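/- \textbf{Moser's theorem on formal schemes.} Let $Y$ be a smooth variety over $\mathbb{C}$ (a smooth, separated, quasi-compact scheme over $\mathbb C$, not necessarily connected), let $\pi : X \to Y$ be the total space of a vector bundle of finite rank over $Y$, and regard $Y$ as a closed subvariety of $X$ via the zero section. Let $\mathcal{I} \subset \mathcal{O}_X$ be the ideal sheaf of $Y$. Put $\mathcal{O}_{\hat X} = \varprojlim_n \mathcal{O}_X/\mathcal{I}^n$, a sheaf of $\mathbb{C}$-algebras on $Y$, let $\hat{\mathcal{I}} = \varprojlim_n \mathcal{I}/\mathcal{I}^n \subset \mathcal{O}_{\hat X}$ be the completion of $\mathcal{I}$ (so that $\mathcal{O}_{\hat X}/\hat{\mathcal{I}} = \mathcal{O}_X/\mathcal{I}$), and put $\Omega^k_{\hat X} = \varprojlim_n \Omega^k_X/\mathcal{I}^n\Omega^k_X$, where $\Omega^k_X$ is the sheaf of algebraic $k$-forms over $\mathbb{C}$. The differential $d : \mathcal{O}_X \to \Omega^1_X$ and the wedge product extend by continuity to the completions, and an automorphism $\Phi$ of the sheaf of $\mathbb{C}$-algebras $\mathcal{O}_{\hat X}$ that preserves $\hat{\mathcal{I}}$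 acts on completed forms by $\Phi^*(a\, db_1 \wedge \dots \wedge db_k) = \Phi(a)\, d\Phi(b_1) \wedge \dots \wedge d\Phi(b_k)$. Let $\omega_0, \omega_1 \in H^0(X, \Omega^2_X)$ be two symplectic forms on $X$ (closed nondegenerate algebraic $2$-forms) such that $(\omega_0 - \omega_1)_y = 0$ in the fibre of $\Omega^2_X$ at $y$ for all $y \in Y$. Then there is an automorphism $\Phi$ of the sheaf of $\mathbb{C}$-algebras $\mathcal{O}_{\hat X}$ that preserves $\hat{\mathcal{I}}$, induces the identity on $\mathcal{O}_X/\mathcal{I}$, and satisfies $\Phi^*\omega_1 = \omega_0$, where $\omega_0, \omega_1$ are viewed as elements of $\Omega^2_{\hat X}$. -/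

import Mathlib

open CategoryTheory AlgebraicGeometry

noncomputable section

namespace FormalMoser

/-! ## Algebraic differential forms -/

section DeRham

variable (R A : Type*) [CommRing R] [CommRing A] [Algebra R A]

/-- The module `Ω^k` of algebraic `k`-forms of an `R`-algebra `A`. -/
abbrev Form (k : ℕ) : Type _ := ⋀[A]^k (Ω[A⁄R])

/-- The algebra of all algebraic differential forms. -/
abbrev Forms : Type _ := ExteriorAlgebra A (Ω[A⁄R])

/-- A differential `da`, as an element of the algebra of all forms. -/
abbrev dForm (a : A) : Forms R A := ExteriorAlgebra.ι A (KaehlerDifferential.D R A a)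

variable {R A} in
theorem iota_anticomm (x y : Ω[A⁄R]) :
    ExteriorAlgebra.ι A x * ExteriorAlgebra.ι A y =
      -(ExteriorAlgebra.ι A y * ExteriorAlgebra.ι A x) :=
  eq_neg_of_add_eq_zero_left (ExteriorAlgebra.ι_add_mul_swap x y)

/-- Pairs of forms `(x, y)`, with the `A`-module structure `a • (x, y) = (a x, da ∧ x + a y)`;
a map `x ↦ (x, d x)` into it is `A`-linear exactly if `d` satisfies the Leibniz rule. -/
def Jet : Type _ := Forms R A × Forms R A

instance : AddCommGroup (Jet R A) := inferInstanceAs (AddCommGroup (Forms R A × Forms R A))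

instance : Module A (Jet R A) where
  smul a p := (a • p.1, dForm R A a * p.1 + a • p.2)
  one_smul p := Prod.ext (one_smul A p.1) (by
    change dForm R A 1 * p.1 + (1 : A) • p.2 = p.2
    simp [dForm])
  mul_smul a b p := Prod.ext (mul_smul a b p.1) (by
    change dForm R A (a * b) * p.1 + (a * b) • p.2
      = dForm R A a * (b • p.1) + a • (dForm R A b * p.1 + b • p.2)
    simp only [dForm, Derivation.leibniz, map_add, map_smul, add_mul, smul_mul_assoc,
      mul_smul_comm, smul_add, mul_smul]
    abel)
  smul_zero a := Prod.ext (smul_zero a) (by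
    change dForm R A a * 0 + a • (0 : Forms R A) = 0
    simp)
  smul_add a p q := Prod.ext (smul_add a p.1 q.1) (by
    change dForm R A a * (p.1 + q.1) + a • (p.2 + q.2)
      = (dForm R A a * p.1 + a • p.2) + (dForm R A a * q.1 + a • q.2)
    rw [mul_add, smul_add]; abel)
  add_smul a b p := Prod.ext (add_smul a b p.1) (by
    change dForm R A (a + b) * p.1 + (a + b) • p.2
      = (dForm R A a * p.1 + a • p.2) + (dForm R A b * p.1 + b • p.2)
    simp only [dForm, map_add, add_mul, add_smul]; abel)
  zero_smul p := Prod.ext (zero_smul A p.1) (by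
    change dForm R A 0 * p.1 + (0 : A) • p.2 = 0
    simp [dForm])

theorem Jet.smul_fst (a : A) (p : Jet R A) : (a • p).1 = a • p.1 := rfl

theorem Jet.smul_snd (a : A) (p : Jet R A) : (a • p).2 = dForm R A a * p.1 + a • p.2 := rfl

theorem Jet.add_fst (p q : Jet R A) : (p + q).1 = p.1 + q.1 := rfl

theorem Jet.add_snd (p q : Jet R A) : (p + q).2 = p.2 + q.2 := rfl

instance : Module R (Jet R A) := Module.compHom (Jet R A) (algebraMap R A)

instance : IsScalarTower R A (Jet R A) where
  smul_assoc r a p := by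
    rw [Algebra.smul_def, mul_smul]; rfl

/-- `b ↦ (db, d(db)) = (db, 0)`. -/
def jetDerivation : Derivation R A (Jet R A) where
  toFun b := ((dForm R A b, 0) : Forms R A × Forms R A)
  map_add' a b := Prod.ext (by
    change dForm R A (a + b) = dForm R A a + dForm R A b
    simp [dForm]) (by
    change (0 : Forms R A) = 0 + 0
    simp)
  map_smul' r b := Prod.ext (by
    change dForm R A (r • b) = algebraMap R A r • dForm R A b
    simp [dForm]) (by
    change (0 : Forms R A) = dForm R A (algebraMap R A r) * _ + algebraMap R A r • 0
    simp [dForm])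
  map_one_eq_zero' := Prod.ext (by
    change dForm R A 1 = 0
    simp [dForm]) rfl
  leibniz' a b := Prod.ext (by
    change dForm R A (a * b) = a • dForm R A b + b • dForm R A a
    simp [dForm]) (by
    change (0 : Forms R A) = (dForm R A a * dForm R A b + a • 0)
      + (dForm R A b * dForm R A a + b • 0)
    simp [dForm, ExteriorAlgebra.ι_add_mul_swap])

/-- `m ↦ (m, dm)` on 1-forms. -/
def jetOne : Ω[A⁄R] →ₗ[A] Jet R A := (jetDerivation R A).liftKaehlerDifferential

theorem jetOne_D (b : A) :
    jetOne R A (KaehlerDifferential.D R A b) = ((dForm R A b, 0) : Forms R A × Forms R A) :=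
  (jetDerivation R A).liftKaehlerDifferential_comp_D b

/-- The exterior derivative of 1-forms: `d (a db) = da ∧ db`. -/
def dOne (m : Ω[A⁄R]) : Forms R A := (jetOne R A m).2

theorem dOne_add (m n : Ω[A⁄R]) : dOne R A (m + n) = dOne R A m + dOne R A n := by
  rw [dOne, map_add]; rfl

theorem form_induction {p : Ω[A⁄R] → Prop} (h0 : p 0) (hadd : ∀ x y, p x → p y → p (x + y))
    (hD : ∀ a b : A, p (a • KaehlerDifferential.D R A b)) (m : Ω[A⁄R]) : p m := by
  have hm : m ∈ Submodule.span A (Set.range (KaehlerDifferential.D R A)) := by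
    rw [KaehlerDifferential.span_range_derivation]; trivial
  refine Submodule.closure_induction (p := fun x _ => p x) h0 (fun x y _ _ => hadd x y) ?_ hm
  intro a x ⟨b, hb⟩
  exact hb ▸ hD a b

theorem jetOne_fst (m : Ω[A⁄R]) : (jetOne R A m).1 = ExteriorAlgebra.ι A m := by
  induction m using form_induction with
  | h0 => simp; rfl
  | hadd x y hx hy => rw [map_add, Jet.add_fst, hx, hy, map_add]
  | hD a b => rw [map_smul, Jet.smul_fst, jetOne_D, map_smul]

theorem dOne_smul (a : A) (m : Ω[A⁄R]) :
    dOne R A (a • m) = dForm R A a * ExteriorAlgebra.ι A m + a • dOne R A m := by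
  rw [dOne, map_smul, Jet.smul_snd, jetOne_fst]; rfl

theorem dOne_smul_D (a b : A) :
    dOne R A (a • KaehlerDifferential.D R A b) = dForm R A a * dForm R A b := by
  rw [dOne_smul, dOne, jetOne_D]
  change _ + a • (0 : Forms R A) = _
  simp

theorem dOne_commute (m n : Ω[A⁄R]) :
    dOne R A m * ExteriorAlgebra.ι A n = ExteriorAlgebra.ι A n * dOne R A m := by
  induction m using form_induction with
  | h0 =>
    have h : dOne R A 0 = 0 := by rw [dOne, map_zero]; rfl
    simp [h]
  | hadd x y hx hy => rw [dOne_add, add_mul, mul_add, hx, hy]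
  | hD a b =>
    rw [dOne_smul_D, mul_assoc, iota_anticomm _ n, mul_neg, ← mul_assoc, iota_anticomm _ n,
      neg_mul, neg_neg, mul_assoc]

/-- Left multiplication by a 1-form `m` on pairs `(x, dx)`:
`(m ∧ x, d(m ∧ x)) = (m ∧ x, dm ∧ x - m ∧ dx)`. -/
def jetMul : Ω[A⁄R] →ₗ[A] Jet R A →ₗ[A] Jet R A :=
  LinearMap.mk₂ A
    (fun m p => ((ExteriorAlgebra.ι A m * p.1, dOne R A m * p.1 - ExteriorAlgebra.ι A m * p.2) :
      Forms R A × Forms R A))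
    (fun m n p => Prod.ext (by
        change ExteriorAlgebra.ι A (m + n) * p.1 = _ * p.1 + _ * p.1
        rw [map_add, add_mul]) (by
        change dOne R A (m + n) * p.1 - ExteriorAlgebra.ι A (m + n) * p.2
          = (dOne R A m * p.1 - _ * p.2) + (dOne R A n * p.1 - _ * p.2)
        rw [map_add, dOne_add, add_mul, add_mul]; abel))
    (fun a m p => Prod.ext (by
        change ExteriorAlgebra.ι A (a • m) * p.1 = a • (_ * p.1)
        rw [map_smul, smul_mul_assoc]) (by
        change dOne R A (a • m) * p.1 - ExteriorAlgebra.ι A (a • m) * p.2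
          = dForm R A a * (ExteriorAlgebra.ι A m * p.1)
            + a • (dOne R A m * p.1 - ExteriorAlgebra.ι A m * p.2)
        rw [map_smul, dOne_smul, add_mul, smul_mul_assoc, smul_mul_assoc, smul_sub, mul_assoc]
        abel))
    (fun m p q => Prod.ext (mul_add _ _ _) (by
        change dOne R A m * (p.1 + q.1) - ExteriorAlgebra.ι A m * (p.2 + q.2)
          = (dOne R A m * p.1 - _ * p.2) + (dOne R A m * q.1 - _ * q.2)
        rw [mul_add, mul_add]; abel))
    (fun a m p => Prod.ext (mul_smul_comm _ _ _) (by
        change dOne R A m * (a • p.1) - ExteriorAlgebra.ι A m * (dForm R A a * p.1 + a • p.2)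
          = dForm R A a * (ExteriorAlgebra.ι A m * p.1)
            + a • (dOne R A m * p.1 - ExteriorAlgebra.ι A m * p.2)
        rw [mul_add, ← mul_assoc (ExteriorAlgebra.ι A m), iota_anticomm m, mul_smul_comm,
          mul_smul_comm, smul_sub, neg_mul, mul_assoc]
        abel))

theorem jetMul_apply (m : Ω[A⁄R]) (p : Jet R A) :
    jetMul R A m p = ((ExteriorAlgebra.ι A m * p.1,
      dOne R A m * p.1 - ExteriorAlgebra.ι A m * p.2) : Forms R A × Forms R A) := rfl

theorem jetMul_jetMul (m : Ω[A⁄R]) (p : Jet R A) :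
    jetMul R A m (jetMul R A m p) = (0 : QuadraticForm A (Ω[A⁄R])) m • p := by
  rw [show (0 : QuadraticForm A (Ω[A⁄R])) m = 0 from rfl, zero_smul, jetMul_apply, jetMul_apply]
  refine Prod.ext ?_ ?_
  · change ExteriorAlgebra.ι A m * (ExteriorAlgebra.ι A m * p.1) = 0
    rw [← mul_assoc, ExteriorAlgebra.ι_sq_zero, zero_mul]
  · change dOne R A m * (ExteriorAlgebra.ι A m * p.1)
      - ExteriorAlgebra.ι A m * (dOne R A m * p.1 - ExteriorAlgebra.ι A m * p.2) = 0
    rw [mul_sub, ← mul_assoc, ← mul_assoc, ← mul_assoc, ExteriorAlgebra.ι_sq_zero,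
      dOne_commute, zero_mul]
    abel

/-- The pair `(1, d1) = (1, 0)`. -/
def jetUnit : Jet R A := ((1, 0) : Forms R A × Forms R A)

/-- `x ↦ (x, dx)` on all forms, determined by `1 ↦ (1, 0)` and
`m ∧ x ↦ (m ∧ x, dm ∧ x - m ∧ dx)` for every 1-form `m`. -/
def jet : Forms R A →ₗ[A] Jet R A :=
  CliffordAlgebra.foldr (0 : QuadraticForm A (Ω[A⁄R])) (jetMul R A) (jetMul_jetMul R A)
    (jetUnit R A)

/-- The exterior derivative (de Rham differential) on algebraic differential forms. -/
def extDer (x : Forms R A) : Forms R A := (jet R A x).2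

theorem jet_iota_mul (m : Ω[A⁄R]) (x : Forms R A) :
    jet R A (ExteriorAlgebra.ι A m * x) = jetMul R A m (jet R A x) := by
  have h := CliffordAlgebra.foldr_mul (0 : QuadraticForm A (Ω[A⁄R])) (jetMul R A)
    (jetMul_jetMul R A) (jetUnit R A) (CliffordAlgebra.ι 0 m) x
  rw [CliffordAlgebra.foldr_ι] at h
  exact h

theorem jet_fst (x : Forms R A) : (jet R A x).1 = x := by
  induction x using CliffordAlgebra.left_induction with
  | algebraMap a =>
    have h : jet R A (algebraMap A _ a) = a • jetUnit R A :=
      CliffordAlgebra.foldr_algebraMap _ _ _ _ a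
    rw [h, Jet.smul_fst, Algebra.algebraMap_eq_smul_one]; rfl
  | add x y hx hy => rw [map_add, Jet.add_fst, hx, hy]
  | ι_mul x m hx =>
    have h := congrArg Prod.fst (jet_iota_mul R A m x)
    rw [jetMul_apply, hx] at h
    exact h

theorem extDer_add (x y : Forms R A) : extDer R A (x + y) = extDer R A x + extDer R A y := by
  rw [extDer, map_add]; rfl

theorem extDer_smul (a : A) (x : Forms R A) :
    extDer R A (a • x) = dForm R A a * x + a • extDer R A x := by
  rw [extDer, map_smul, Jet.smul_snd, jet_fst]; rfl

theorem extDer_one : extDer R A 1 = 0 :=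
  congrArg Prod.snd (CliffordAlgebra.foldr_one (0 : QuadraticForm A (Ω[A⁄R])) (jetMul R A)
    (jetMul_jetMul R A) (jetUnit R A))

theorem extDer_dForm_mul (b : A) (x : Forms R A) :
    extDer R A (dForm R A b * x) = -(dForm R A b * extDer R A x) := by
  have h := congrArg Prod.snd (jet_iota_mul R A (KaehlerDifferential.D R A b) x)
  have hb : dOne R A (KaehlerDifferential.D R A b) = 0 := congrArg Prod.snd (jetOne_D R A b)
  rw [jetMul_apply, hb, zero_mul, zero_sub] at h
  exact h

/-- In degree 2 the differential is the usual one: `d (a db ∧ dc) = da ∧ db ∧ dc`. -/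
theorem extDer_two (a b c : A) :
    extDer R A (a • (dForm R A b * dForm R A c)) =
      dForm R A a * (dForm R A b * dForm R A c) := by
  have hc : extDer R A (dForm R A c) = 0 := by
    have h := extDer_dForm_mul R A c 1
    rwa [mul_one, extDer_one, mul_zero, neg_zero] at h
  rw [extDer_smul, extDer_dForm_mul, hc, mul_zero, neg_zero, smul_zero, add_zero]

variable {R A}

/-- The contraction `ι_v x` of a form with a vector field (an `R`-derivation of `A`). -/
def contract (v : Derivation R A A) (x : Forms R A) : Forms R A :=
  CliffordAlgebra.contractLeft (Q := (0 : QuadraticForm A (Ω[A⁄R])))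
    (v.liftKaehlerDifferential : Module.Dual A (Ω[A⁄R])) x

/-- A 2-form is symplectic if it is closed and nondegenerate: contraction with it is a bijection
from vector fields to 1-forms. -/
structure IsSymplecticForm (ω : Form R A 2) : Prop where
  closed : extDer R A (ω : Forms R A) = 0
  nondegenerate : ∀ α : Ω[A⁄R], ∃! v : Derivation R A A,
    contract v (ω : Forms R A) = ExteriorAlgebra.ι A α

end DeRham

/-! ## Pullback of forms -/

section Pullback

variable {R A B N₁ N₂ : Type*} [CommRing R] [CommRing A] [CommRing B] [Algebra R A] [Algebra R B]
  [AddCommGroup N₁] [Module R N₁] [Module B N₁] [IsScalarTower R B N₁]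
  [AddCommGroup N₂] [Module B N₂]

/-- For a ring map `ψ : A → B` and a derivation `D : B → N₁`, the `ψ`-semilinear map
`a db ↦ ψ(a) D(ψ(b))` on 1-forms. -/
def pullbackOne (ψ : A →ₐ[R] B) (D : Derivation R B N₁) : Ω[A⁄R] →ₛₗ[ψ.toRingHom] N₁ :=
  letI : Algebra A B := ψ.toRingHom.toAlgebra
  letI : Module A N₁ := Module.compHom N₁ ψ.toRingHom
  haveI : IsScalarTower A B N₁ := ⟨fun a b n => mul_smul (ψ a) b n⟩
  haveI : IsScalarTower R A B := IsScalarTower.of_algebraMap_eq fun r => (ψ.commutes r).symm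
  haveI : IsScalarTower R A N₁ := ⟨fun r a n => by
    change ψ (r • a) • n = r • (ψ a • n)
    rw [map_smul, smul_assoc]⟩
  let L : Ω[A⁄R] →ₗ[A] N₁ := (D.compAlgebraMap A).liftKaehlerDifferential
  { toFun := L, map_add' := L.map_add, map_smul' := L.map_smul }

theorem pullbackOne_D (ψ : A →ₐ[R] B) (D : Derivation R B N₁) (a : A) :
    pullbackOne ψ D (KaehlerDifferential.D R A a) = D (ψ a) := by
  let : Algebra A B := ψ.toRingHom.toAlgebra
  let : Module A N₁ := Module.compHom N₁ ψ.toRingHom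
  have : IsScalarTower A B N₁ := ⟨fun a b n => mul_smul (ψ a) b n⟩
  have : IsScalarTower R A B := IsScalarTower.of_algebraMap_eq fun r => (ψ.commutes r).symm
  have : IsScalarTower R A N₁ := ⟨fun r a n => by
    change ψ (r • a) • n = r • (ψ a • n)
    rw [map_smul, smul_assoc]⟩
  exact (D.compAlgebraMap A).liftKaehlerDifferential_comp_D a

/-- With in addition a `B`-multilinear alternating product `w : N₁ × ⋯ × N₁ → N₂`, the
`ψ`-semilinear map `a db₁ ∧ ⋯ ∧ dbₖ ↦ ψ(a) w(D(ψ(b₁)), …, D(ψ(bₖ)))` on `k`-forms. -/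
def pullback {k : ℕ} (ψ : A →ₐ[R] B) (D : Derivation R B N₁) (w : N₁ [⋀^Fin k]→ₗ[B] N₂) :
    Form R A k →ₛₗ[ψ.toRingHom] N₂ :=
  letI : Module A N₂ := Module.compHom N₂ ψ.toRingHom
  let W : Ω[A⁄R] [⋀^Fin k]→ₗ[A] N₂ :=
    { toFun := fun m => w fun i => pullbackOne ψ D (m i)
      map_update_add' := fun m i x y => by
        have h (z) : (fun j => pullbackOne ψ D (Function.update m i z j)) =
            Function.update (fun j => pullbackOne ψ D (m j)) i (pullbackOne ψ D z) := by
          ext j; by_cases hj : j = i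
          · subst hj; simp
          · simp [hj]
        have e := Subsingleton.elim ‹DecidableEq (Fin k)› (instDecidableEqFin k)
        subst e
        simp only [h, map_add, w.map_update_add]
      map_update_smul' := fun m i c x => by
        have h (z) : (fun j => pullbackOne ψ D (Function.update m i z j)) =
            Function.update (fun j => pullbackOne ψ D (m j)) i (pullbackOne ψ D z) := by
          ext j; by_cases hj : j = i
          · subst hj; simp
          · simp [hj]
        have e := Subsingleton.elim ‹DecidableEq (Fin k)› (instDecidableEqFin k)
        subst e
        simp only [h, LinearMap.map_smulₛₗ, w.map_update_smul]
        rfl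
      map_eq_zero_of_eq' := fun m i j hij hne =>
        w.map_eq_zero_of_eq _ (by simp [hij]) hne }
  let L : Form R A k →ₗ[A] N₂ := exteriorPower.alternatingMapLinearEquiv W
  { toFun := L, map_add' := L.map_add, map_smul' := L.map_smul }

theorem pullback_iotaMulti {k : ℕ} (ψ : A →ₐ[R] B) (D : Derivation R B N₁)
    (w : N₁ [⋀^Fin k]→ₗ[B] N₂) (m : Fin k → Ω[A⁄R]) :
    pullback ψ D w (exteriorPower.ιMulti A k m) = w fun i => pullbackOne ψ D (m i) := by
  let : Module A N₂ := Module.compHom N₂ ψ.toRingHom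
  exact exteriorPower.alternatingMapLinearEquiv_apply_ιMulti _ m

/-- The pullback `Ω^k_A → Ω^k_B` of algebraic forms along a homomorphism of `R`-algebras. -/
def mapForm {k : ℕ} (ψ : A →ₐ[R] B) : Form R A k →ₛₗ[ψ.toRingHom] Form R B k :=
  pullback ψ (KaehlerDifferential.D R B) (exteriorPower.ιMulti B k)

end Pullback

/-! ## Forms on a formal completion -/

section Completion

variable {R A : Type*} [CommRing R] [CommRing A] [Algebra R A] (I : Ideal A)

/-- Completed forms `lim_n Ω^k / I^n Ω^k`. -/
abbrev CompletedForm (R : Type*) {A : Type*} [CommRing R] [CommRing A] [Algebra R A]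
    (I : Ideal A) (k : ℕ) : Type _ :=
  AdicCompletion I (Form R A k)

theorem D_mem (n : ℕ) {a : A} (ha : a ∈ I ^ (n + 1)) :
    KaehlerDifferential.D R A a ∈ (I ^ n • ⊤ : Submodule A (Ω[A⁄R])) := by
  induction n generalizing a with
  | zero => simp
  | succ n ih =>
    rw [pow_succ] at ha
    induction ha using Submodule.mul_induction_on' with
    | mem_mul_mem x hx y hy =>
      rw [Derivation.leibniz]
      refine add_mem (Submodule.smul_mem_smul hx trivial) ?_
      rw [pow_succ', Submodule.mul_smul]
      exact Submodule.smul_mem_smul hy (ih hx)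
    | add x _ y _ hx hy => rw [map_add]; exact add_mem hx hy

theorem exists_rep {M : Type*} [AddCommGroup M] [Module A M] (x : AdicCompletion I M) (n : ℕ) :
    ∃ m : M, Submodule.Quotient.mk (p := (I ^ n • ⊤ : Submodule A M)) m = x.val n :=
  Submodule.Quotient.mk_surjective _ _

theorem rep_mono {M : Type*} [AddCommGroup M] [Module A M] (x : AdicCompletion I M) {m n : ℕ}
    (hmn : m ≤ n) {a : M} (ha : Submodule.Quotient.mk (p := (I ^ n • ⊤ : Submodule A M)) a
      = x.val n) : Submodule.Quotient.mk (p := (I ^ m • ⊤ : Submodule A M)) a = x.val m := by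
  have h := x.property hmn
  change AdicCompletion.transitionMap I M hmn (x.val n) = _ at h
  rw [← h, ← ha]
  rfl

theorem rep_smul {M : Type*} [AddCommGroup M] [Module A M] (x : AdicCompletion I A)
    (y : AdicCompletion I M) (n : ℕ) {a : A} {m : M}
    (ha : Submodule.Quotient.mk (p := (I ^ n • ⊤ : Submodule A A)) a = x.val n)
    (hm : Submodule.Quotient.mk (p := (I ^ n • ⊤ : Submodule A M)) m = y.val n) :
    Submodule.Quotient.mk (p := (I ^ n • ⊤ : Submodule A M)) (a • m) = (x • y).val n := by
  change _ = x.val n • y.val n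
  rw [← ha, ← hm]
  rfl

instance : IsScalarTower R (AdicCompletion I A) (AdicCompletion I (Ω[A⁄R])) where
  smul_assoc r x y := AdicCompletion.ext fun n => by
    obtain ⟨a, ha⟩ := exists_rep I x n
    obtain ⟨m, hm⟩ := exists_rep I y n
    have hr : Submodule.Quotient.mk (p := (I ^ n • ⊤ : Submodule A A)) (r • a) = (r • x).val n := by
      rw [Submodule.Quotient.mk_smul, ha]; rfl
    rw [← rep_smul I (r • x) y n hr hm, smul_assoc, Submodule.Quotient.mk_smul,
      rep_smul I x y n ha hm]
    rfl

/-- The value modulo `I ^ n` of the completed differential. -/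
def completedDFun (a : AdicCompletion I A) (n : ℕ) :
    Ω[A⁄R] ⧸ (I ^ n • ⊤ : Submodule A (Ω[A⁄R])) :=
  Submodule.Quotient.mk (KaehlerDifferential.D R A (exists_rep I a (n + 1)).choose)

theorem completedDFun_eq (a : AdicCompletion I A) (n : ℕ) {b : A}
    (hb : Submodule.Quotient.mk (p := (I ^ (n + 1) • ⊤ : Submodule A A)) b = a.val (n + 1)) :
    completedDFun (R := R) I a n = Submodule.Quotient.mk (KaehlerDifferential.D R A b) := by
  refine (Submodule.Quotient.eq _).2 ?_
  rw [← map_sub]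
  refine D_mem I n ?_
  have h := (Submodule.Quotient.eq _).1 ((exists_rep I a (n + 1)).choose_spec.trans hb.symm)
  simpa using h

/-- The continuous extension of `d : A → Ω^1` to the completions. -/
def completedD (R : Type*) {A : Type*} [CommRing R] [CommRing A] [Algebra R A] (I : Ideal A) :
    Derivation R (AdicCompletion I A) (AdicCompletion I (Ω[A⁄R])) where
  toFun a := ⟨completedDFun I a, fun {m n} hmn => by
    obtain ⟨b, hb⟩ := exists_rep I a (n + 1)
    rw [completedDFun_eq I a n hb,
      completedDFun_eq I a m (rep_mono I a (Nat.succ_le_succ hmn) hb)]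
    rfl⟩
  map_add' x y := AdicCompletion.ext fun n => by
    obtain ⟨a, ha⟩ := exists_rep I x (n + 1)
    obtain ⟨b, hb⟩ := exists_rep I y (n + 1)
    change completedDFun (R := R) I (x + y) n =
      completedDFun (R := R) I x n + completedDFun (R := R) I y n
    rw [completedDFun_eq I x n ha, completedDFun_eq I y n hb,
      completedDFun_eq I (x + y) n (b := a + b) (by
        rw [Submodule.Quotient.mk_add, ha, hb]; rfl), map_add, Submodule.Quotient.mk_add]
  map_smul' r x := AdicCompletion.ext fun n => by
    obtain ⟨a, ha⟩ := exists_rep I x (n + 1)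
    change completedDFun (R := R) I (r • x) n = r • completedDFun (R := R) I x n
    rw [completedDFun_eq I x n ha, completedDFun_eq I (r • x) n (b := r • a) (by
        rw [Submodule.Quotient.mk_smul, ha]; rfl), Derivation.map_smul,
        Submodule.Quotient.mk_smul]
  map_one_eq_zero' := AdicCompletion.ext fun n => by
    change completedDFun (R := R) I 1 n = 0
    rw [completedDFun_eq I 1 n (b := 1) rfl, Derivation.map_one_eq_zero,
      Submodule.Quotient.mk_zero]
  leibniz' x y := AdicCompletion.ext fun n => by
    obtain ⟨a, ha⟩ := exists_rep I x (n + 1)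
    obtain ⟨b, hb⟩ := exists_rep I y (n + 1)
    have hx : Submodule.Quotient.mk (KaehlerDifferential.D R A a) = completedDFun (R := R) I x n :=
      (completedDFun_eq I x n ha).symm
    have hy : Submodule.Quotient.mk (KaehlerDifferential.D R A b) = completedDFun (R := R) I y n :=
      (completedDFun_eq I y n hb).symm
    change completedDFun (R := R) I (x * y) n =
      x.val n • completedDFun (R := R) I y n + y.val n • completedDFun (R := R) I x n
    rw [completedDFun_eq I (x * y) n (b := a * b) (rep_smul I x y (n + 1) ha hb),
      Derivation.leibniz, Submodule.Quotient.mk_add, ← hx, ← hy,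
      ← rep_mono I x (Nat.le_succ n) ha, ← rep_mono I y (Nat.le_succ n) hb]
    rfl

theorem alternating_congr {M N : Type*} [AddCommGroup M] [Module A M] [AddCommGroup N]
    [Module A N] {k : ℕ} (f : M [⋀^Fin k]→ₗ[A] N) (J : Ideal A) {v w : Fin k → M}
    (h : ∀ i, v i - w i ∈ (J • ⊤ : Submodule A M)) : f v - f w ∈ (J • ⊤ : Submodule A N) := by
  have key (u : Fin k → M) (i : Fin k) (x : M) (hx : x ∈ (J • ⊤ : Submodule A M)) :
      f (Function.update u i x) ∈ (J • ⊤ : Submodule A N) := by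
    induction hx using Submodule.smul_induction_on' with
    | smul r hr n _ => rw [f.map_update_smul]; exact Submodule.smul_mem_smul hr trivial
    | add x _ y _ hx hy => rw [f.map_update_add]; exact add_mem hx hy
  have main (s : Finset (Fin k)) : f (s.piecewise v w) - f w ∈ (J • ⊤ : Submodule A N) := by
    induction s using Finset.induction_on with
    | empty => simp
    | insert i s hi ih =>
      have e : f ((insert i s).piecewise v w) - f (s.piecewise v w) ∈
          (J • ⊤ : Submodule A N) := by
        have h1 : s.piecewise v w = Function.update (s.piecewise v w) i (w i) := by
          rw [eq_comm, Function.update_eq_self_iff, Finset.piecewise_eq_of_notMem _ _ _ hi]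
        rw [Finset.piecewise_insert]
        nth_rewrite 2 [h1]
        rw [← f.map_update_sub]
        exact key _ i _ (h i)
      simpa using add_mem e ih
  simpa using main Finset.univ

/-- The value modulo `I ^ n` of the completion of a multilinear map. -/
def completedAlternatingFun {M N : Type*} [AddCommGroup M] [Module A M] [AddCommGroup N]
    [Module A N] {k : ℕ} (f : M [⋀^Fin k]→ₗ[A] N) (v : Fin k → AdicCompletion I M) (n : ℕ) :
    N ⧸ (I ^ n • ⊤ : Submodule A N) :=
  Submodule.Quotient.mk (f fun i => (exists_rep I (v i) n).choose)

theorem completedAlternatingFun_eq {M N : Type*} [AddCommGroup M] [Module A M] [AddCommGroup N]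
    [Module A N] {k : ℕ} (f : M [⋀^Fin k]→ₗ[A] N) (v : Fin k → AdicCompletion I M) (n : ℕ)
    {m : Fin k → M}
    (hm : ∀ i, Submodule.Quotient.mk (p := (I ^ n • ⊤ : Submodule A M)) (m i) = (v i).val n) :
    completedAlternatingFun I f v n = Submodule.Quotient.mk (f m) :=
  (Submodule.Quotient.eq _).2 <| alternating_congr f _ fun i =>
    (Submodule.Quotient.eq _).1 ((exists_rep I (v i) n).choose_spec.trans (hm i).symm)

/-- The continuous extension of an alternating map to the completions. -/
def completedAlternating {M N : Type*} [AddCommGroup M] [Module A M] [AddCommGroup N]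
    [Module A N] {k : ℕ} (f : M [⋀^Fin k]→ₗ[A] N) :
    AdicCompletion I M [⋀^Fin k]→ₗ[AdicCompletion I A] AdicCompletion I N where
  toFun v := ⟨completedAlternatingFun I f v, fun {m n} hmn => by
    choose a ha using fun i => exists_rep I (v i) n
    rw [completedAlternatingFun_eq I f v n ha,
      completedAlternatingFun_eq I f v m fun i => rep_mono I (v i) hmn (ha i)]
    rfl⟩
  map_update_add' {inst} v i x y := AdicCompletion.ext fun n => by
    obtain rfl := Subsingleton.elim inst (instDecidableEqFin k)
    choose a ha using fun i => exists_rep I (v i) n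
    obtain ⟨b, hb⟩ := exists_rep I x n
    obtain ⟨c, hc⟩ := exists_rep I y n
    have h (z : AdicCompletion I M) (d : M)
        (hd : Submodule.Quotient.mk (p := (I ^ n • ⊤ : Submodule A M)) d = z.val n) :=
      completedAlternatingFun_eq I f (Function.update v i z) n (m := Function.update a i d)
        fun j => by
          by_cases hj : j = i
          · subst hj; simpa using hd
          · simpa [hj] using ha j
    change completedAlternatingFun I f (Function.update v i (x + y)) n =
      completedAlternatingFun I f (Function.update v i x) n +
        completedAlternatingFun I f (Function.update v i y) n
    rw [h x b hb, h y c hc, h (x + y) (b + c) (by rw [Submodule.Quotient.mk_add, hb, hc]; rfl),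
      f.map_update_add, Submodule.Quotient.mk_add]
  map_update_smul' {inst} v i r x := AdicCompletion.ext fun n => by
    obtain rfl := Subsingleton.elim inst (instDecidableEqFin k)
    choose a ha using fun i => exists_rep I (v i) n
    obtain ⟨b, hb⟩ := exists_rep I x n
    obtain ⟨c, hc⟩ := exists_rep I r n
    have h (z : AdicCompletion I M) (d : M)
        (hd : Submodule.Quotient.mk (p := (I ^ n • ⊤ : Submodule A M)) d = z.val n) :=
      completedAlternatingFun_eq I f (Function.update v i z) n (m := Function.update a i d)
        fun j => by
          by_cases hj : j = i
          · subst hj; simpa using hd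
          · simpa [hj] using ha j
    change completedAlternatingFun I f (Function.update v i (r • x)) n =
      r.val n • completedAlternatingFun I f (Function.update v i x) n
    rw [h x b hb, h (r • x) (c • b) (rep_smul I r x n hc hb), f.map_update_smul, ← hc]
    rfl
  map_eq_zero_of_eq' v i j hij hne := AdicCompletion.ext fun n => by
    choose a ha using fun x : AdicCompletion I M => exists_rep I x n
    change completedAlternatingFun I f v n = 0
    rw [completedAlternatingFun_eq I f v n (m := fun i => a (v i)) fun i => ha (v i),
      f.map_eq_zero_of_eq _ (by rw [hij]) hne, Submodule.Quotient.mk_zero]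

/-- The pullback `Ω^k → lim_n Ω^k / I^n Ω^k` of algebraic forms along an algebra homomorphism `ψ`
from `A` to its completion: `a db₁ ∧ ⋯ ∧ dbₖ ↦ ψ(a) dψ(b₁) ∧ ⋯ ∧ dψ(bₖ)`. -/
def formalPullback {k : ℕ} (ψ : A →ₐ[R] AdicCompletion I A) :
    Form R A k →ₛₗ[ψ.toRingHom] CompletedForm R I k :=
  pullback ψ (completedD R I) (completedAlternating I (exteriorPower.ιMulti A k))

/-- The canonical homomorphism from `A` to its completion. -/
def toCompletion (R : Type*) {A : Type*} [CommRing R] [CommRing A] [Algebra R A] (I : Ideal A) :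
    A →ₐ[R] AdicCompletion I A where
  __ := algebraMap A (AdicCompletion I A)
  commutes' _ := rfl

/-- The homomorphism of completions induced by a homomorphism `f : A → B` with `f(I) ⊆ J`. -/
def mapCompletion {B : Type*} [CommRing B] {I : Ideal A} {J : Ideal B} (f : A →+* B)
    (h : I ≤ J.comap f) : AdicCompletion I A →+* AdicCompletion J B :=
  AdicCompletion.liftRingHom J
    (fun n => (Ideal.quotientMap (J ^ n) f (by
      rw [← Ideal.map_le_iff_le_comap, Ideal.map_pow]
      exact Ideal.pow_right_mono (Ideal.map_le_iff_le_comap.2 h) n)).comp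
        (AdicCompletion.evalₐ I n : AdicCompletion I A →+* A ⧸ I ^ n))
    (fun {m n} hle => by
      ext x
      induction x using AdicCompletion.induction_on with
      | _ r =>
        simp only [RingHom.comp_apply, RingHom.coe_coe, AdicCompletion.evalₐ_mk,
          Ideal.quotientMap_mk]
        exact congrArg (Ideal.quotientMap (J ^ m) f (by
          rw [← Ideal.map_le_iff_le_comap, Ideal.map_pow]
          exact Ideal.pow_right_mono (Ideal.map_le_iff_le_comap.2 h) m))
            (AdicCompletion.Ideal.mk_eq_mk I hle r))

end Completion

/-! ## Complex schemes, vector bundles and formal completions -/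

section Scheme

/-- `Spec ℂ`. -/
abbrev SpecC : Scheme.{0} := Spec (CommRingCat.of ℂ)

/-- The homomorphism `ℂ → Γ(X, U)` given by the structure morphism of a complex scheme. -/
def scalars (X : Scheme.{0}) [X.Over SpecC] (U : X.Opens) : CommRingCat.of ℂ ⟶ Γ(X, U) :=
  (Scheme.ΓSpecIso (CommRingCat.of ℂ)).inv ≫
    (X ↘ SpecC).appLE ⊤ U (show U ≤ (X ↘ SpecC) ⁻¹ᵁ ⊤ from le_top)

/-- Sections of the structure sheaf of a complex scheme form a `ℂ`-algebra. -/
instance sectionsAlgebra (X : Scheme.{0}) [X.Over SpecC] (U : X.Opens) : Algebra ℂ Γ(X, U) :=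
  (scalars X U).hom.toAlgebra

theorem scalars_map (X : Scheme.{0}) [X.Over SpecC] {U V : X.Opens} (h : V ≤ U) :
    scalars X U ≫ X.presheaf.map (homOfLE h).op = scalars X V := by
  simp only [scalars, Category.assoc, Scheme.Hom.appLE_map]

/-- Restriction of sections of the structure sheaf. -/
def res {X : Scheme.{0}} [X.Over SpecC] {U V : X.Opens} (h : V ≤ U) : Γ(X, U) →ₐ[ℂ] Γ(X, V) where
  __ := (X.presheaf.map (homOfLE h).op).hom
  commutes' r := congrArg (fun f : CommRingCat.of ℂ ⟶ Γ(X, V) => f.hom r) (scalars_map X h)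

/-- A global section of `Ω^k_X`: a compatible family of algebraic `k`-forms on the affine opens. -/
structure GlobalForm (X : Scheme.{0}) [X.Over SpecC] (k : ℕ) where
  val : ∀ U : X.affineOpens, Form ℂ Γ(X, U.1) k
  compat : ∀ {U V : X.affineOpens} (h : V.1 ≤ U.1), mapForm (res h) (val U) = val V

/-- A symplectic form on `X`: a global closed nondegenerate 2-form. -/
def GlobalForm.IsSymplectic {X : Scheme.{0}} [X.Over SpecC] (ω : GlobalForm X 2) : Prop :=
  ∀ U : X.affineOpens, IsSymplecticForm (ω.val U)

open TensorProduct in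
/-- `(ω - ω')_x = 0` in the fibre `κ(x) ⊗ Ω^k_X` at the point `x`. -/
def GlobalForm.AgreeAt {X : Scheme.{0}} [X.Over SpecC] {k : ℕ} (ω ω' : GlobalForm X k) (x : X) :
    Prop :=
  ∀ (U : X.affineOpens) (hx : x ∈ U.1),
    letI : Algebra Γ(X, U.1) (X.residueField x) := (X.evaluation U.1 x hx).hom.toAlgebra
    (1 : X.residueField x) ⊗ₜ[Γ(X, U.1)] (ω.val U - ω'.val U) = 0

/-- The structure of a vector bundle (of finite, locally constant rank) on `π : X ⟶ Y`, so that `X`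
is its total space: over the members `U i` of an open cover of `Y` there are fibre coordinates
identifying `π⁻¹(U i)` with the affine space of dimension `rank i` over `U i`, and the coordinates
over two members are related by linear substitutions with coefficients functions on `Y`. The zero
section is the section of `π` on which all fibre coordinates vanish. -/
structure VectorBundleStructure {X Y : Scheme.{0}} (π : X ⟶ Y) where
  ι : Type
  U : ι → Y.Opens
  iSup_U : ⨆ i, U i = ⊤
  rank : ι → ℕ
  coord : ∀ i, Fin (rank i) → Γ(X, π ⁻¹ᵁ U i)
  isIso_coord : ∀ i, IsIso (AffineSpace.homOfVector (π ∣_ U i)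
    fun a : Fin (rank i) => (π ⁻¹ᵁ U i).topIso.inv (coord i a))
  transition : ∀ i j, ∃ M : Matrix (Fin (rank j)) (Fin (rank i)) Γ(Y, U i ⊓ U j), ∀ a,
    X.presheaf.map (homOfLE (π.preimage_mono (inf_le_right : U i ⊓ U j ≤ U j))).op (coord j a) =
      ∑ b, π.app (U i ⊓ U j) (M a b) *
        X.presheaf.map (homOfLE (π.preimage_mono (inf_le_left : U i ⊓ U j ≤ U i))).op (coord i b)
  zeroSection : Y ⟶ X
  zeroSection_comp : zeroSection ≫ π = 𝟙 Y
  zeroSection_coord : ∀ i a, zeroSection.app (π ⁻¹ᵁ U i) (coord i a) = 0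

variable {X : Scheme.{0}}

/-- The completed structure sheaf `lim_n O_X / I^n` of the formal completion of `X` along the closed
subscheme defined by the ideal sheaf `I`, on the basis of affine opens. -/
abbrev CompletedSheaf (I : X.IdealSheafData) (U : X.affineOpens) : Type :=
  AdicCompletion (I.ideal U) Γ(X, U.1)

/-- The restriction maps of the completed structure sheaf. -/
def completedRes (I : X.IdealSheafData) {U V : X.affineOpens} (h : V ≤ U) :
    CompletedSheaf I U →+* CompletedSheaf I V :=
  mapCompletion (X.presheaf.map (homOfLE h).op).hom (I.ideal_le_comap_ideal h)

/-- The completion of the ideal sheaf `I`: the kernel of `lim_n O_X / I^n → O_X / I`. -/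
def completedIdeal (I : X.IdealSheafData) (U : X.affineOpens) : Ideal (CompletedSheaf I U) :=
  RingHom.ker (AdicCompletion.evalOneₐ (I.ideal U))

/-- An automorphism of the completed structure sheaf, as a sheaf of `ℂ`-algebras. -/
structure FormalAut [X.Over SpecC] (I : X.IdealSheafData) where
  app : ∀ U : X.affineOpens, CompletedSheaf I U ≃ₐ[ℂ] CompletedSheaf I U
  naturality : ∀ {U V : X.affineOpens} (h : V ≤ U) (f : CompletedSheaf I U),
    completedRes I h (app U f) = app V (completedRes I h f)

/-- `Φ^* ω = ω'` as completed forms, that is in `lim_n Ω^k_X / I^n Ω^k_X`. -/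
def FormalAut.PullsBack [X.Over SpecC] {I : X.IdealSheafData} (Φ : FormalAut I) {k : ℕ}
    (ω ω' : GlobalForm X k) : Prop :=
  ∀ U : X.affineOpens,
    formalPullback (I.ideal U)
      ((Φ.app U : CompletedSheaf I U →ₐ[ℂ] CompletedSheaf I U).comp
        (toCompletion ℂ (I.ideal U))) (ω.val U) =
      AdicCompletion.of (I.ideal U) (Form ℂ Γ(X, U.1) k) (ω'.val U)

end Scheme

end FormalMoser

end

noncomputable section

namespace FormalMoser

/-! ## Cartan calculus -/

section Cartan

variable {R A : Type*} [CommRing R] [CommRing A] [Algebra R A]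

/-! The proof is Moser's deformation argument with analysis replaced by the `I`-adic topology, where
`I` is the ideal of the zero section over an affine open. Two ingredients are needed: a Poincaré
lemma giving primitives of `ω₁ - ω₀` with enough vanishing along `Y`, and a flow that can be summed
formally.

The Poincaré lemma comes from the Euler vector field `e` of the bundle, which acts on `I ^ n / I ^
(n + 1)` as multiplication by `n`. On 2-forms divisible by `I ^ n`, modulo forms divisible by `I ^
(n + 1)`, the Lie derivative `L_e` is annihilated by the polynomial with roots `n`, `n + 1`, `n + 2`
(`IsEuler.weights_pow`). For `n > 0` the roots are nonzero, so a polynomial in `L_e` inverts `L_e`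
up to higher order. Since `L_e = d ι_e` on closed forms, a closed 2-form vanishing along `Y` is an
adically convergent sum of forms `dγₙ` with `γₙ` divisible by `I ^ (n + 2)`
(`IsEuler.remainder_mem_formFil`, `IsEuler.primitive_mem_formFil`).

Instead of a segment, the forms are joined by `η = ω₀ + ∑ tⁿ⁺¹ dγₙ`, in which powers of `t` keep
pace with the adic order. The equation `ι_v η = -∑ (n + 1) tⁿ γₙ` is solved one coefficient at a
time by inverting only the constant term `ω₀`, and `vₙ` takes values in `I ^ (n + 2)`. The solution
of `dφ/dt = φ ∘ L_v`, `φ(0) = id`, is a power series whose `j`-th coefficient raises the adic order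
by `j`, so setting `t = 1` makes sense. Because `L_v η + dη/dt = 0`, the series `φ η` is constant
(`sum_moserFlow_formPath`), and evaluation at `t = 1` gives `Φ^* ω₁ = ω₀` (`formalPullback_eq_of`).
Modulo `I` only the identity survives, and such a perturbation of the identity is bijective on every
`A / I ^ n`.

The local automorphisms glue because no choice enters them. The Euler field is globally defined
since changes of trivialisation are linear (`IsRadialOver.of_res`, `existsUnique_eulerField`).
Restriction between affine opens is étale, so vector fields extend along it, and every step of the
construction commutes with restriction (`moserSeries_map`). Finally, pointwise agreement along `Y`
gives `ω₁ - ω₀ ∈ I Ω²` because `Y` is reduced and `Ω²` is projective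
(`GlobalForm.sub_mem_of_agreeAt`). -/

theorem contract_add (v : Derivation R A A) (x y : Forms R A) :
    contract v (x + y) = contract v x + contract v y := map_add _ _ _

theorem contract_smul (v : Derivation R A A) (a : A) (x : Forms R A) :
    contract v (a • x) = a • contract v x := map_smul _ _ _

theorem contract_zero (v : Derivation R A A) : contract v (0 : Forms R A) = 0 := map_zero _

theorem contract_neg (v : Derivation R A A) (x : Forms R A) :
    contract v (-x) = -contract v x := map_neg _ _

theorem contract_one (v : Derivation R A A) : contract v (1 : Forms R A) = 0 :=
  CliffordAlgebra.contractLeft_one _ _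

theorem contract_iota_mul (v : Derivation R A A) (m : Ω[A⁄R]) (x : Forms R A) :
    contract v (ExteriorAlgebra.ι A m * x) =
      v.liftKaehlerDifferential m • x - ExteriorAlgebra.ι A m * contract v x :=
  CliffordAlgebra.contractLeft_ι_mul _ _ _

theorem contract_dForm_mul (v : Derivation R A A) (b : A) (x : Forms R A) :
    contract v (dForm R A b * x) = v b • x - dForm R A b * contract v x := by
  rw [contract_iota_mul, Derivation.liftKaehlerDifferential_comp_D]

theorem extDer_zero : extDer R A 0 = 0 := by
  rw [extDer, map_zero]; rfl

theorem extDer_algebraMap_smul (r : R) (x : Forms R A) :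
    extDer R A (r • x) = r • extDer R A x := by
  rw [← algebraMap_smul A r x, extDer_smul, ← algebraMap_smul A r (extDer R A x)]
  simp [dForm]

variable (R A) in
/-- The exterior derivative as a linear map. -/
def extDerₗ : Forms R A →ₗ[R] Forms R A where
  toFun := extDer R A
  map_add' := extDer_add R A
  map_smul' := extDer_algebraMap_smul

theorem extDer_neg (x : Forms R A) : extDer R A (-x) = -extDer R A x := map_neg (extDerₗ R A) x

theorem extDer_sub (x y : Forms R A) : extDer R A (x - y) = extDer R A x - extDer R A y :=
  map_sub (extDerₗ R A) x y

/-- All forms are obtained from `1` by sums, multiplication by functions and by differentials. -/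
theorem forms_induction {p : Forms R A → Prop} (h1 : p 1) (hadd : ∀ x y, p x → p y → p (x + y))
    (hsmul : ∀ (a : A) x, p x → p (a • x)) (hd : ∀ (b : A) x, p x → p (dForm R A b * x))
    (x : Forms R A) : p x := by
  induction x using CliffordAlgebra.left_induction with
  | algebraMap a => rw [Algebra.algebraMap_eq_smul_one]; exact hsmul _ _ h1
  | add x y hx hy => exact hadd x y hx hy
  | ι_mul x m hx =>
    change p (ExteriorAlgebra.ι A m * x)
    induction m using form_induction with
    | h0 => simpa using hsmul 0 _ hx
    | hadd m n hm hn => rw [map_add, add_mul]; exact hadd _ _ hm hn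
    | hD a b => rw [map_smul, smul_mul_assoc]; exact hsmul _ _ (hd b x hx)

theorem extDer_dForm (b : A) : extDer R A (dForm R A b) = 0 := by
  have h := extDer_dForm_mul R A b 1
  rwa [mul_one, extDer_one, mul_zero, neg_zero] at h

theorem extDer_algebraMap (a : A) : extDer R A (algebraMap A _ a) = dForm R A a := by
  rw [Algebra.algebraMap_eq_smul_one, extDer_smul, extDer_one, smul_zero, add_zero, mul_one]

theorem extDer_extDer (x : Forms R A) : extDer R A (extDer R A x) = 0 := by
  induction x using forms_induction with
  | h1 => rw [extDer_one, extDer_zero]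
  | hadd x y hx hy => rw [extDer_add, extDer_add, hx, hy, add_zero]
  | hsmul a x hx =>
    rw [extDer_smul, extDer_add, extDer_dForm_mul, extDer_smul, hx, smul_zero, add_zero,
      neg_add_cancel]
  | hd b x hx => rw [extDer_dForm_mul, extDer_neg, extDer_dForm_mul, hx, mul_zero, neg_zero,
      neg_zero]

theorem contract_algebraMap_smul (v : Derivation R A A) (r : R) (x : Forms R A) :
    contract v (r • x) = r • contract v x := by
  rw [← algebraMap_smul A r x, contract_smul, algebraMap_smul]

/-- The Lie derivative `L_v = d ι_v + ι_v d` on differential forms. -/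
def lieDer (v : Derivation R A A) : Forms R A →ₗ[R] Forms R A where
  toFun x := extDer R A (contract v x) + contract v (extDer R A x)
  map_add' x y := by
    rw [contract_add, extDer_add, extDer_add, contract_add]; abel
  map_smul' r x := by
    rw [contract_algebraMap_smul, extDer_algebraMap_smul, extDer_algebraMap_smul,
      contract_algebraMap_smul, smul_add, RingHom.id_apply]

theorem lieDer_apply (v : Derivation R A A) (x : Forms R A) :
    lieDer v x = extDer R A (contract v x) + contract v (extDer R A x) := rfl

theorem lieDer_of_closed (v : Derivation R A A) {x : Forms R A} (hx : extDer R A x = 0) :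
    lieDer v x = extDer R A (contract v x) := by
  rw [lieDer_apply, hx, contract_zero, add_zero]

theorem lieDer_one (v : Derivation R A A) : lieDer v (1 : Forms R A) = 0 := by
  rw [lieDer_apply, contract_one, extDer_one, extDer_zero, contract_zero, add_zero]

theorem lieDer_smul (v : Derivation R A A) (a : A) (x : Forms R A) :
    lieDer v (a • x) = v a • x + a • lieDer v x := by
  simp only [lieDer_apply, contract_smul, extDer_smul, contract_add, contract_dForm_mul, smul_add]
  abel

theorem lieDer_dForm_mul (v : Derivation R A A) (b : A) (x : Forms R A) :
    lieDer v (dForm R A b * x) = dForm R A (v b) * x + dForm R A b * lieDer v x := by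
  simp only [lieDer_apply, contract_dForm_mul, extDer_sub, extDer_smul, extDer_dForm_mul,
    contract_neg, mul_add]
  abel

theorem lieDer_algebraMap (v : Derivation R A A) (a : A) :
    lieDer v (algebraMap A (Forms R A) a) = algebraMap A _ (v a) := by
  rw [Algebra.algebraMap_eq_smul_one, lieDer_smul, lieDer_one, smul_zero, add_zero,
    Algebra.algebraMap_eq_smul_one]

/-- No signs appear because `L_v` has degree zero. This is what makes the flow on forms
multiplicative. -/
theorem lieDer_mul (v : Derivation R A A) (x y : Forms R A) :
    lieDer v (x * y) = lieDer v x * y + x * lieDer v y := by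
  induction x using forms_induction with
  | h1 => rw [lieDer_one, one_mul, one_mul, zero_mul, zero_add]
  | hadd x x' hx hx' => rw [add_mul, map_add, hx, hx', map_add, add_mul, add_mul]; abel
  | hsmul a x hx =>
    rw [smul_mul_assoc, lieDer_smul, hx, lieDer_smul, add_mul, smul_mul_assoc, smul_mul_assoc,
      smul_mul_assoc, smul_add, add_assoc]
  | hd b x hx =>
    rw [mul_assoc, lieDer_dForm_mul, hx, lieDer_dForm_mul, add_mul, mul_add, mul_assoc, mul_assoc,
      mul_assoc, add_assoc]

theorem lieDer_extDer (v : Derivation R A A) (x : Forms R A) :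
    lieDer v (extDer R A x) = extDer R A (lieDer v x) := by
  rw [lieDer_apply, lieDer_apply, extDer_extDer, contract_zero, add_zero, extDer_add,
    extDer_extDer, zero_add]

/-! ### Forms of degree one and two -/

/-- On products of 1-forms, `ι_v (m ∧ n) = v(m) n - v(n) m`. -/
theorem contract_mem_range_iota (v : Derivation R A A) {x : Forms R A}
    (hx : x ∈ ⋀[A]^2 (Ω[A⁄R])) : contract v x ∈ (ExteriorAlgebra.ι A (M := Ω[A⁄R])).range := by
  rw [ExteriorAlgebra.exteriorPower, pow_two] at hx
  induction hx using Submodule.mul_induction_on' with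
  | mem_mul_mem x hx y hy =>
    obtain ⟨m, rfl⟩ := hx
    obtain ⟨n, rfl⟩ := hy
    have h := contract_iota_mul v n (1 : Forms R A)
    rw [mul_one, contract_one, mul_zero, sub_zero] at h
    rw [contract_iota_mul, h, mul_smul_comm, mul_one]
    exact sub_mem (Submodule.smul_mem _ _ ⟨n, rfl⟩) (Submodule.smul_mem _ _ ⟨m, rfl⟩)
  | add x _ y _ hx hy => rw [contract_add]; exact add_mem hx hy

theorem dForm_mul_dForm_mem (a b : A) : dForm R A a * dForm R A b ∈ ⋀[A]^2 (Ω[A⁄R]) := by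
  rw [ExteriorAlgebra.exteriorPower, pow_two]
  exact Submodule.mul_mem_mul ⟨_, rfl⟩ ⟨_, rfl⟩

/-- The predicate sees the membership proof, so that the principle also applies to elements of the
subtype `Form R A 2`. -/
theorem two_form_induction {p : ∀ x : Forms R A, x ∈ ⋀[A]^2 (Ω[A⁄R]) → Prop}
    (h0 : p 0 (zero_mem _)) (hadd : ∀ x hx y hy, p x hx → p y hy → p (x + y) (add_mem hx hy))
    (hd : ∀ a b c : A, p (a • (dForm R A b * dForm R A c))
      (Submodule.smul_mem _ a (dForm_mul_dForm_mem b c))) {x : Forms R A}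
    (hx : x ∈ ⋀[A]^2 (Ω[A⁄R])) : p x hx := by
  suffices h : ∃ h, p x h from h.2
  have add {x y} : (∃ h, p x h) → (∃ h, p y h) → ∃ h, p (x + y) h :=
    fun ⟨hx, h⟩ ⟨hy, h'⟩ => ⟨_, hadd x hx y hy h h'⟩
  rw [ExteriorAlgebra.exteriorPower, pow_two] at hx
  induction hx using Submodule.mul_induction_on' with
  | mem_mul_mem x hx y hy =>
    obtain ⟨m, rfl⟩ := hx
    obtain ⟨n, rfl⟩ := hy
    induction m using form_induction with
    | h0 => simpa using h0
    | hadd m m' hm hm' => rw [map_add, add_mul]; exact add hm hm'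
    | hD a b =>
      induction n using form_induction with
      | h0 => simpa using h0
      | hadd m m' hm hm' => rw [map_add, mul_add]; exact add hm hm'
      | hD a' b' =>
        rw [map_smul, map_smul, smul_mul_smul_comm]
        exact ⟨_, hd _ _ _⟩
  | add x _ y _ hx hy => exact add hx hy

theorem extDer_iota_mem (m : Ω[A⁄R]) :
    extDer R A (ExteriorAlgebra.ι A m) ∈ ⋀[A]^2 (Ω[A⁄R]) := by
  induction m using form_induction with
  | h0 => rw [map_zero, extDer_zero]; exact zero_mem _
  | hadd m n hm hn => rw [map_add, extDer_add]; exact add_mem hm hn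
  | hD a b =>
    rw [map_smul, extDer_smul, extDer_dForm, smul_zero, add_zero]
    exact dForm_mul_dForm_mem a b

theorem lieDer_smul_dForm_mul_dForm (v : Derivation R A A) (a b c : A) :
    lieDer v (a • (dForm R A b * dForm R A c)) = v a • (dForm R A b * dForm R A c) +
      a • (dForm R A (v b) * dForm R A c + dForm R A b * dForm R A (v c)) := by
  have h := lieDer_dForm_mul v c (1 : Forms R A)
  rw [mul_one, mul_one, lieDer_one, mul_zero, add_zero] at h
  rw [lieDer_smul, lieDer_dForm_mul, h]

theorem lieDer_mem (v : Derivation R A A) {x : Forms R A} (hx : x ∈ ⋀[A]^2 (Ω[A⁄R])) :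
    lieDer v x ∈ ⋀[A]^2 (Ω[A⁄R]) := by
  induction hx using two_form_induction with
  | h0 => rw [map_zero]; exact zero_mem _
  | hadd x _ y _ hx hy => rw [map_add]; exact add_mem hx hy
  | hd a b c =>
    rw [lieDer_smul_dForm_mul_dForm]
    exact add_mem (Submodule.smul_mem _ _ (dForm_mul_dForm_mem _ _))
      (Submodule.smul_mem _ _ (add_mem (dForm_mul_dForm_mem _ _) (dForm_mul_dForm_mem _ _)))

end Cartan

/-! ## The adic filtration on forms -/

section Filtration

variable {R A : Type*} [CommRing R] [CommRing A] [Algebra R A] (I : Ideal A)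

variable (R) in
/-- The forms divisible by `I ^ n`. -/
abbrev formFil (n : ℕ) : Submodule A (Forms R A) := I ^ n • ⊤

variable {I}

theorem formFil_mono {m n : ℕ} (h : m ≤ n) : formFil R I n ≤ formFil R I m :=
  Submodule.smul_mono_left (Ideal.pow_le_pow_right h)

theorem mem_formFil_zero (x : Forms R A) : x ∈ formFil R I 0 := by simp [formFil]

theorem smul_mem_formFil {m n k : ℕ} (h : k ≤ m + n) {a : A} (ha : a ∈ I ^ m) {x : Forms R A}
    (hx : x ∈ formFil R I n) : a • x ∈ formFil R I k := by
  refine formFil_mono h ?_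
  rw [formFil, pow_add, Submodule.mul_smul]
  exact Submodule.smul_mem_smul ha hx

theorem formFil_induction {n : ℕ} {p : ∀ x : Forms R A, x ∈ formFil R I n → Prop}
    (hadd : ∀ x hx y hy, p x hx → p y hy → p (x + y) (add_mem hx hy))
    (hs : ∀ a (ha : a ∈ I ^ n) (x : Forms R A), p (a • x) (Submodule.smul_mem_smul ha trivial))
    {x : Forms R A} (hx : x ∈ formFil R I n) : p x hx :=
  Submodule.smul_induction_on' hx (fun a ha x _ => hs a ha x) hadd

theorem mul_mem_formFil {m n k : ℕ} (h : k ≤ m + n) {x y : Forms R A} (hx : x ∈ formFil R I m)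
    (hy : y ∈ formFil R I n) : x * y ∈ formFil R I k := by
  induction hx using formFil_induction with
  | hadd x _ x' _ hx hx' => rw [add_mul]; exact add_mem hx hx'
  | hs a ha x =>
    rw [smul_mul_assoc]
    refine smul_mem_formFil h ha ?_
    induction hy using formFil_induction with
    | hadd x _ x' _ hx hx' => rw [mul_add]; exact add_mem hx hx'
    | hs a ha y => rw [mul_smul_comm]; exact Submodule.smul_mem_smul ha trivial

theorem dForm_mem_formFil {n : ℕ} {a : A} (ha : a ∈ I ^ (n + 1)) :
    dForm R A a ∈ formFil R I n := by
  have h := D_mem (R := R) I n ha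
  rw [dForm]
  generalize KaehlerDifferential.D R A a = m at h
  induction h using Submodule.smul_induction_on' with
  | smul a ha m _ => rw [map_smul]; exact Submodule.smul_mem_smul ha trivial
  | add x _ y _ hx hy => rw [map_add]; exact add_mem hx hy

/-- One order is lost in the term `da ∧ x` of `d (a x)`. -/
theorem extDer_mem_formFil {n : ℕ} {x : Forms R A} (hx : x ∈ formFil R I (n + 1)) :
    extDer R A x ∈ formFil R I n := by
  induction hx using formFil_induction with
  | hadd x _ y _ hx hy => rw [extDer_add]; exact add_mem hx hy
  | hs a ha x =>
    rw [extDer_smul]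
    exact add_mem (mul_mem_formFil (le_refl (n + 0)) (dForm_mem_formFil ha) (mem_formFil_zero x))
      (Submodule.smul_mem_smul (Ideal.pow_le_pow_right n.le_succ ha) trivial)

theorem contract_mem_formFil {k n m : ℕ} (h : m ≤ k + n) {v : Derivation R A A}
    (hv : ∀ a, v a ∈ I ^ k) {x : Forms R A} (hx : x ∈ formFil R I n) :
    contract v x ∈ formFil R I m := by
  induction hx using formFil_induction with
  | hadd x _ y _ hx hy => rw [contract_add]; exact add_mem hx hy
  | hs a ha x =>
    rw [contract_smul]
    refine smul_mem_formFil (by omega : m ≤ n + k) ha ?_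
    induction x using forms_induction with
    | h1 => rw [contract_one]; exact zero_mem _
    | hadd x y hx hy => rw [contract_add]; exact add_mem hx hy
    | hsmul a x hx => rw [contract_smul]; exact Submodule.smul_mem _ _ hx
    | hd b x hx =>
      rw [contract_dForm_mul]
      exact sub_mem (Submodule.smul_mem_smul (hv b) trivial)
        (mul_mem_formFil (by omega : k ≤ 0 + k) (mem_formFil_zero _) hx)

/-- In a product of `n` elements of `I`, the Leibniz rule trades one factor in `I` for a factor in
`I ^ (k + 1)`. -/
theorem derivation_mem_pow {v : Derivation R A A} {k : ℕ} (hv : ∀ a, v a ∈ I ^ (k + 1)) {n : ℕ}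
    {a : A} (ha : a ∈ I ^ n) : v a ∈ I ^ (n + k) := by
  induction n generalizing a with
  | zero => exact Ideal.pow_le_pow_right (by omega) (hv a)
  | succ n ih =>
    rw [pow_succ] at ha
    induction ha using Submodule.mul_induction_on' with
    | mem_mul_mem x hx y hy =>
      rw [Derivation.leibniz]
      refine add_mem ?_ ?_
      · have := Ideal.mul_mem_mul hx (hv y)
        rwa [← pow_add, ← add_assoc, add_right_comm] at this
      · have := Ideal.mul_mem_mul hy (ih hx)
        rwa [← pow_succ', add_right_comm] at this
    | add x _ y _ hx hy => rw [map_add]; exact add_mem hx hy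

/-- The gain is `k` rather than `k + 1` since `L_v (db) = d (v b)` and the differential costs one
order. -/
theorem lieDer_mem_formFil {v : Derivation R A A} {k : ℕ} (hv : ∀ a, v a ∈ I ^ (k + 1)) {n : ℕ}
    {x : Forms R A} (hx : x ∈ formFil R I n) : lieDer v x ∈ formFil R I (n + k) := by
  induction hx using formFil_induction with
  | hadd x _ y _ hx hy => rw [map_add]; exact add_mem hx hy
  | hs a ha x =>
    rw [lieDer_smul]
    refine add_mem (Submodule.smul_mem_smul (derivation_mem_pow hv ha) trivial)
      (smul_mem_formFil le_rfl ha ?_)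
    induction x using forms_induction with
    | h1 => rw [lieDer_one]; exact zero_mem _
    | hadd x y hx hy => rw [map_add]; exact add_mem hx hy
    | hsmul a x hx =>
      rw [lieDer_smul]
      exact add_mem (Submodule.smul_mem_smul (Ideal.pow_le_pow_right k.le_succ (hv a)) trivial)
        (Submodule.smul_mem _ _ hx)
    | hd b x hx =>
      rw [lieDer_dForm_mul]
      exact add_mem (mul_mem_formFil (le_refl (k + 0)) (dForm_mem_formFil (hv b))
        (mem_formFil_zero x)) (mul_mem_formFil (by omega : k ≤ 0 + k) (mem_formFil_zero _) hx)

end Filtration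

/-! ## The formal Poincaré lemma for an Euler vector field -/

section Euler

variable {R A : Type*} [Field R] [CommRing A] [Algebra R A]

/-- A vector field vanishing along `V(I)` and acting as the identity on `I / I ^ 2`. -/
structure IsEuler (I : Ideal A) (e : Derivation R A A) : Prop where
  mem : ∀ a, e a ∈ I
  sub_self_mem : ∀ a ∈ I, e a - a ∈ I ^ 2

variable {I : Ideal A} {e : Derivation R A A}

theorem IsEuler.sub_mem_pow (he : IsEuler I e) {n : ℕ} {a : A} (ha : a ∈ I ^ n) :
    e a - (n : R) • a ∈ I ^ (n + 1) := by
  induction n generalizing a with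
  | zero => simpa using he.mem a
  | succ n ih =>
    rw [pow_succ] at ha
    induction ha using Submodule.mul_induction_on' with
    | mem_mul_mem x hx y hy =>
      have h : e (x * y) - ((n + 1 : ℕ) : R) • (x * y) =
          x * (e y - y) + (e x - (n : R) • x) * y := by
        rw [Derivation.leibniz, Nat.cast_succ, add_smul, one_smul, sub_mul, smul_mul_assoc,
          smul_eq_mul, smul_eq_mul]
        ring
      rw [h]
      refine add_mem ?_ ?_
      · have := Ideal.mul_mem_mul hx (he.sub_self_mem y hy)
        rwa [← pow_add] at this
      · exact Ideal.mul_mem_mul (ih hx) hy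
    | add x _ y _ hx hy =>
      rw [map_add, smul_add, add_sub_add_comm]; exact add_mem hx hy

theorem IsEuler.lieDer_mem_formFil (he : IsEuler I e) {n : ℕ} {x : Forms R A}
    (hx : x ∈ formFil R I n) : lieDer e x ∈ formFil R I n :=
  FormalMoser.lieDer_mem_formFil (k := 0) (by simpa using he.mem) hx

theorem algebraMap_smul_mem_formFil {n : ℕ} (r : R) {x : Forms R A} (hx : x ∈ formFil R I n) :
    r • x ∈ formFil R I n := by
  rw [← algebraMap_smul A r x]; exact Submodule.smul_mem _ _ hx

/-- `L_v - c`. -/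
def shiftedLie (v : Derivation R A A) (c : R) : Forms R A →ₗ[R] Forms R A :=
  lieDer v - c • LinearMap.id

theorem shiftedLie_apply (v : Derivation R A A) (c : R) (x : Forms R A) :
    shiftedLie v c x = lieDer v x - c • x := rfl

theorem IsEuler.shiftedLie_mem (he : IsEuler I e) (c : R) {n : ℕ} {x : Forms R A}
    (hx : x ∈ formFil R I n) : shiftedLie e c x ∈ formFil R I n :=
  sub_mem (he.lieDer_mem_formFil hx) (algebraMap_smul_mem_formFil c hx)

/-- The difference equals `(e a - n a) x`: a coefficient of order `n` shifts weights by `n`. -/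
theorem IsEuler.shiftedLie_smul (he : IsEuler I e) (c : R) {n : ℕ} {a : A} (ha : a ∈ I ^ n)
    (x : Forms R A) : shiftedLie e (n + c) (a • x) - a • shiftedLie e c x ∈ formFil R I (n + 1) := by
  have h : shiftedLie e (n + c) (a • x) - a • shiftedLie e c x = (e a - (n : R) • a) • x := by
    rw [shiftedLie_apply, shiftedLie_apply, lieDer_smul, sub_smul, add_smul, smul_sub, smul_assoc,
      smul_comm a c x]
    abel
  rw [h]
  exact Submodule.smul_mem_smul (he.sub_mem_pow ha) trivial

/-- Modulo `I`, `L_e` sends `db` to `d(e b)` and fixes `d(e b)`, because `e (e b) - e b ∈ I ^ 2`. So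
it has weights 0 and 1 on 1-forms, and weights 0, 1, 2 on their products: explicitly `p q ↦ p' q + p
q' ↦ 2 p' q' ↦ 0`. -/
theorem IsEuler.weights (he : IsEuler I e) {x : Forms R A} (hx : x ∈ ⋀[A]^2 (Ω[A⁄R])) :
    shiftedLie e 2 (shiftedLie e 1 (shiftedLie e 0 x)) ∈ formFil R I 1 := by
  have key (a : A) : dForm R A (e (e a)) - dForm R A (e a) ∈ formFil R I 1 := by
    rw [dForm, dForm, ← map_sub, ← map_sub]
    exact dForm_mem_formFil (he.sub_self_mem _ (he.mem a))
  have hl (x y : Forms R A) (hy : y ∈ formFil R I 1) : x * y ∈ formFil R I 1 :=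
    mul_mem_formFil (le_refl (0 + 1)) (mem_formFil_zero x) hy
  have hr (x y : Forms R A) (hx : x ∈ formFil R I 1) : x * y ∈ formFil R I 1 :=
    mul_mem_formFil (le_refl (1 + 0)) hx (mem_formFil_zero y)
  have hL (b c : A) : lieDer e (dForm R A b * dForm R A c) =
      dForm R A (e b) * dForm R A c + dForm R A b * dForm R A (e c) := by
    simpa using lieDer_smul_dForm_mul_dForm e 1 b c
  have hbase (b c : A) : shiftedLie e 2 (shiftedLie e 1 (shiftedLie e 0
      (dForm R A b * dForm R A c))) ∈ formFil R I 1 := by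
    set p := dForm R A b
    set p' := dForm R A (e b) with hp'
    set q := dForm R A c
    set q' := dForm R A (e c) with hq'
    have h0 : shiftedLie e 0 (p * q) = p' * q + p * q' := by
      rw [shiftedLie_apply, hL, zero_smul, sub_zero]
    have h1 : shiftedLie e 1 (p' * q + p * q') - (2 : R) • (p' * q') ∈ formFil R I 1 := by
      have : shiftedLie e 1 (p' * q + p * q') - (2 : R) • (p' * q') =
          (dForm R A (e (e b)) - p') * q + p * (dForm R A (e (e c)) - q') := by
        rw [shiftedLie_apply, map_add, hL, hL, one_smul, two_smul, sub_mul, mul_sub]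
        abel
      rw [this]
      exact add_mem (hr _ _ (key b)) (hl _ _ (key c))
    have h2 : shiftedLie e 2 ((2 : R) • (p' * q')) ∈ formFil R I 1 := by
      have : shiftedLie e 2 (p' * q') =
          (dForm R A (e (e b)) - p') * q' + p' * (dForm R A (e (e c)) - q') := by
        rw [shiftedLie_apply, hL, two_smul, sub_mul, mul_sub]
        abel
      rw [map_smul, this]
      exact algebraMap_smul_mem_formFil _ (add_mem (hr _ _ (key b)) (hl _ _ (key c)))
    rw [h0]
    have h3 := add_mem (he.shiftedLie_mem 2 h1) h2
    rwa [← map_add, sub_add_cancel] at h3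
  -- Modulo `I` the operators `L_e - c` are `A`-linear, so it suffices to treat `db ∧ dc`.
  have hs (c : R) (a : A) (y z : Forms R A) (h : y - a • z ∈ formFil R I 1) :
      shiftedLie e c y - a • shiftedLie e c z ∈ formFil R I 1 := by
    have h1 := he.shiftedLie_mem c h
    have h2 := he.shiftedLie_smul c (n := 0) (a := a) (by simp) z
    rw [Nat.cast_zero, zero_add, zero_add] at h2
    rw [map_sub] at h1
    have := add_mem h1 h2
    rwa [sub_add_sub_cancel] at this
  induction hx using two_form_induction with
  | h0 => simp
  | hadd x _ y _ hx hy => rw [map_add, map_add, map_add]; exact add_mem hx hy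
  | hd a b c =>
    have h := hs 2 a _ _ (hs 1 a _ _ (hs 0 a _ (dForm R A b * dForm R A c)
      (by rw [sub_self]; exact zero_mem _)))
    have := add_mem h (Submodule.smul_mem _ a (hbase b c))
    rwa [sub_add_cancel] at this

/-- The projection to degree `k` is `A`-linear, so the filtration on all forms induces the adic
filtration on `Ω^k`. -/
theorem mem_smul_of_mem_formFil {n k : ℕ} {x : Forms R A} (hx : x ∈ formFil R I n)
    (hk : x ∈ ⋀[A]^k (Ω[A⁄R])) : x ∈ I ^ n • ⋀[A]^k (Ω[A⁄R]) := by
  let p : Forms R A →ₗ[A] Forms R A :=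
    GradedAlgebra.proj (fun n : ℕ => (⋀[A]^n (Ω[A⁄R]) : Submodule A (Forms R A))) k
  have h1 : p x = x := by
    rw [GradedAlgebra.proj_apply]
    exact DirectSum.decompose_of_mem_same
      (fun n : ℕ => (⋀[A]^n (Ω[A⁄R]) : Submodule A (Forms R A))) hk
  have h2 : p x ∈ (I ^ n • ⊤ : Submodule A (Forms R A)).map p := ⟨x, hx, rfl⟩
  rw [Submodule.map_smul'', h1] at h2
  refine Submodule.smul_mono le_rfl ?_ h2
  rintro _ ⟨y, -, rfl⟩
  rw [GradedAlgebra.proj_apply]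
  exact SetLike.coe_mem _

theorem IsEuler.weights_pow (he : IsEuler I e) {n : ℕ} {x : Forms R A}
    (hx : x ∈ formFil R I n) (hx2 : x ∈ ⋀[A]^2 (Ω[A⁄R])) :
    shiftedLie e (n + 2) (shiftedLie e (n + 1) (shiftedLie e (n + 0) x)) ∈ formFil R I (n + 1) := by
  have hs (c : R) (a : A) (ha : a ∈ I ^ n) (y z : Forms R A)
      (h : y - a • z ∈ formFil R I (n + 1)) :
      shiftedLie e (n + c) y - a • shiftedLie e c z ∈ formFil R I (n + 1) := by
    have h1 := he.shiftedLie_mem (n + c) h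
    rw [map_sub] at h1
    have := add_mem h1 (he.shiftedLie_smul c ha z)
    rwa [sub_add_sub_cancel] at this
  have h := mem_smul_of_mem_formFil hx hx2
  clear hx hx2
  induction h using Submodule.smul_induction_on' with
  | smul a ha x hx =>
    have h := hs 2 a ha _ _ (hs 1 a ha _ _ (hs 0 a ha _ x (by rw [sub_self]; exact zero_mem _)))
    have := add_mem h (smul_mem_formFil le_rfl ha (he.weights hx))
    rwa [sub_add_cancel] at this
  | add x _ y _ hx hy => rw [map_add, map_add, map_add]; exact add_mem hx hy

/-- The approximate inverse of `L_e` on forms of weights `n + 1`, `n + 2` and `n + 3`. -/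
def approxInv (e : Derivation R A A) (n : ℕ) (x : Forms R A) : Forms R A :=
  (((n + 1) * (n + 2) * (n + 3) : R)⁻¹) • (lieDer e (lieDer e x) - (3 * n + 6 : R) • lieDer e x +
    (3 * n ^ 2 + 12 * n + 11 : R) • x)

/-- With `a, b, c = n + 1, n + 2, n + 3`, this is `(X - a)(X - b)(X - c) + abc = X (X² - (a + b + c)
X + (ab + ac + bc))` evaluated at `X = L_e`. Characteristic zero makes `abc` invertible. -/
theorem sub_lieDer_approxInv [CharZero R] (e : Derivation R A A) (n : ℕ) (x : Forms R A) :
    x - lieDer e (approxInv e n x) = -(((n + 1) * (n + 2) * (n + 3) : R)⁻¹) •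
      shiftedLie e ((n + 1 : ℕ) + 2) (shiftedLie e ((n + 1 : ℕ) + 1)
        (shiftedLie e ((n + 1 : ℕ) + 0) x)) := by
  have h1 : (n + 1 : R) ≠ 0 := by exact_mod_cast n.succ_ne_zero
  have h2 : (n + 2 : R) ≠ 0 := by exact_mod_cast (n + 1).succ_ne_zero
  have h3 : (n + 3 : R) ≠ 0 := by exact_mod_cast (n + 2).succ_ne_zero
  have h : x = ((n + 1) * (n + 2) * (n + 3) : R)⁻¹ • ((n + 1) * (n + 2) * (n + 3) : R) • x := by
    rw [smul_smul, inv_mul_cancel₀ (by simp [h1, h2, h3]), one_smul]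
  nth_rewrite 1 [h]
  rw [approxInv, map_smul, ← smul_sub, neg_smul, ← smul_neg]
  congr 1
  simp only [shiftedLie_apply, map_sub, map_add, map_smul, Nat.cast_succ]
  module

/-- The remainders of the successive approximations of `x` by exact forms. -/
def remainder (e : Derivation R A A) (x : Forms R A) : ℕ → Forms R A
  | 0 => x
  | n + 1 => remainder e x n - extDer R A (contract e (approxInv e n (remainder e x n)))

/-- The 1-forms whose differentials sum up to `x`. -/
def primitive (e : Derivation R A A) (x : Forms R A) (n : ℕ) : Forms R A :=
  contract e (approxInv e n (remainder e x n))

theorem sum_extDer_primitive (e : Derivation R A A) (x : Forms R A) (n : ℕ) :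
    ∑ k ∈ Finset.range n, extDer R A (primitive e x k) = x - remainder e x n := by
  induction n with
  | zero => simp [remainder]
  | succ n ih => rw [Finset.sum_range_succ, ih, remainder, primitive]; abel

theorem approxInv_mem {p : Submodule R (Forms R A)} (hp : ∀ x ∈ p, lieDer e x ∈ p) (n : ℕ)
    {x : Forms R A} (hx : x ∈ p) : approxInv e n x ∈ p :=
  p.smul_mem _ (add_mem (sub_mem (hp _ (hp _ hx)) (p.smul_mem _ (hp _ hx))) (p.smul_mem _ hx))

theorem approxInv_mem_two (n : ℕ) {x : Forms R A} (hx : x ∈ ⋀[A]^2 (Ω[A⁄R])) :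
    approxInv e n x ∈ ⋀[A]^2 (Ω[A⁄R]) :=
  approxInv_mem (p := (⋀[A]^2 (Ω[A⁄R]) : Submodule A (Forms R A)).restrictScalars R)
    (fun _ => lieDer_mem e) n hx

theorem approxInv_closed (n : ℕ) {x : Forms R A} (hx : extDer R A x = 0) :
    extDer R A (approxInv e n x) = 0 :=
  approxInv_mem (p := LinearMap.ker (extDerₗ R A))
    (fun x (hx : extDer R A x = 0) => by
      change extDer R A (lieDer e x) = 0
      rw [← lieDer_extDer, hx, map_zero]) n hx

theorem IsEuler.approxInv_mem_formFil (he : IsEuler I e) (n : ℕ) {k : ℕ} {x : Forms R A}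
    (hx : x ∈ formFil R I k) : approxInv e n x ∈ formFil R I k :=
  approxInv_mem (p := (formFil R I k).restrictScalars R) (fun _ => he.lieDer_mem_formFil) n hx

variable {x : Forms R A}

theorem remainder_mem_closed (hx : x ∈ ⋀[A]^2 (Ω[A⁄R])) (hd : extDer R A x = 0) (n : ℕ) :
    remainder e x n ∈ ⋀[A]^2 (Ω[A⁄R]) ∧ extDer R A (remainder e x n) = 0 := by
  induction n with
  | zero => exact ⟨hx, hd⟩
  | succ n ih =>
    rw [remainder]
    refine ⟨sub_mem ih.1 ?_, ?_⟩
    · obtain ⟨m, hm⟩ := contract_mem_range_iota e (approxInv_mem_two (e := e) n ih.1)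
      rw [← hm]
      exact extDer_iota_mem m
    · rw [extDer_sub, extDer_extDer, ih.2, sub_zero]

/-- On closed forms `d ι_e` is `L_e`, so the new remainder is a scalar multiple of the product of
three shifted Lie derivatives that `IsEuler.weights_pow` shows to raise the order. -/
theorem IsEuler.remainder_mem_formFil [CharZero R] (he : IsEuler I e) (hx : x ∈ ⋀[A]^2 (Ω[A⁄R]))
    (hd : extDer R A x = 0) (hI : x ∈ formFil R I 1) (n : ℕ) :
    remainder e x n ∈ formFil R I (n + 1) := by
  induction n with
  | zero => exact hI
  | succ n ih =>
    obtain ⟨h2, hc⟩ := remainder_mem_closed (e := e) hx hd n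
    rw [remainder, ← lieDer_of_closed _ (approxInv_closed n hc), sub_lieDer_approxInv]
    exact algebraMap_smul_mem_formFil _ (he.weights_pow ih h2)

/-- The remainder has order `n + 1`, and contraction with `e`, which vanishes along `V(I)`, adds
one. This extra order is what makes Moser's flow converge. -/
theorem IsEuler.primitive_mem_formFil [CharZero R] (he : IsEuler I e) (hx : x ∈ ⋀[A]^2 (Ω[A⁄R]))
    (hd : extDer R A x = 0) (hI : x ∈ formFil R I 1) (n : ℕ) :
    primitive e x n ∈ formFil R I (n + 2) :=
  contract_mem_formFil (by omega : n + 2 ≤ 1 + (n + 1)) (by simpa using he.mem)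
    (he.approxInv_mem_formFil n (he.remainder_mem_formFil hx hd hI n))

theorem primitive_mem_range_iota (hx : x ∈ ⋀[A]^2 (Ω[A⁄R])) (hd : extDer R A x = 0) (n : ℕ) :
    primitive e x n ∈ (ExteriorAlgebra.ι A (M := Ω[A⁄R])).range :=
  contract_mem_range_iota e (approxInv_mem_two n (remainder_mem_closed hx hd n).1)

end Euler

/-! ## Flows of time-dependent vector fields as formal power series in the time -/

section Flow

open Finset

theorem sum_antidiagonal_assoc {M : Type*} [AddCommMonoid M] (f : ℕ → ℕ → ℕ → M) (n : ℕ) :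
    ∑ p ∈ antidiagonal n, ∑ q ∈ antidiagonal p.1, f q.1 q.2 p.2 =
      ∑ p ∈ antidiagonal n, ∑ q ∈ antidiagonal p.2, f p.1 q.1 q.2 := by
  rw [sum_sigma', sum_sigma']
  refine sum_nbij' (fun x => ⟨(x.2.1, x.2.2 + x.1.2), (x.2.2, x.1.2)⟩)
    (fun x => ⟨(x.1.1 + x.2.1, x.2.2), (x.1.1, x.2.1)⟩) ?_ ?_ ?_ ?_ (fun _ _ => rfl) <;>
  · rintro ⟨⟨a, b⟩, ⟨c, d⟩⟩ h
    simp only [mem_sigma, HasAntidiagonal.mem_antidiagonal] at h ⊢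
    obtain ⟨rfl, rfl⟩ := h
    simp [add_assoc]

theorem sum_antidiagonal_right_comm {M : Type*} [AddCommMonoid M] (f : ℕ → ℕ → ℕ → M) (n : ℕ) :
    ∑ p ∈ antidiagonal n, ∑ q ∈ antidiagonal p.1, f q.1 q.2 p.2 =
      ∑ p ∈ antidiagonal n, ∑ q ∈ antidiagonal p.1, f q.1 p.2 q.2 := by
  rw [sum_antidiagonal_assoc, sum_antidiagonal_assoc fun a b c => f a c b]
  refine sum_congr rfl fun p _ => ?_
  rw [← Nat.sum_antidiagonal_swap]
  rfl

variable {R S S' : Type*} [Field R] [AddCommGroup S] [Module R S] [AddCommGroup S'] [Module R S']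

/-- The coefficients of the solution `φ` of `dφ/dt = φ ∘ δ`, `φ(0) = id`, where `δ = ∑ tⁿ δ n`. -/
def flow (δ : ℕ → S →ₗ[R] S) : ℕ → S →ₗ[R] S
  | 0 => LinearMap.id
  | n + 1 => ((n + 1 : R)⁻¹) • ∑ k : Fin (n + 1), flow δ (n - k) ∘ₗ δ k

variable {δ : ℕ → S →ₗ[R] S}

theorem flow_zero : flow δ 0 = LinearMap.id := by rw [flow]

theorem flow_succ_eq (n : ℕ) (x : S) :
    flow δ (n + 1) x = ((n + 1 : R)⁻¹) • ∑ p ∈ antidiagonal n, flow δ p.1 (δ p.2 x) := by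
  rw [flow, Nat.sum_antidiagonal_eq_sum_range_succ_mk, ← sum_range_reflect, sum_range]
  simp only [LinearMap.smul_apply, LinearMap.sum_apply, LinearMap.comp_apply]
  congr 1
  refine sum_congr rfl fun k _ => ?_
  have h : n + 1 - 1 - (k : ℕ) = n - k := by omega
  have h' : n - (n + 1 - 1 - (k : ℕ)) = k := by omega
  rw [h', h]

theorem flow_succ [CharZero R] (n : ℕ) (x : S) :
    (n + 1 : R) • flow δ (n + 1) x = ∑ p ∈ antidiagonal n, flow δ p.1 (δ p.2 x) := by
  rw [flow_succ_eq, smul_smul, mul_inv_cancel₀ (by exact_mod_cast n.succ_ne_zero), one_smul]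

/-- Used three times: for the inclusion of functions into forms, for `d`, and for restriction to a
smaller open set. -/
theorem flow_intertwine {δ' : ℕ → S' →ₗ[R] S'} (T : S →ₗ[R] S')
    (h : ∀ n x, T (δ n x) = δ' n (T x)) (n : ℕ) (x : S) :
    T (flow δ n x) = flow δ' n (T x) := by
  induction n using Nat.strong_induction_on generalizing x with
  | _ n ih =>
    cases n with
    | zero => rw [flow_zero, flow_zero]; rfl
    | succ n =>
      rw [flow_succ_eq, flow_succ_eq, map_smul, map_sum]
      congr 1
      refine sum_congr rfl fun p hp => ?_
      rw [ih p.1 (by have := mem_antidiagonal.1 hp; omega), h]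

theorem flow_eq_zero {x : S} (h : ∀ n, δ n x = 0) {n : ℕ} (hn : n ≠ 0) : flow δ n x = 0 := by
  obtain ⟨n, rfl⟩ := Nat.exists_eq_succ_of_ne_zero hn
  rw [flow_succ_eq, sum_eq_zero, smul_zero]
  intro p _
  rw [h, map_zero]

/-- The coefficient of `tʲ` combines products of `δ k` whose values `k + 1` add up to `j`; the `+ 1`
is the integration in `t`. -/
theorem flow_mem {F : ℕ → Submodule R S} (h : ∀ k n, ∀ x ∈ F n, δ k x ∈ F (n + k + 1)) (j : ℕ)
    {n : ℕ} {x : S} (hx : x ∈ F n) : flow δ j x ∈ F (n + j) := by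
  induction j using Nat.strong_induction_on generalizing x n with
  | _ j ih =>
    cases j with
    | zero => rwa [flow_zero]
    | succ j =>
      rw [flow_succ_eq]
      refine Submodule.smul_mem _ _ (sum_mem fun p hp => ?_)
      have hp := mem_antidiagonal.1 hp
      have := ih p.1 (by omega) (h p.2 n x hx)
      rwa [show n + p.2 + 1 + p.1 = n + (j + 1) by omega] at this

/-- If the path `η = ∑ tⁿ η n` satisfies `δ η + dη/dt = 0`, then `φ η` is constant. -/
theorem sum_flow_path [CharZero R] {η : ℕ → S}
    (h : ∀ n, ∑ p ∈ antidiagonal n, δ p.1 (η p.2) + (n + 1 : R) • η (n + 1) = 0) (n : ℕ) :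
    ∑ p ∈ antidiagonal (n + 1), flow δ p.1 (η p.2) = 0 := by
  have h0 : (n + 1 : R) ≠ 0 := by exact_mod_cast n.succ_ne_zero
  refine (smul_eq_zero_iff_right h0).1 ?_
  -- This is the product rule for `d/dt`: the factor `n + 1 = p.1 + p.2` splits into the derivatives
  -- of the flow and of the path.
  have h1 : (n + 1 : R) • ∑ p ∈ antidiagonal (n + 1), flow δ p.1 (η p.2) =
      ∑ p ∈ antidiagonal (n + 1), (p.1 : R) • flow δ p.1 (η p.2) +
      ∑ p ∈ antidiagonal (n + 1), (p.2 : R) • flow δ p.1 (η p.2) := by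
    rw [← sum_add_distrib, smul_sum]
    refine sum_congr rfl fun p hp => ?_
    rw [← add_smul, ← Nat.cast_add, mem_antidiagonal.1 hp, Nat.cast_succ]
  have h2 : ∑ p ∈ antidiagonal (n + 1), (p.1 : R) • flow δ p.1 (η p.2) =
      ∑ p ∈ antidiagonal n, flow δ p.1 (∑ q ∈ antidiagonal p.2, δ q.1 (η q.2)) := by
    rw [Nat.sum_antidiagonal_succ, Nat.cast_zero, zero_smul, zero_add]
    simp only [Nat.cast_succ, flow_succ, map_sum]
    exact sum_antidiagonal_assoc (fun a b c => flow δ a (δ b (η c))) n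
  have h3 : ∑ p ∈ antidiagonal (n + 1), (p.2 : R) • flow δ p.1 (η p.2) =
      ∑ p ∈ antidiagonal n, flow δ p.1 ((p.2 + 1 : R) • η (p.2 + 1)) := by
    rw [Nat.sum_antidiagonal_succ', Nat.cast_zero, zero_smul, zero_add]
    simp only [Nat.cast_succ, map_smul]
  rw [h1, h2, h3, ← sum_add_distrib]
  refine sum_eq_zero fun p _ => ?_
  rw [← map_add, h, map_zero]

end Flow

section FlowMul

open Finset

variable {R S : Type*} [Field R] [CharZero R] [Ring S] [Algebra R S] {δ : ℕ → S →ₗ[R] S}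

/-- The exponential of a derivation is multiplicative: both sides solve the same differential
equation in `t`, so they agree coefficient by coefficient. -/
theorem flow_mul (h : ∀ n x y, δ n (x * y) = δ n x * y + x * δ n y) (n : ℕ) (x y : S) :
    flow δ n (x * y) = ∑ p ∈ antidiagonal n, flow δ p.1 x * flow δ p.2 y := by
  induction n using Nat.strong_induction_on generalizing x y with
  | _ n ih =>
    cases n with
    | zero => simp [flow_zero]
    | succ n =>
      have h0 : (n + 1 : R) ≠ 0 := by exact_mod_cast n.succ_ne_zero
      refine smul_right_injective S h0 ?_
      simp only
      have h1 : (n + 1 : R) • ∑ p ∈ antidiagonal (n + 1), flow δ p.1 x * flow δ p.2 y =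
          ∑ p ∈ antidiagonal (n + 1), ((p.1 : R) • flow δ p.1 x) * flow δ p.2 y +
          ∑ p ∈ antidiagonal (n + 1), flow δ p.1 x * ((p.2 : R) • flow δ p.2 y) := by
        rw [← sum_add_distrib, smul_sum]
        refine sum_congr rfl fun p hp => ?_
        rw [smul_mul_assoc, mul_smul_comm, ← add_smul, ← Nat.cast_add, mem_antidiagonal.1 hp,
          Nat.cast_succ]
      rw [h1, Nat.sum_antidiagonal_succ, Nat.sum_antidiagonal_succ' (n := n)]
      simp only [Nat.cast_zero, zero_smul, zero_mul, mul_zero, zero_add, Nat.cast_succ, flow_succ]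
      simp only [sum_mul, mul_sum]
      have h2 : ∑ p ∈ antidiagonal n, ∑ q ∈ antidiagonal p.1,
          flow δ q.1 (δ q.2 x) * flow δ p.2 y =
          ∑ p ∈ antidiagonal n, ∑ q ∈ antidiagonal p.1,
            flow δ q.1 (δ p.2 x) * flow δ q.2 y :=
        sum_antidiagonal_right_comm (fun a b c => flow δ a (δ b x) * flow δ c y) n
      have h3 : ∑ p ∈ antidiagonal n, ∑ q ∈ antidiagonal p.2,
          flow δ p.1 x * flow δ q.1 (δ q.2 y) =
          ∑ p ∈ antidiagonal n, ∑ q ∈ antidiagonal p.1,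
            flow δ q.1 x * flow δ q.2 (δ p.2 y) :=
        (sum_antidiagonal_assoc (fun a b c => flow δ a x * flow δ b (δ c y)) n).symm
      rw [h2, h3, ← sum_add_distrib]
      refine sum_congr rfl fun p hp => ?_
      have hp := mem_antidiagonal.1 hp
      rw [h, map_add, ih p.1 (by omega), ih p.1 (by omega), ← sum_add_distrib]

end FlowMul

/-! ## Moser's vector fields -/

section Sharp

variable {R A : Type*} [CommRing R] [CommRing A] [Algebra R A]

theorem liftKaehlerDifferential_add (v w : Derivation R A A) :
    (v + w).liftKaehlerDifferential = v.liftKaehlerDifferential + w.liftKaehlerDifferential :=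
  map_add (KaehlerDifferential.linearMapEquivDerivation R A (M := A)).symm v w

theorem liftKaehlerDifferential_smul (a : A) (v : Derivation R A A) :
    (a • v).liftKaehlerDifferential = a • v.liftKaehlerDifferential :=
  map_smul (KaehlerDifferential.linearMapEquivDerivation R A (M := A)).symm a v

theorem add_contract (v w : Derivation R A A) (x : Forms R A) :
    contract (v + w) x = contract v x + contract w x := by
  rw [contract, liftKaehlerDifferential_add, map_add]; rfl

theorem smul_contract (a : A) (v : Derivation R A A) (x : Forms R A) :
    contract (a • v) x = a • contract v x := by
  rw [contract, liftKaehlerDifferential_smul, map_smul]; rfl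

namespace IsSymplecticForm

variable {ω : Form R A 2} (hω : IsSymplecticForm ω)

/-- The vector field corresponding to a 1-form under a symplectic form. -/
def sharp : Ω[A⁄R] →ₗ[A] Derivation R A A where
  toFun α := (hω.nondegenerate α).choose
  map_add' α β := ((hω.nondegenerate (α + β)).choose_spec.2 _ (by
    change contract _ _ = _
    rw [add_contract, (hω.nondegenerate α).choose_spec.1, (hω.nondegenerate β).choose_spec.1,
      map_add])).symm
  map_smul' a α := ((hω.nondegenerate (a • α)).choose_spec.2 _ (by
    change contract _ _ = _
    rw [RingHom.id_apply, smul_contract, (hω.nondegenerate α).choose_spec.1, map_smul])).symm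

theorem contract_sharp (α : Ω[A⁄R]) :
    contract (hω.sharp α) (ω : Forms R A) = ExteriorAlgebra.ι A α :=
  (hω.nondegenerate α).choose_spec.1

theorem sharp_unique {α : Ω[A⁄R]} {v : Derivation R A A}
    (h : contract v (ω : Forms R A) = ExteriorAlgebra.ι A α) : v = hω.sharp α :=
  (hω.nondegenerate α).choose_spec.2 v h

/-- The vector field corresponding to the part of degree one of a form. -/
def sharpForm : Forms R A →ₗ[A] Derivation R A A := hω.sharp ∘ₗ ExteriorAlgebra.ιInv

theorem contract_sharpForm {x : Forms R A} (hx : x ∈ (ExteriorAlgebra.ι A (M := Ω[A⁄R])).range) :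
    contract (hω.sharpForm x) (ω : Forms R A) = x := by
  obtain ⟨m, rfl⟩ := hx
  rw [sharpForm, LinearMap.comp_apply, ExteriorAlgebra.ι_leftInverse m, contract_sharp]

theorem sharpForm_unique {x : Forms R A} {v : Derivation R A A}
    (h : contract v (ω : Forms R A) = x) : v = hω.sharpForm x := by
  obtain ⟨m, hm⟩ := contract_mem_range_iota v ω.2
  rw [h] at hm
  obtain rfl := hm
  rw [sharpForm, LinearMap.comp_apply, ExteriorAlgebra.ι_leftInverse m]
  exact hω.sharp_unique h

/-- By `A`-linearity, passing from 1-forms to vector fields loses no adic order. -/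
theorem sharpForm_mem {I : Ideal A} {n : ℕ} {x : Forms R A} (hx : x ∈ formFil R I n) (a : A) :
    hω.sharpForm x a ∈ I ^ n := by
  induction hx using formFil_induction with
  | hadd x _ y _ hx hy => rw [map_add, Derivation.add_apply]; exact add_mem hx hy
  | hs b hb x =>
    rw [map_smul, Derivation.smul_apply, smul_eq_mul]
    exact Ideal.mul_mem_right _ _ hb

end IsSymplecticForm

end Sharp

/-! ### The path of 2-forms and its flow. -/

section Moser

open Finset

variable {R A : Type*} [Field R] [CommRing A] [Algebra R A] {ω : Form R A 2}
  (hω : IsSymplecticForm ω) (γ : ℕ → Forms R A)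

/-- The coefficients of the path of 2-forms `ω + ∑ tⁿ⁺¹ dγₙ`. -/
def formPath (ω : Form R A 2) (γ : ℕ → Forms R A) : ℕ → Forms R A
  | 0 => ω
  | n + 1 => extDer R A (γ n)

/-- The coefficients of the vector field `v` with `ι_v η = -∑ (n + 1) tⁿ γₙ`,
where `η = ω + ∑ tⁿ⁺¹ dγₙ`. -/
def moserField (n : ℕ) : Derivation R A A :=
  -hω.sharpForm ((n + 1 : R) • γ n +
    ∑ k : Fin n, contract (moserField k) (extDer R A (γ (n - 1 - k))))

variable {γ}

theorem moserField_eq (n : ℕ) :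
    moserField hω γ n = -hω.sharpForm ((n + 1 : R) • γ n +
      ∑ k ∈ range n, contract (moserField hω γ k) (extDer R A (γ (n - 1 - k)))) := by
  rw [moserField, sum_range]

theorem neg_contract (v : Derivation R A A) (x : Forms R A) :
    contract (-v) x = -contract v x := by
  rw [← neg_one_smul A, smul_contract, neg_one_smul]

theorem moserField_arg_mem (hγ : ∀ n, γ n ∈ (ExteriorAlgebra.ι A (M := Ω[A⁄R])).range) (n : ℕ) :
    (n + 1 : R) • γ n +
      ∑ k ∈ range n, contract (moserField hω γ k) (extDer R A (γ (n - 1 - k))) ∈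
        (ExteriorAlgebra.ι A (M := Ω[A⁄R])).range := by
  refine add_mem ?_ (sum_mem fun k _ => contract_mem_range_iota _ ?_)
  · rw [← algebraMap_smul A]
    exact Submodule.smul_mem _ _ (hγ n)
  · obtain ⟨m, hm⟩ := hγ (n - 1 - k)
    rw [← hm]
    exact extDer_iota_mem m

/-- The coefficient of `tⁿ` in `ι_v η = -∑ (n + 1) tⁿ γₙ`. The summand with `k = n` contracts `ω`
itself, and the recursion chooses the `n`-th field to balance the others. -/
theorem sum_contract_moserField (hγ : ∀ n, γ n ∈ (ExteriorAlgebra.ι A (M := Ω[A⁄R])).range)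
    (n : ℕ) : ∑ p ∈ antidiagonal n, contract (moserField hω γ p.1) (formPath ω γ p.2) =
      -((n + 1 : R) • γ n) := by
  have hs : ∑ k ∈ range n, contract (moserField hω γ k) (formPath ω γ (n - k)) =
      ∑ k ∈ range n, contract (moserField hω γ k) (extDer R A (γ (n - 1 - k))) := by
    refine sum_congr rfl fun k hk => ?_
    obtain ⟨m, rfl⟩ := Nat.exists_eq_add_of_lt (mem_range.1 hk)
    rw [show k + m + 1 - k = m + 1 by omega, show k + m + 1 - 1 - k = m by omega, formPath]
  rw [Nat.sum_antidiagonal_eq_sum_range_succ_mk, sum_range_succ, hs, Nat.sub_self, formPath,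
    moserField_eq hω n, neg_contract, hω.contract_sharpForm (moserField_arg_mem hω hγ n)]
  abel

theorem moserField_mem {I : Ideal A} (hγ : ∀ n, γ n ∈ formFil R I (n + 2)) (n : ℕ) (a : A) :
    moserField hω γ n a ∈ I ^ (n + 2) := by
  induction n using Nat.strong_induction_on generalizing a with
  | _ n ih =>
    rw [moserField_eq, Derivation.neg_apply, neg_mem_iff]
    refine hω.sharpForm_mem (add_mem (algebraMap_smul_mem_formFil _ (hγ n))
      (sum_mem fun k hk => ?_)) a
    have hk := mem_range.1 hk
    -- The primitive `γ (n - 1 - k)` has order `n + 1 - k`, its differential order `n - k`, and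
    -- contraction adds `k + 2`.
    exact contract_mem_formFil (k := k + 2) (n := n - 1 - k + 1) (by omega) (ih k hk)
      (extDer_mem_formFil (hγ _))

/-- The coefficients of the flow of `moserField` on differential forms. -/
def moserFlow (n : ℕ) : Forms R A →ₗ[R] Forms R A := flow (fun k => lieDer (moserField hω γ k)) n

/-- The coefficients of the flow of `moserField` on functions. -/
def moserFlowFun (n : ℕ) : A →ₗ[R] A := flow (fun k => (moserField hω γ k : A →ₗ[R] A)) n

theorem moserFlow_algebraMap (n : ℕ) (a : A) :
    moserFlow hω (γ := γ) n (algebraMap A _ a) =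
      algebraMap A _ (moserFlowFun hω (γ := γ) n a) :=
  (flow_intertwine ((Algebra.linearMap A (Forms R A)).restrictScalars R)
    (fun n x => (lieDer_algebraMap (moserField hω γ n) x).symm) n a).symm

theorem moserFlow_extDer (n : ℕ) (x : Forms R A) :
    moserFlow hω (γ := γ) n (extDer R A x) = extDer R A (moserFlow hω (γ := γ) n x) :=
  (flow_intertwine (extDerₗ R A) (fun n x => (lieDer_extDer (moserField hω γ n) x).symm) n x).symm

/-- Together with multiplicativity this says that the flow on forms is the pullback along the flow
on functions. -/
theorem moserFlow_dForm (n : ℕ) (a : A) :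
    moserFlow hω (γ := γ) n (dForm R A a) = dForm R A (moserFlowFun hω (γ := γ) n a) := by
  rw [← extDer_algebraMap, moserFlow_extDer, moserFlow_algebraMap, extDer_algebraMap]

theorem moserFlow_mul [CharZero R] (n : ℕ) (x y : Forms R A) :
    moserFlow hω (γ := γ) n (x * y) =
      ∑ p ∈ antidiagonal n, moserFlow hω (γ := γ) p.1 x * moserFlow hω (γ := γ) p.2 y :=
  flow_mul (fun n => lieDer_mul (moserField hω γ n)) n x y

theorem moserFlowFun_mul [CharZero R] (n : ℕ) (a b : A) :
    moserFlowFun hω (γ := γ) n (a * b) =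
      ∑ p ∈ antidiagonal n, moserFlowFun hω (γ := γ) p.1 a * moserFlowFun hω (γ := γ) p.2 b :=
  flow_mul (fun n x y => by
    change moserField hω γ n (x * y) = _
    rw [Derivation.leibniz, smul_eq_mul, smul_eq_mul, add_comm, mul_comm y]
    rfl) n a b

theorem moserFlow_mem {I : Ideal A} (hγ : ∀ n, γ n ∈ formFil R I (n + 2)) (j : ℕ) {n : ℕ}
    {x : Forms R A} (hx : x ∈ formFil R I n) :
    moserFlow hω (γ := γ) j x ∈ formFil R I (n + j) :=
  flow_mem (F := fun n => (formFil R I n).restrictScalars R)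
    (fun k _ _ hx => lieDer_mem_formFil (k := k + 1) (moserField_mem hω hγ k) hx) j hx

theorem moserFlowFun_mem {I : Ideal A} (hγ : ∀ n, γ n ∈ formFil R I (n + 2)) (j : ℕ) {n : ℕ}
    {a : A} (ha : a ∈ I ^ n) : moserFlowFun hω (γ := γ) j a ∈ I ^ (n + j) :=
  flow_mem (F := fun n => (I ^ n).restrictScalars R)
    (fun k _ _ hx => derivation_mem_pow (k := k + 1) (moserField_mem hω hγ k) hx) j ha

theorem moserFlowFun_algebraMap {n : ℕ} (hn : n ≠ 0) (r : R) :
    moserFlowFun hω (γ := γ) n (algebraMap R A r) = 0 :=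
  flow_eq_zero (fun k => Derivation.map_algebraMap (moserField hω γ k) r) hn

/-- Moser's trick: the flow of `moserField` carries the path `ω + ∑ tⁿ⁺¹ dγₙ` to `ω`. -/
theorem sum_moserFlow_formPath [CharZero R]
    (hγ : ∀ n, γ n ∈ (ExteriorAlgebra.ι A (M := Ω[A⁄R])).range) (n : ℕ) :
    ∑ p ∈ antidiagonal (n + 1), moserFlow hω (γ := γ) p.1 (formPath ω γ p.2) = 0 := by
  refine sum_flow_path (fun n => ?_) n
  have hclosed (k : ℕ) : extDer R A (formPath ω γ k) = 0 := by
    cases k with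
    | zero => exact hω.closed
    | succ k => exact extDer_extDer _
  simp only [lieDer_of_closed _ (hclosed _)]
  have h := congrArg (extDerₗ R A) (sum_contract_moserField hω hγ n)
  rw [map_sum, map_neg, map_smul] at h
  rw [formPath, add_eq_zero_iff_eq_neg]
  exact h

end Moser

/-! ## Summation of a formal power series of operators in the adic topology -/

section Truncation

open Finset

theorem sum_range_antidiagonal {M : Type*} [AddCommMonoid M] (f : ℕ → ℕ → M) (N : ℕ) :
    ∑ n ∈ range N, ∑ p ∈ antidiagonal n, f p.1 p.2 =
      ∑ p ∈ range N ×ˢ range N with p.1 + p.2 < N, f p.1 p.2 := by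
  rw [sum_sigma']
  refine sum_nbij' (fun x => x.2) (fun p => ⟨p.1 + p.2, p⟩) ?_ ?_ ?_ (fun _ _ => rfl)
    (fun _ _ => rfl)
  · rintro ⟨n, a, b⟩ h
    simp only [mem_sigma, HasAntidiagonal.mem_antidiagonal, mem_range, mem_filter,
      mem_product] at h ⊢
    omega
  · rintro ⟨a, b⟩ h
    simp only [mem_sigma, HasAntidiagonal.mem_antidiagonal, mem_range, mem_filter,
      mem_product] at h ⊢
    exact ⟨h.2, trivial⟩
  · rintro ⟨n, a, b⟩ h
    simp only [mem_sigma, HasAntidiagonal.mem_antidiagonal, mem_range] at h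
    obtain ⟨-, rfl⟩ := h
    rfl

/-- A square partial sum differs from a triangular one by terms with `i + j ≥ N`. So Cauchy products
may be truncated at `t = 1`. -/
theorem sum_sum_sub_sum_antidiagonal_mem {M : Type*} [AddCommGroup M] {F : ℕ → AddSubgroup M}
    (hF : Antitone F) {f : ℕ → ℕ → M} (hf : ∀ i j, f i j ∈ F (i + j)) (N : ℕ) :
    ∑ i ∈ range N, ∑ j ∈ range N, f i j - ∑ n ∈ range N, ∑ p ∈ antidiagonal n, f p.1 p.2 ∈ F N := by
  rw [sum_range_antidiagonal, ← sum_product', ← sum_filter_add_sum_filter_not (range N ×ˢ range N)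
    (fun p => p.1 + p.2 < N), add_sub_cancel_left]
  exact sum_mem fun p hp => hF (not_lt.1 (mem_filter.1 hp).2) (hf _ _)

variable {R A : Type*} [CommRing R] [CommRing A] [Algebra R A]

/-- `∑ f j` is a perturbation of the identity converging to an algebra endomorphism of the
`I`-adic completion. -/
structure IsAdicFlow (I : Ideal A) (f : ℕ → A →ₗ[R] A) : Prop where
  zero : f 0 = LinearMap.id
  mul : ∀ n a b, f n (a * b) = ∑ p ∈ antidiagonal n, f p.1 a * f p.2 b
  mem_pow : ∀ j n a, a ∈ I ^ n → f j a ∈ I ^ (n + j)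
  map_algebraMap : ∀ n, n ≠ 0 → ∀ r, f n (algebraMap R A r) = 0

namespace IsAdicFlow

variable {I : Ideal A} {f : ℕ → A →ₗ[R] A} (hf : IsAdicFlow I f)
include hf

theorem mem (j : ℕ) (a : A) : f j a ∈ I ^ j := by
  simpa using hf.mem_pow j 0 a (by simp)

theorem sum_algebraMap {n : ℕ} (hn : n ≠ 0) (r : R) :
    ∑ j ∈ range n, f j (algebraMap R A r) = algebraMap R A r := by
  obtain ⟨n, rfl⟩ := Nat.exists_eq_succ_of_ne_zero hn
  rw [sum_range_succ', sum_eq_zero fun j _ => hf.map_algebraMap (j + 1) j.succ_ne_zero r, zero_add,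
    hf.zero]
  rfl

theorem sum_mul_sub_mem (n : ℕ) (a b : A) :
    (∑ j ∈ range n, f j a) * (∑ j ∈ range n, f j b) - ∑ j ∈ range n, f j (a * b) ∈ I ^ n := by
  simp only [hf.mul, sum_mul_sum]
  exact sum_sum_sub_sum_antidiagonal_mem (F := fun n => (I ^ n).toAddSubgroup)
    (fun m n h => Ideal.pow_le_pow_right h) (f := fun i j => f i a * f j b)
    (fun i j => by
      have := Ideal.mul_mem_mul (hf.mem i a) (hf.mem j b)
      rwa [← pow_add] at this) n

theorem sum_sub_sum_mem {m n : ℕ} (h : m ≤ n) (a : A) :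
    ∑ j ∈ range n, f j a - ∑ j ∈ range m, f j a ∈ I ^ m := by
  rw [← sum_range_add_sum_Ico _ h, add_sub_cancel_left]
  exact sum_mem fun j hj => Ideal.pow_le_pow_right (mem_Ico.1 hj).1 (hf.mem j a)

theorem sum_sub_self_mem {m n : ℕ} (hn : n ≠ 0) {a : A} (ha : a ∈ I ^ m) :
    ∑ j ∈ range n, f j a - a ∈ I ^ (m + 1) := by
  obtain ⟨n, rfl⟩ := Nat.exists_eq_succ_of_ne_zero hn
  rw [sum_range_succ', hf.zero, LinearMap.id_apply, add_sub_cancel_right]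
  exact sum_mem fun j _ => Ideal.pow_le_pow_right (by omega) (hf.mem_pow (j + 1) m a ha)

/-- The homomorphism `a ↦ ∑ f j a` modulo `I ^ n`. -/
def levelHom (n : ℕ) : A →ₐ[R] A ⧸ I ^ n :=
  AlgHom.ofLinearMap ((Ideal.Quotient.mkₐ R (I ^ n)).toLinearMap ∘ₗ ∑ j ∈ range n, f j)
    (by
      rcases eq_or_ne n 0 with rfl | hn
      · exact Ideal.Quotient.eq.2 (by simp)
      · have h := hf.sum_algebraMap hn 1
        rw [map_one] at h
        simp [h, -map_sum])
    (fun a b => by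
      simp only [LinearMap.comp_apply, LinearMap.sum_apply, AlgHom.toLinearMap_apply,
        ← map_mul]
      exact (Ideal.Quotient.eq.2 (hf.sum_mul_sub_mem n a b)).symm)

theorem levelHom_apply (n : ℕ) (a : A) :
    hf.levelHom n a = Ideal.Quotient.mk (I ^ n) (∑ j ∈ range n, f j a) := by
  simp only [levelHom, AlgHom.ofLinearMap_apply, LinearMap.comp_apply, LinearMap.sum_apply]
  rfl

/-- The endomorphism `∑ f j` of `A / I ^ n`. -/
def level (n : ℕ) : A ⧸ I ^ n →ₐ[R] A ⧸ I ^ n :=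
  Ideal.Quotient.liftₐ (I ^ n) (hf.levelHom n) fun a ha => by
    rw [levelHom_apply, Ideal.Quotient.eq_zero_iff_mem]
    exact sum_mem fun j _ => Ideal.pow_le_pow_right (by omega) (hf.mem_pow j n a ha)

theorem level_mk (n : ℕ) (a : A) : hf.level n (Ideal.Quotient.mk (I ^ n) a) =
    Ideal.Quotient.mk (I ^ n) (∑ j ∈ range n, f j a) := by
  rw [← hf.levelHom_apply]
  exact Ideal.Quotient.liftₐ_apply _ _ _ _

/-- The map is the identity on each `I ^ m / I ^ (m + 1)`, so an element of the kernel climbs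
through the filtration one step at a time. -/
theorem level_injective (n : ℕ) : Function.Injective (hf.level n) := by
  rw [injective_iff_map_eq_zero]
  intro x hx
  obtain ⟨a, rfl⟩ := Ideal.Quotient.mk_surjective x
  rw [level_mk, Ideal.Quotient.eq_zero_iff_mem] at hx
  rw [Ideal.Quotient.eq_zero_iff_mem]
  suffices h : ∀ m ≤ n, a ∈ I ^ m from h n le_rfl
  intro m
  induction m with
  | zero => simp
  | succ m ih =>
    intro hm
    have h := sub_mem (Ideal.pow_le_pow_right hm hx)
      (hf.sum_sub_self_mem (by omega : n ≠ 0) (ih (by omega)))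
    rwa [sub_sub_cancel] at h

/-- For `a ∈ I ^ m` the error `∑ f j a - a` lies in `I ^ (m + 1)` and already has a preimage `x`;
then `a - x` maps to `a`. The induction runs on `k = n - m`. -/
theorem level_surjective (n : ℕ) : Function.Surjective (hf.level n) := by
  suffices h : ∀ k m, m + k = n → ∀ a ∈ I ^ m, ∃ x, hf.level n x = Ideal.Quotient.mk (I ^ n) a by
    intro x
    obtain ⟨a, rfl⟩ := Ideal.Quotient.mk_surjective x
    exact h n 0 (zero_add n) a (by simp)
  intro k
  induction k with
  | zero =>
    intro m hm a ha
    rw [add_zero] at hm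
    exact ⟨0, by rw [map_zero, eq_comm, Ideal.Quotient.eq_zero_iff_mem, ← hm]; exact ha⟩
  | succ k ih =>
    intro m hm a ha
    obtain ⟨x, hx⟩ := ih (m + 1) (by omega) _ (hf.sum_sub_self_mem (by omega : n ≠ 0) ha)
    refine ⟨Ideal.Quotient.mk (I ^ n) a - x, ?_⟩
    rw [map_sub, hx, level_mk, ← map_sub, sub_sub_cancel]

theorem factorPow_level {m n : ℕ} (h : m ≤ n) (x : A ⧸ I ^ n) :
    Ideal.Quotient.factorPow I h (hf.level n x) =
      hf.level m (Ideal.Quotient.factorPow I h x) := by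
  obtain ⟨a, rfl⟩ := Ideal.Quotient.mk_surjective x
  rw [level_mk]
  change Ideal.Quotient.mk (I ^ m) _ = hf.level m (Ideal.Quotient.mk (I ^ m) a)
  rw [level_mk]
  exact Ideal.Quotient.eq.2 (hf.sum_sub_sum_mem h a)

end IsAdicFlow

section

variable (I : Ideal A)

theorem mk_eq_val_iff (x : AdicCompletion I A) (n : ℕ) (a : A) :
    Submodule.Quotient.mk (p := (I ^ n • ⊤ : Submodule A A)) a = x.val n ↔
      Ideal.Quotient.mk (I ^ n) a = AdicCompletion.evalₐ I n x := by
  obtain ⟨b, hb⟩ := exists_rep I x n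
  have h : AdicCompletion.evalₐ I n x = Ideal.Quotient.mk (I ^ n) b := by
    have h1 : AdicCompletion.eval I A n x = Submodule.Quotient.mk b := hb.symm
    rw [← AdicCompletion.factor_eval_eq_evalₐ I x (by simp), h1]
    rfl
  rw [h, ← hb, Ideal.Quotient.eq, Submodule.Quotient.eq, smul_eq_mul, Ideal.mul_top]

theorem factorPow_evalₐ {m n : ℕ} (h : m ≤ n) (x : AdicCompletion I A) :
    Ideal.Quotient.factorPow I h (AdicCompletion.evalₐ I n x) = AdicCompletion.evalₐ I m x := by
  obtain ⟨a, ha⟩ := exists_rep I x n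
  rw [← (mk_eq_val_iff I x n a).1 ha, ← (mk_eq_val_iff I x m a).1 (rep_mono I x h ha)]
  rfl

end

namespace IsAdicFlow

variable {I : Ideal A} {f : ℕ → A →ₗ[R] A} (hf : IsAdicFlow I f)

/-- The endomorphism `∑ f j` of the completion. -/
def hom : AdicCompletion I A →ₐ[R] AdicCompletion I A :=
  AdicCompletion.liftAlgHom I
    (fun n => (hf.level n).comp ((AdicCompletion.evalₐ I n).restrictScalars R))
    fun {m n} h => by
      ext x
      change Ideal.Quotient.factorPow I h (hf.level n (AdicCompletion.evalₐ I n x)) =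
        hf.level m (AdicCompletion.evalₐ I m x)
      rw [factorPow_level, factorPow_evalₐ]

theorem evalₐ_hom (n : ℕ) (x : AdicCompletion I A) :
    AdicCompletion.evalₐ I n (hf.hom x) = hf.level n (AdicCompletion.evalₐ I n x) :=
  AdicCompletion.evalₐ_liftAlgHom I _ (fun {m n} h => by
    ext x
    change Ideal.Quotient.factorPow I h (hf.level n (AdicCompletion.evalₐ I n x)) =
      hf.level m (AdicCompletion.evalₐ I m x)
    rw [factorPow_level, factorPow_evalₐ]) n x

theorem hom_bijective : Function.Bijective hf.hom := by
  constructor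
  · intro x y h
    refine AdicCompletion.ext_evalₐ fun n => hf.level_injective n ?_
    rw [← evalₐ_hom, h, evalₐ_hom]
  · intro y
    choose g hg using fun n => hf.level_surjective n (AdicCompletion.evalₐ I n y)
    -- Injectivity at each level forces the chosen preimages to be compatible.
    have hc {m n : ℕ} (h : m ≤ n) : Ideal.Quotient.factorPow I h (g n) = g m := by
      apply hf.level_injective
      rw [← factorPow_level, hg, hg, factorPow_evalₐ]
    choose a ha using fun n => Ideal.Quotient.mk_surjective (g n)
    let x : AdicCompletion I A := ⟨fun n => Submodule.Quotient.mk (a n), fun {m n} h => by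
      refine (Submodule.Quotient.eq _).2 ?_
      have := hc h
      rw [← ha, ← ha] at this
      rw [smul_eq_mul, Ideal.mul_top]
      exact Ideal.Quotient.eq.1 this⟩
    refine ⟨x, AdicCompletion.ext_evalₐ fun n => ?_⟩
    rw [evalₐ_hom, ← hg, ← ha, (mk_eq_val_iff I x n (a n)).1 rfl]

/-- The automorphism `∑ f j` of the completion. -/
def equiv : AdicCompletion I A ≃ₐ[R] AdicCompletion I A :=
  AlgEquiv.ofBijective hf.hom hf.hom_bijective

theorem evalₐ_equiv (n : ℕ) (x : AdicCompletion I A) :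
    AdicCompletion.evalₐ I n (hf.equiv x) = hf.level n (AdicCompletion.evalₐ I n x) :=
  hf.evalₐ_hom n x

theorem evalₐ_equiv_of (n : ℕ) (a : A) :
    AdicCompletion.evalₐ I n (hf.equiv (AdicCompletion.of I A a)) =
      Ideal.Quotient.mk (I ^ n) (∑ j ∈ range n, f j a) := by
  rw [evalₐ_equiv, AdicCompletion.evalₐ_of, level_mk]

theorem evalOneₐ_equiv (x : AdicCompletion I A) :
    AdicCompletion.evalOneₐ I (hf.equiv x) = AdicCompletion.evalOneₐ I x := by
  rw [← AdicCompletion.factorₐ_evalₐ_one, ← AdicCompletion.factorₐ_evalₐ_one, evalₐ_equiv]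
  obtain ⟨a, ha⟩ := Ideal.Quotient.mk_surjective (AdicCompletion.evalₐ I 1 x)
  rw [← ha, level_mk, sum_range_one, hf.zero]
  rfl

end IsAdicFlow

end Truncation

/-! ### Degree two forms and their adic filtration inside the exterior algebra. -/

section

variable {R A : Type*} [CommRing R] [CommRing A] [Algebra R A] {I : Ideal A}

theorem iotaMulti_two_coe (v : Fin 2 → Ω[A⁄R]) :
    ((exteriorPower.ιMulti A 2 v : Form R A 2) : Forms R A) =
      ExteriorAlgebra.ι A (v 0) * ExteriorAlgebra.ι A (v 1) := by
  rw [exteriorPower.ιMulti_apply_coe, ExteriorAlgebra.ιMulti_apply]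
  simp

theorem smul_dForm_mul_dForm_eq (a b c : A) :
    (⟨a • (dForm R A b * dForm R A c),
      Submodule.smul_mem _ a (dForm_mul_dForm_mem b c)⟩ : Form R A 2) =
        a • exteriorPower.ιMulti A 2 (fun i => KaehlerDifferential.D R A (![b, c] i)) := by
  refine Subtype.ext ?_
  rw [Submodule.coe_smul, iotaMulti_two_coe]
  simp

theorem map_subtype_smul_top (J : Ideal A) (k : ℕ) :
    (J • ⊤ : Submodule A (Form R A k)).map (⋀[A]^k (Ω[A⁄R])).subtype = J • ⋀[A]^k (Ω[A⁄R]) := by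
  rw [Submodule.map_smul'', Submodule.map_top, Submodule.range_subtype]

theorem mem_formFil_of_mem_smul_top {k n : ℕ} {x : Form R A k}
    (hx : x ∈ (I ^ n • ⊤ : Submodule A (Form R A k))) : (x : Forms R A) ∈ formFil R I n := by
  have h := Submodule.mem_map_of_mem (f := (⋀[A]^k (Ω[A⁄R])).subtype) hx
  rw [map_subtype_smul_top] at h
  exact Submodule.smul_mono le_rfl le_top h

end

theorem mem_smul_top_of_mem_formFil {R A : Type*} [Field R] [CommRing A] [Algebra R A]
    {I : Ideal A} {k n : ℕ} {x : Form R A k} (hx : (x : Forms R A) ∈ formFil R I n) :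
    x ∈ (I ^ n • ⊤ : Submodule A (Form R A k)) := by
  have h := mem_smul_of_mem_formFil hx x.2
  rw [← map_subtype_smul_top] at h
  obtain ⟨z, hz, hzx⟩ := h
  rwa [show x = z from Subtype.ext hzx.symm]

/-! ## Moser's theorem on the completion of an algebra -/

section

open Finset

variable {R A : Type*} [Field R] [CharZero R] [CommRing A] [Algebra R A] {I : Ideal A}
  {ω : Form R A 2} (hω : IsSymplecticForm ω) {γ : ℕ → Forms R A}

theorem isAdicFlow_moserFlowFun (hγ : ∀ n, γ n ∈ formFil R I (n + 2)) :
    IsAdicFlow I (fun n => moserFlowFun hω (γ := γ) n) where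
  zero := flow_zero
  mul := moserFlowFun_mul hω
  mem_pow j _ _ := moserFlowFun_mem hω hγ j
  map_algebraMap _ hn r := moserFlowFun_algebraMap hω hn r

theorem sum_mul_sum_sub_sum_moserFlow_mem (hγ : ∀ n, γ n ∈ formFil R I (n + 2)) (N : ℕ)
    (x y : Forms R A) :
    (∑ j ∈ range N, moserFlow hω (γ := γ) j x) * (∑ j ∈ range N, moserFlow hω (γ := γ) j y) -
      ∑ j ∈ range N, moserFlow hω (γ := γ) j (x * y) ∈ formFil R I N := by
  simp only [moserFlow_mul, sum_mul_sum]
  refine sum_sum_sub_sum_antidiagonal_mem (F := fun n => (formFil R I n).toAddSubgroup)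
    (fun m n h => formFil_mono h)
    (f := fun i j => moserFlow hω (γ := γ) i x * moserFlow hω (γ := γ) j y)
    (fun i j => mul_mem_formFil le_rfl ?_ ?_) N
  · simpa using moserFlow_mem hω hγ i (n := 0) (mem_formFil_zero x)
  · simpa using moserFlow_mem hω hγ j (n := 0) (mem_formFil_zero y)

theorem sum_smul_sum_sub_sum_moserFlow_mem (hγ : ∀ n, γ n ∈ formFil R I (n + 2)) (N : ℕ)
    (a : A) (x : Forms R A) :
    (∑ j ∈ range N, moserFlowFun hω (γ := γ) j a) • (∑ j ∈ range N, moserFlow hω (γ := γ) j x) -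
      ∑ j ∈ range N, moserFlow hω (γ := γ) j (a • x) ∈ formFil R I N := by
  have h := sum_mul_sum_sub_sum_moserFlow_mem hω hγ N (algebraMap A _ a) x
  simpa only [moserFlow_algebraMap, ← map_sum, ← Algebra.smul_def] using h

variable {ψ : A →ₐ[R] AdicCompletion I A}

/-- The formal pullback is defined through completed differentials, the flow through Lie
derivatives. This identifies the two modulo `I ^ n`. -/
theorem exists_formalPullback_rep (hγ : ∀ n, γ n ∈ formFil R I (n + 2))
    (hψ : ∀ n a, AdicCompletion.evalₐ I n (ψ a) =
      Ideal.Quotient.mk (I ^ n) (∑ j ∈ range n, moserFlowFun hω (γ := γ) j a))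
    (x : Form R A 2) (n : ℕ) :
    ∃ y : Form R A 2, Submodule.Quotient.mk (p := (I ^ n • ⊤ : Submodule A (Form R A 2))) y =
        (formalPullback I ψ x).val n ∧
      (y : Forms R A) - ∑ j ∈ range (n + 1), moserFlow hω (γ := γ) j x ∈ formFil R I n := by
  obtain ⟨x, hx⟩ := x
  induction hx using two_form_induction with
  | h0 =>
    refine ⟨0, ?_, ?_⟩
    · change _ = (formalPullback I ψ 0).val n
      rw [map_zero]; rfl
    · simp
  | hadd x hx x' hx' h h' =>
    obtain ⟨y, h1, h2⟩ := h
    obtain ⟨y', h1', h2'⟩ := h'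
    refine ⟨y + y', ?_, ?_⟩
    · change _ = (formalPullback I ψ (⟨x, hx⟩ + ⟨x', hx'⟩)).val n
      rw [map_add, Submodule.Quotient.mk_add, h1, h1']
      rfl
    · simp only [map_add, sum_add_distrib, Submodule.coe_add] at h2 h2' ⊢
      rw [add_sub_add_comm]
      exact add_mem h2 h2'
  | hd a b c =>
    -- The completed differential modulo `I ^ n` needs its argument modulo `I ^ (n + 1)`, hence `n +
    -- 1` terms.
    let T (a : A) : A := ∑ j ∈ range (n + 1), moserFlowFun hω (γ := γ) j a
    have hflow := isAdicFlow_moserFlowFun hω hγ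
    have hT (a : A) : Ideal.Quotient.mk (I ^ n) (T a) = AdicCompletion.evalₐ I n (ψ a) := by
      rw [hψ]
      exact Ideal.Quotient.eq.2 (hflow.sum_sub_sum_mem n.le_succ a)
    refine ⟨T a • exteriorPower.ιMulti A 2
      (fun i => KaehlerDifferential.D R A (T (![b, c] i))), ?_, ?_⟩
    · rw [smul_dForm_mul_dForm_eq, map_smulₛₗ, formalPullback, pullback_iotaMulti]
      refine rep_smul I _ _ n ((mk_eq_val_iff I _ n _).2 (hT a)) ?_
      refine (completedAlternatingFun_eq I _ _ n fun i => ?_).symm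
      rw [pullbackOne_D]
      refine (completedDFun_eq I _ n ?_).symm
      rw [mk_eq_val_iff, hψ]
    · have hTd (b : A) : dForm R A (T b) =
          ∑ j ∈ range (n + 1), moserFlow hω (γ := γ) j (dForm R A b) := by
        simp only [moserFlow_dForm, T]
        simp only [dForm, map_sum]
      rw [Submodule.coe_smul, iotaMulti_two_coe]
      change T a • (dForm R A (T b) * dForm R A (T c)) - _ ∈ _
      rw [hTd, hTd]
      have h1 := Submodule.smul_mem _ (T a) (sum_mul_sum_sub_sum_moserFlow_mem hω hγ (n + 1)
        (dForm R A b) (dForm R A c))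
      have h2 := sum_smul_sum_sub_sum_moserFlow_mem hω hγ (n + 1) a (dForm R A b * dForm R A c)
      rw [smul_sub] at h1
      have := add_mem h1 h2
      rw [sub_add_sub_cancel] at this
      exact formFil_mono n.le_succ this

/-- Evaluation of `φ η = ω` at `t = 1`: modulo `I ^ n`, replace `ω'` by a partial sum of the path,
then the double sum by its antidiagonals. -/
theorem formalPullback_eq_of (hγ : ∀ n, γ n ∈ formFil R I (n + 2))
    (hγ' : ∀ n, γ n ∈ (ExteriorAlgebra.ι A (M := Ω[A⁄R])).range)
    (hψ : ∀ n a, AdicCompletion.evalₐ I n (ψ a) =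
      Ideal.Quotient.mk (I ^ n) (∑ j ∈ range n, moserFlowFun hω (γ := γ) j a))
    {ω' : Form R A 2}
    (hω' : ∀ n, (ω' : Forms R A) - ∑ k ∈ range (n + 1), formPath ω γ k ∈ formFil R I (n + 1)) :
    formalPullback I ψ ω' = AdicCompletion.of I (Form R A 2) ω := by
  refine AdicCompletion.ext fun n => ?_
  obtain ⟨y, hy, hy'⟩ := exists_formalPullback_rep hω hγ hψ ω' n
  rw [← hy]
  refine (Submodule.Quotient.eq _).2 ?_
  have hη (k : ℕ) : formPath ω γ k ∈ formFil R I k := by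
    cases k with
    | zero => exact mem_formFil_zero _
    | succ k => exact extDer_mem_formFil (hγ k)
  have h1 : ∑ j ∈ range (n + 1), moserFlow hω (γ := γ) j ω' -
      ∑ j ∈ range (n + 1), ∑ k ∈ range (n + 1), moserFlow hω (γ := γ) j (formPath ω γ k) ∈
        formFil R I n := by
    rw [← sum_sub_distrib]
    refine sum_mem fun j _ => ?_
    rw [← map_sum, ← map_sub]
    exact formFil_mono (by omega) (moserFlow_mem hω hγ j (hω' n))
  have h2 : ∑ j ∈ range (n + 1), ∑ k ∈ range (n + 1), moserFlow hω (γ := γ) j (formPath ω γ k) -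
      ω ∈ formFil R I (n + 1) := by
    have h := sum_sum_sub_sum_antidiagonal_mem (F := fun n => (formFil R I n).toAddSubgroup)
      (fun m n h => formFil_mono h) (f := fun j k => moserFlow hω (γ := γ) j (formPath ω γ k))
      (fun i j => by
        have := moserFlow_mem hω hγ i (hη j)
        rwa [add_comm] at this) (n + 1)
    -- All coefficients of `φ η` of positive degree vanish; only `φ₀ η₀ = ω` remains.
    rw [sum_range_succ' (fun n => ∑ p ∈ antidiagonal n, _),
      sum_eq_zero fun n _ => sum_moserFlow_formPath hω hγ' n, zero_add] at h
    simpa [moserFlow, flow_zero, formPath] using h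
  have h3 := add_mem hy' (add_mem h1 (formFil_mono n.le_succ h2))
  rw [sub_add_sub_cancel, sub_add_sub_cancel] at h3
  exact mem_smul_top_of_mem_formFil h3

end

/-! ### The automorphism defined by a pair of symplectic forms and an Euler vector field -/

section

open Finset

variable {R A : Type*} [Field R] [CharZero R] [CommRing A] [Algebra R A] {I : Ideal A}
  {e : Derivation R A A} {ω₀ ω₁ : Form R A 2}

/-- The coefficients of the automorphism carrying `ω₁` to `ω₀`. -/
def moserSeries (e : Derivation R A A) (h₀ : IsSymplecticForm ω₀) (ω₁ : Form R A 2) (n : ℕ) :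
    A →ₗ[R] A :=
  moserFlowFun h₀ (γ := primitive e (ω₁ - ω₀ : Forms R A)) n

theorem IsEuler.isAdicFlow_moserSeries (he : IsEuler I e) (h₀ : IsSymplecticForm ω₀)
    (h₁ : IsSymplecticForm ω₁) (h : ω₁ - ω₀ ∈ (I • ⊤ : Submodule A (Form R A 2))) :
    IsAdicFlow I (moserSeries e h₀ ω₁) :=
  isAdicFlow_moserFlowFun h₀ (he.primitive_mem_formFil (ω₁ - ω₀).2
    (by rw [extDer_sub, h₁.closed, h₀.closed, sub_zero])
    (mem_formFil_of_mem_smul_top (x := ω₁ - ω₀) (by rwa [pow_one])))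

theorem IsEuler.formalPullback_eq (he : IsEuler I e) (h₀ : IsSymplecticForm ω₀)
    (h₁ : IsSymplecticForm ω₁) (h : ω₁ - ω₀ ∈ (I • ⊤ : Submodule A (Form R A 2))) :
    formalPullback I (((he.isAdicFlow_moserSeries h₀ h₁ h).equiv :
      AdicCompletion I A →ₐ[R] AdicCompletion I A).comp (toCompletion R I)) ω₁ =
        AdicCompletion.of I (Form R A 2) ω₀ := by
  have hd : extDer R A (ω₁ - ω₀ : Forms R A) = 0 := by
    rw [extDer_sub, h₁.closed, h₀.closed, sub_zero]
  have hI : (ω₁ - ω₀ : Forms R A) ∈ formFil R I 1 :=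
    mem_formFil_of_mem_smul_top (x := ω₁ - ω₀) (by rwa [pow_one])
  refine formalPullback_eq_of h₀ (he.primitive_mem_formFil (ω₁ - ω₀).2 hd hI)
    (primitive_mem_range_iota (ω₁ - ω₀).2 hd)
    (fun n a => (he.isAdicFlow_moserSeries h₀ h₁ h).evalₐ_equiv_of n a) fun n => ?_
  have h := sum_extDer_primitive e (ω₁ - ω₀ : Forms R A) n
  rw [sum_range_succ']
  change (ω₁ : Forms R A) - (∑ k ∈ range n, extDer R A (primitive e (ω₁ - ω₀ : Forms R A) k) +
    ω₀) ∈ _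
  rw [h, show (ω₁ : Forms R A) - (ω₁ - ω₀ - remainder e (ω₁ - ω₀ : Forms R A) n + ω₀) =
    remainder e (ω₁ - ω₀ : Forms R A) n by abel]
  exact he.remainder_mem_formFil (ω₁ - ω₀).2 hd hI n

end

/-! ## Functoriality for étale homomorphisms -/

section Functoriality

variable {R A B : Type*} [CommRing R] [CommRing A] [CommRing B] [Algebra R A] [Algebra R B]

/-- The pullback homomorphism of algebras of forms. -/
def formsMap (f : A →ₐ[R] B) : Forms R A →+* Forms R B :=
  letI : Algebra A B := f.toRingHom.toAlgebra
  haveI : IsScalarTower R A B := IsScalarTower.of_algebraMap_eq fun r => (f.commutes r).symm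
  (ExteriorAlgebra.lift A (A := Forms R B)
    ⟨(ExteriorAlgebra.ι B).restrictScalars A ∘ₗ KaehlerDifferential.map R R A B,
      fun m => ExteriorAlgebra.ι_sq_zero (R := B) (KaehlerDifferential.map R R A B m)⟩).toRingHom

theorem formsMap_smul (f : A →ₐ[R] B) (a : A) (x : Forms R A) :
    formsMap f (a • x) = f a • formsMap f x := by
  let : Algebra A B := f.toRingHom.toAlgebra
  have : IsScalarTower R A B := IsScalarTower.of_algebraMap_eq fun r => (f.commutes r).symm
  exact (map_smul (ExteriorAlgebra.lift A (A := Forms R B) _) a x).trans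
    (algebraMap_smul B a (formsMap f x)).symm

theorem formsMap_dForm (f : A →ₐ[R] B) (a : A) : formsMap f (dForm R A a) = dForm R B (f a) := by
  let : Algebra A B := f.toRingHom.toAlgebra
  have : IsScalarTower R A B := IsScalarTower.of_algebraMap_eq fun r => (f.commutes r).symm
  refine (ExteriorAlgebra.lift_ι_apply A _ _ _).trans ?_
  change ExteriorAlgebra.ι B (KaehlerDifferential.map R R A B _) = _
  rw [KaehlerDifferential.map_D]
  rfl

theorem formsMap_algebraMap_smul (f : A →ₐ[R] B) (r : R) (x : Forms R A) :
    formsMap f (r • x) = r • formsMap f x := by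
  rw [← algebraMap_smul A r x, formsMap_smul, f.commutes, algebraMap_smul]

variable {f : A →ₐ[R] B}

theorem formsMap_extDer (x : Forms R A) :
    formsMap f (extDer R A x) = extDer R B (formsMap f x) := by
  induction x using forms_induction with
  | h1 => rw [extDer_one, map_zero, map_one, extDer_one]
  | hadd x y hx hy => rw [extDer_add, map_add, hx, hy, map_add, extDer_add]
  | hsmul a x hx =>
    rw [extDer_smul, map_add, map_mul, formsMap_dForm, formsMap_smul, hx, formsMap_smul,
      extDer_smul]
  | hd b x hx =>
    rw [extDer_dForm_mul, map_neg, map_mul, formsMap_dForm, hx, map_mul, formsMap_dForm,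
      extDer_dForm_mul]

theorem formsMap_contract {v : Derivation R A A} {w : Derivation R B B}
    (h : ∀ a, w (f a) = f (v a)) (x : Forms R A) :
    formsMap f (contract v x) = contract w (formsMap f x) := by
  induction x using forms_induction with
  | h1 => rw [contract_one, map_zero, map_one, contract_one]
  | hadd x y hx hy => rw [contract_add, map_add, hx, hy, map_add, contract_add]
  | hsmul a x hx => rw [contract_smul, formsMap_smul, hx, formsMap_smul, contract_smul]
  | hd b x hx =>
    rw [contract_dForm_mul, map_sub, formsMap_smul, map_mul, formsMap_dForm, hx, map_mul,
      formsMap_dForm, contract_dForm_mul, h]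

theorem formsMap_lieDer {v : Derivation R A A} {w : Derivation R B B}
    (h : ∀ a, w (f a) = f (v a)) (x : Forms R A) :
    formsMap f (lieDer v x) = lieDer w (formsMap f x) := by
  rw [lieDer_apply, map_add, formsMap_extDer, formsMap_contract h, formsMap_contract h,
    formsMap_extDer, lieDer_apply]

theorem mapForm_coe (x : Form R A 2) : (mapForm f x : Forms R B) = formsMap f x := by
  obtain ⟨x, hx⟩ := x
  induction hx using two_form_induction with
  | h0 =>
    change ((mapForm f (0 : Form R A 2) : Form R B 2) : Forms R B) = formsMap f 0
    rw [map_zero, map_zero]; rfl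
  | hadd x hx y hy h h' =>
    change ((mapForm f (⟨x, hx⟩ + ⟨y, hy⟩ : Form R A 2) : Form R B 2) : Forms R B) = _
    rw [map_add, Submodule.coe_add, h, h', ← map_add]
  | hd a b c =>
    rw [smul_dForm_mul_dForm_eq, map_smulₛₗ, mapForm, pullback_iotaMulti, Submodule.coe_smul,
      iotaMulti_two_coe, Submodule.coe_smul, iotaMulti_two_coe, formsMap_smul, map_mul]
    simp only [pullbackOne_D]
    change _ = f a • (formsMap f (dForm R A b) * formsMap f (dForm R A c))
    rw [formsMap_dForm, formsMap_dForm]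
    rfl

/-- An extension to `B` of the vector field of `x` contracts `ω'` to the pullback of `x`, so by
nondegeneracy of `ω'` it is the vector field of that pullback. -/
theorem sharpForm_apply_map {ω : Form R A 2} (hω : IsSymplecticForm ω) {ω' : Form R B 2}
    (hω' : IsSymplecticForm ω') (h : mapForm f ω = ω')
    (hf : ∀ v : Derivation R A A, ∃ w : Derivation R B B, ∀ a, w (f a) = f (v a))
    {x : Forms R A} (hx : x ∈ (ExteriorAlgebra.ι A (M := Ω[A⁄R])).range) (a : A) :
    hω'.sharpForm (formsMap f x) (f a) = f (hω.sharpForm x a) := by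
  obtain ⟨w, hw⟩ := hf (hω.sharpForm x)
  rw [← hω'.sharpForm_unique (v := w) (x := formsMap f x), hw]
  rw [← h, mapForm_coe, ← formsMap_contract hw, hω.contract_sharpForm hx]

end Functoriality

section

open Finset

variable {R A B : Type*} [Field R] [CommRing A] [CommRing B] [Algebra R A] [Algebra R B]
  {f : A →ₐ[R] B}

theorem formsMap_primitive {v : Derivation R A A} {w : Derivation R B B}
    (h : ∀ a, w (f a) = f (v a)) (x : Forms R A) (n : ℕ) :
    formsMap f (primitive v x n) = primitive w (formsMap f x) n := by
  have h1 (n : ℕ) (x : Forms R A) :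
      formsMap f (approxInv v n x) = approxInv w n (formsMap f x) := by
    simp only [approxInv, formsMap_algebraMap_smul, map_add, map_sub, formsMap_lieDer h]
  have h2 : formsMap f (remainder v x n) = remainder w (formsMap f x) n := by
    induction n with
    | zero => rfl
    | succ n ih =>
      rw [remainder, remainder, map_sub, formsMap_extDer, formsMap_contract h, h1, ih]
  rw [primitive, formsMap_contract h, h1, h2, primitive]

variable {ω : Form R A 2} (hω : IsSymplecticForm ω) {ω' : Form R B 2}
  (hω' : IsSymplecticForm ω')

theorem moserField_apply_map (h : mapForm f ω = ω')
    (hf : ∀ v : Derivation R A A, ∃ w : Derivation R B B, ∀ a, w (f a) = f (v a))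
    {γ : ℕ → Forms R A} (hγ : ∀ n, γ n ∈ (ExteriorAlgebra.ι A (M := Ω[A⁄R])).range)
    {γ' : ℕ → Forms R B} (hγ' : ∀ n, formsMap f (γ n) = γ' n) (n : ℕ) (a : A) :
    moserField hω' γ' n (f a) = f (moserField hω γ n a) := by
  induction n using Nat.strong_induction_on generalizing a with
  | _ n ih =>
    rw [moserField_eq, moserField_eq, Derivation.neg_apply, Derivation.neg_apply, map_neg,
      ← sharpForm_apply_map hω hω' h hf (moserField_arg_mem hω hγ n), map_add (formsMap f),
      map_sum (formsMap f), formsMap_algebraMap_smul, hγ']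
    refine congrArg (fun x => -hω'.sharpForm ((n + 1 : R) • γ' n + x) (f a)) ?_
    refine sum_congr rfl fun k hk => ?_
    rw [formsMap_contract (ih k (mem_range.1 hk)), formsMap_extDer, hγ']

theorem moserSeries_map (h : mapForm f ω = ω') {v : Derivation R A A} {w : Derivation R B B}
    (hvw : ∀ a, w (f a) = f (v a))
    (hf : ∀ v : Derivation R A A, ∃ w : Derivation R B B, ∀ a, w (f a) = f (v a))
    {η : Form R A 2} (hη : IsSymplecticForm η) {η' : Form R B 2} (hη' : mapForm f η = η')
    (n : ℕ) (a : A) :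
    f (moserSeries v hω η n a) = moserSeries w hω' η' n (f a) := by
  refine flow_intertwine f.toLinearMap (fun n a => ?_) n a
  refine (moserField_apply_map hω hω' h hf
    (primitive_mem_range_iota (η - ω).2 ?_) (fun n => ?_) n a).symm
  · rw [Submodule.coe_sub, extDer_sub, hη.closed, hω.closed, sub_zero]
  · rw [Submodule.coe_sub, formsMap_primitive hvw, map_sub, ← mapForm_coe, ← mapForm_coe, h, hη']

end

/-! ### Extension and uniqueness of derivations along étale homomorphisms. -/

section Etale

variable {R A B : Type*} [CommRing R] [CommRing A] [CommRing B] [Algebra R B]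

open TensorProduct in
-- For `B` formally étale over `A`, `Ω[B⁄R]` is the base change of `Ω[A⁄R]`.
theorem exists_derivation_extension [Algebra R A] [Algebra A B] [IsScalarTower R A B]
    [Algebra.FormallyEtale A B] (v : Derivation R A B) :
    ∃ w : Derivation R B B, ∀ a, w (algebraMap A B a) = v a := by
  let l : B ⊗[A] Ω[A⁄R] →ₗ[B] B := LinearMap.liftBaseChange B v.liftKaehlerDifferential
  let l' : Ω[B⁄R] →ₗ[B] B :=
    l ∘ₗ (KaehlerDifferential.tensorKaehlerEquivOfFormallyEtale R A B).symm.toLinearMap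
  refine ⟨l'.compDer (KaehlerDifferential.D R B), fun a => ?_⟩
  change l ((KaehlerDifferential.tensorKaehlerEquivOfFormallyEtale R A B).symm
    (KaehlerDifferential.D R B (algebraMap A B a))) = v a
  rw [KaehlerDifferential.tensorKaehlerEquivOfFormallyEtale_symm_D_algebraMap]
  simp [l]

/-- The difference is an `A`-derivation, and `Ω[B⁄A] = 0`. -/
theorem derivation_ext_of_formallyUnramified {M : Type*} [AddCommGroup M] [Module B M] [Module R M]
    [Algebra A B] [Module A M] [IsScalarTower A B M] [Algebra.FormallyUnramified A B]
    {v w : Derivation R B M} (h : ∀ a : A, v (algebraMap A B a) = w (algebraMap A B a)) :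
    v = w := by
  let u : Derivation A B M :=
    { toFun := fun b => v b - w b
      map_add' := fun a b => by rw [map_add, map_add, add_sub_add_comm]
      map_smul' := fun a b => by
        rw [Algebra.smul_def, Derivation.leibniz, Derivation.leibniz, h, add_sub_add_right_eq_sub,
          ← smul_sub, algebraMap_smul, RingHom.id_apply]
      map_one_eq_zero' := by simp
      leibniz' := fun a b => by
        change v (a * b) - w (a * b) = a • (v b - w b) + b • (v a - w a)
        rw [Derivation.leibniz, Derivation.leibniz, smul_sub, smul_sub]
        abel }
  have hu : u = 0 :=
    (KaehlerDifferential.linearMapEquivDerivation A B (M := M)).symm.injective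
      (Subsingleton.elim _ _)
  ext b
  exact sub_eq_zero.1 (congrArg (fun d : Derivation A B M => d b) hu)

end Etale

/-! ## Reducedness of smooth algebras and pointwise vanishing -/

section

open TensorProduct Polynomial

/-- A nilpotent `s` gives the integral element `s X` of `S[X]`, but over a field the formation of
the integral closure commutes with smooth base change, and `K` is integrally closed in `K[X]`. -/
theorem isReduced_of_smooth_of_field (K S : Type*) [Field K] [CommRing S] [Algebra K S]
    [Algebra.Smooth K S] : IsReduced S where
  eq_zero s hs := by
    let t : S ⊗[K] K[X] := s ⊗ₜ X
    have ht : IsIntegral S t := by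
      obtain ⟨n, hn⟩ := hs
      refine IsIntegral.of_pow n.succ_pos ?_
      rw [Algebra.TensorProduct.tmul_pow, pow_succ, hn, zero_mul, zero_tmul]
      exact isIntegral_zero
    obtain ⟨y, hy⟩ := (TensorProduct.toIntegralClosure_bijective_of_smooth
      (R := K) (S := S) (B := K[X])).2 ⟨t, ht⟩
    -- The coefficient of `X`. It vanishes on the image of the integral closure, since a polynomial
    -- algebraic over `K` is constant, while it sends `s X` to `s`.
    let ℓ : S ⊗[K] K[X] →ₗ[K] S :=
      (TensorProduct.rid K S).toLinearMap ∘ₗ (lcoeff K 1).lTensor S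
    have h0 : ℓ (TensorProduct.toIntegralClosure K S K[X] y) = 0 := by
      clear hy
      induction y with
      | zero => simp
      | add x y hx hy => rw [map_add, Subalgebra.coe_add, map_add, hx, hy, add_zero]
      | tmul s p =>
        have hp : p.1.coeff 1 = 0 := by
          refine coeff_eq_zero_of_natDegree_lt ?_
          by_contra h
          exact Polynomial.transcendental p.1 (by omega) (by simpa using fun h0 => h (by simp [h0])) p.2.isAlgebraic
        change (TensorProduct.rid K S) (s ⊗ₜ p.1.coeff 1) = 0
        rw [hp, tmul_zero, map_zero]
    rw [hy] at h0
    simpa [ℓ, t] using h0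

/-- By functoriality, an exterior power of a retract of a free module is a retract of an exterior
power of that free module. -/
theorem projective_exteriorPower {A M : Type*} [CommRing A] [AddCommGroup M] [Module A M]
    [Module.Projective A M] (n : ℕ) : Module.Projective A (⋀[A]^n M) := by
  obtain ⟨s, hs⟩ := Module.projective_def'.1 (inferInstance : Module.Projective A M)
  refine Module.Projective.of_split (exteriorPower.map n s)
    (exteriorPower.map n (Finsupp.linearCombination A id)) ?_
  rw [← exteriorPower.map_comp, hs, exteriorPower.map_id]

theorem mem_smul_top_of_forall_dual {A M : Type*} [CommRing A] [AddCommGroup M] [Module A M]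
    [Module.Projective A M] {J : Ideal A} {x : M} (h : ∀ ℓ : M →ₗ[A] A, ℓ x ∈ J) :
    x ∈ (J • ⊤ : Submodule A M) := by
  obtain ⟨s, hs⟩ := Module.projective_def'.1 (inferInstance : Module.Projective A M)
  have hx : Finsupp.linearCombination A id (s x) = x := LinearMap.congr_fun hs x
  rw [← hx, Finsupp.linearCombination_apply]
  exact sum_mem fun m _ => Submodule.smul_mem_smul (h (Finsupp.lapply m ∘ₗ s)) trivial

end

/-! ## Sections over affine opens -/

section Sections

variable {X : Scheme.{0}} [X.Over SpecC]

theorem res_apply {U V : X.Opens} (h : V ≤ U) (f : Γ(X, U)) :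
    res h f = X.presheaf.map (homOfLE h).op f := rfl

theorem res_res {U V W : X.Opens} (h : V ≤ U) (h' : W ≤ V) (f : Γ(X, U)) :
    res h' (res h f) = res (h'.trans h) f := by
  rw [res_apply, res_apply, res_apply, ← CommRingCat.comp_apply, ← Functor.map_comp]
  rfl

theorem res_self {U : X.Opens} (f : Γ(X, U)) : res le_rfl f = f := by
  change X.presheaf.map (𝟙 _) f = f
  rw [CategoryTheory.Functor.map_id]
  rfl

/-- Restriction is the map on sections induced by the identity of `X`, an étale morphism. No
reduction to basic opens is needed. -/
theorem etale_res {U V : X.Opens} (hU : IsAffineOpen U) (hV : IsAffineOpen V) (h : V ≤ U) :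
    (res h).toRingHom.Etale := by
  have h1 := (𝟙 X : X ⟶ X).etale_appLE hU hV h
  have h2 : (𝟙 X : X ⟶ X).appLE U V h = X.presheaf.map (homOfLE h).op := by
    simp only [Scheme.Hom.appLE, Scheme.Hom.id_app]
    exact Category.id_comp _
  rw [h2] at h1
  exact h1

theorem exists_res_derivation_extension {U V : X.Opens} (hU : IsAffineOpen U)
    (hV : IsAffineOpen V) (h : V ≤ U) (v : Derivation ℂ Γ(X, U) Γ(X, U)) :
    ∃ w : Derivation ℂ Γ(X, V) Γ(X, V), ∀ a, w (res h a) = res h (v a) := by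
  let : Algebra Γ(X, U) Γ(X, V) := (res h).toRingHom.toAlgebra
  have : IsScalarTower ℂ Γ(X, U) Γ(X, V) :=
    IsScalarTower.of_algebraMap_eq fun r => ((res h).commutes r).symm
  have : Algebra.Etale Γ(X, U) Γ(X, V) := etale_res hU hV h
  exact exists_derivation_extension (A := Γ(X, U))
    ((Algebra.linearMap Γ(X, U) Γ(X, V)).compDer v)

theorem res_derivation_ext {U V : X.Opens} (hU : IsAffineOpen U) (hV : IsAffineOpen V)
    (h : V ≤ U) {v w : Derivation ℂ Γ(X, V) Γ(X, V)}
    (hvw : ∀ a : Γ(X, U), v (res h a) = w (res h a)) : v = w := by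
  let : Algebra Γ(X, U) Γ(X, V) := (res h).toRingHom.toAlgebra
  have : IsScalarTower ℂ Γ(X, U) Γ(X, V) :=
    IsScalarTower.of_algebraMap_eq fun r => ((res h).commutes r).symm
  have : Algebra.Etale Γ(X, U) Γ(X, V) := etale_res hU hV h
  exact derivation_ext_of_formallyUnramified (A := Γ(X, U)) hvw

theorem algebra_smooth [Smooth (X ↘ SpecC)] {U : X.Opens} (hU : IsAffineOpen U) :
    Algebra.Smooth ℂ Γ(X, U) := by
  have h1 := (X ↘ SpecC).smooth_appLE (isAffineOpen_top SpecC) hU le_top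
  have h2 : (scalars X U).hom.Smooth := by
    rw [scalars, CommRingCat.hom_comp]
    exact RingHom.Smooth.respectsIso.2 _
      (Scheme.ΓSpecIso (CommRingCat.of ℂ)).symm.commRingCatIsoToRingEquiv h1
  exact h2

theorem isReduced_of_smooth [Smooth (X ↘ SpecC)] : AlgebraicGeometry.IsReduced X := by
  have (x : X) : _root_.IsReduced (X.presheaf.stalk x) := by
    obtain ⟨U, hU, hx, -⟩ := exists_isAffineOpen_mem_and_subset (X := X) (x := x) (U := ⊤) trivial
    have := algebra_smooth hU
    have := isReduced_of_smooth_of_field ℂ Γ(X, U)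
    have := hU.isLocalization_stalk ⟨x, hx⟩
    change _root_.IsReduced (X.presheaf.stalk (⟨x, hx⟩ : U).1)
    exact @isReduced_localizationPreserves _ _ (hU.primeIdealOf ⟨x, hx⟩).asIdeal.primeCompl _ _
      (TopCat.Presheaf.algebra_section_stalk X.presheaf ⟨x, hx⟩) this ‹_›
  exact isReduced_of_isReduced_stalk X

end Sections

/-! ## Local structure of vector bundles -/

theorem smooth_affineSpace (n : Type) [Finite n] (S : Scheme.{0}) : Smooth (𝔸(n; S) ↘ S) := by
  have h1 : Smooth (Spec.map (CommRingCat.ofHom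
      (algebraMap (ULift.{0} ℤ) (MvPolynomial n (ULift.{0} ℤ))))) :=
    (HasRingHomProperty.Spec_iff (P := @Smooth)).2 (RingHom.smooth_algebraMap.2
      (show Algebra.Smooth (ULift.{0} ℤ) (MvPolynomial n (ULift.{0} ℤ)) from
        ⟨inferInstance, inferInstance⟩))
  have h2 := Limits.isIso_of_isTerminal specULiftZIsTerminal.{0} Limits.terminalIsTerminal
    (Limits.terminal.from _)
  have h3 : Smooth (Limits.terminal.from
      (Spec (CommRingCat.of (MvPolynomial n (ULift.{0} ℤ))))) := by
    rw [← Limits.terminal.comp_from (Spec.map (CommRingCat.ofHom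
      (algebraMap (ULift.{0} ℤ) (MvPolynomial n (ULift.{0} ℤ)))))]
    exact smooth_comp _ _
  exact inferInstanceAs (Smooth (Limits.pullback.fst (Limits.terminal.from S)
    (Limits.terminal.from (Spec (CommRingCat.of (MvPolynomial n (ULift.{0} ℤ)))))))

namespace VectorBundleStructure

variable {X Y : Scheme.{0}} {π : X ⟶ Y}

/-- Over each trivialising open, `π` is isomorphic to an affine space. -/
theorem of_affineSpace (E : VectorBundleStructure π) {P : MorphismProperty Scheme.{0}} [IsZariskiLocalAtTarget P]
    (h : ∀ (n : ℕ) (S : Scheme.{0}), P (𝔸(Fin n; S) ↘ S)) : P π := by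
  rw [IsZariskiLocalAtTarget.iff_of_iSup_eq_top (P := P) E.U E.iSup_U]
  intro i
  have := E.isIso_coord i
  rw [← AffineSpace.homOfVector_over (π ∣_ E.U i)
    (fun a : Fin (E.rank i) => (π ⁻¹ᵁ E.U i).topIso.inv (E.coord i a)),
    MorphismProperty.cancel_left_of_respectsIso P]
  exact h _ _

theorem isAffineHom (E : VectorBundleStructure π) : IsAffineHom π := @of_affineSpace _ _ _ E @IsAffineHom
    (@HasAffineProperty.instIsZariskiLocalAtTarget _ _ instHasAffinePropertyIsAffineHomIsAffine) fun _ _ => inferInstance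

theorem smooth (E : VectorBundleStructure π) : Smooth π := @of_affineSpace _ _ _ E @Smooth
    (@HasRingHomProperty.instIsZariskiLocalAtTarget _ _ instHasRingHomPropertySmoothSmooth) fun _ _ => smooth_affineSpace _ _

/-- Quasi-compactness allows the kernel ideal sheaf of the zero section to be computed on affine
opens. -/
theorem quasiCompact_zeroSection (E : VectorBundleStructure π) : QuasiCompact E.zeroSection := by
  have := E.isAffineHom
  have : QuasiCompact (E.zeroSection ≫ π) := by rw [E.zeroSection_comp]; infer_instance
  exact QuasiCompact.of_comp E.zeroSection π

end VectorBundleStructure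

theorem bijective_appTop {X Y : Scheme.{0}} (f : X ⟶ Y) [IsIso f] :
    Function.Bijective f.appTop :=
  ConcreteCategory.bijective_of_isIso (f.app ⊤)

theorem presheaf_map_map {X : Scheme.{0}} {U V W : X.Opensᵒᵖ} (f : U ⟶ V) (g : V ⟶ W) (k : U ⟶ W)
    (x : X.presheaf.obj U) : X.presheaf.map g (X.presheaf.map f x) = X.presheaf.map k x := by
  rw [← CommRingCat.comp_apply, ← Functor.map_comp, Subsingleton.elim (f ≫ g) k]

namespace VectorBundleStructure

variable {X Y : Scheme.{0}} {π : X ⟶ Y}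

theorem isPullback_homOfLE_morphismRestrict (π : X ⟶ Y) {V U : Y.Opens} (h : V ≤ U) :
    IsPullback (X.homOfLE (π.preimage_mono h)) (π ∣_ V) (π ∣_ U) (Y.homOfLE h) := by
  have h1 := (isPullback_morphismRestrict π V).flip
  rw [← X.homOfLE_ι (π.preimage_mono h), ← Y.homOfLE_ι h] at h1
  exact h1.of_right (morphismRestrict_homOfLE π V U h).symm (isPullback_morphismRestrict π U).flip

/-- The fibre coordinates over a smaller open set. -/
def coordOn (E : VectorBundleStructure π) (i : E.ι) {V : Y.Opens} (h : V ≤ E.U i)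
    (a : Fin (E.rank i)) : Γ(X, π ⁻¹ᵁ V) :=
  X.presheaf.map (homOfLE (π.preimage_mono h)).op (E.coord i a)

/-- The coordinate map over `V` is the base change of the one over `E.U i`: it is the comparison
isomorphism between two pullbacks of the same diagram. -/
theorem isIso_coordOn (E : VectorBundleStructure π) (i : E.ι) {V : Y.Opens} (h : V ≤ E.U i) :
    IsIso (AffineSpace.homOfVector (π ∣_ V)
      fun a => (π ⁻¹ᵁ V).topIso.inv (E.coordOn i h a)) := by
  set v : Fin (E.rank i) → Γ((π ⁻¹ᵁ E.U i).toScheme, ⊤) :=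
    fun a => (π ⁻¹ᵁ E.U i).topIso.inv (E.coord i a)
  have hv : IsIso (AffineSpace.homOfVector (π ∣_ E.U i) v) := E.isIso_coord i
  set g := AffineSpace.homOfVector (π ∣_ V)
    fun a => (π ⁻¹ᵁ V).topIso.inv (E.coordOn i h a) with hg
  have h1 := isPullback_homOfLE_morphismRestrict π h
  have h2 : IsPullback (X.homOfLE (π.preimage_mono h) ≫ AffineSpace.homOfVector (π ∣_ E.U i) v)
      (π ∣_ V) (𝔸(Fin (E.rank i); E.U i) ↘ (E.U i).toScheme) (Y.homOfLE h) := by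
    refine IsPullback.of_iso h1 (Iso.refl _) (asIso (AffineSpace.homOfVector (π ∣_ E.U i) v))
      (Iso.refl _) (Iso.refl _) ?_ ?_ ?_ ?_ <;> simp
  have h3 := AffineSpace.isPullback_map (n := Fin (E.rank i)) (Y.homOfLE h)
  have h4 : g = (h2.isoIsPullback _ _ h3).hom := by
    apply h3.hom_ext
    · rw [IsPullback.isoIsPullback_hom_fst]
      apply AffineSpace.hom_ext
      · rw [Category.assoc, AffineSpace.map_over, hg, AffineSpace.homOfVector_over_assoc,
          Category.assoc, AffineSpace.homOfVector_over, morphismRestrict_homOfLE]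
      · intro a
        rw [Scheme.Hom.comp_appTop, CommRingCat.comp_apply, Scheme.Hom.comp_appTop,
          CommRingCat.comp_apply, AffineSpace.homOfVector_appTop_coord,
          AffineSpace.map_appTop_coord, hg, AffineSpace.homOfVector_appTop_coord]
        refine Eq.symm ((congrArg (fun f => f.hom (v a))
          (Scheme.homOfLE_appTop (π.preimage_mono h))).trans ?_)
        exact (presheaf_map_map _ _ ((homOfLE (by simpa using π.preimage_mono h)).op) _).trans
          (presheaf_map_map (homOfLE (π.preimage_mono h)).op (eqToHom (by simp)).op _ _).symm
    · rw [IsPullback.isoIsPullback_hom_snd, hg, AffineSpace.homOfVector_over]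
  rw [h4]
  infer_instance

/-- Functions on `π⁻¹(V)`, for `V` affine, are polynomials in the fibre coordinates; the geometric
isomorphism is compared with evaluation on constants and on variables. -/
theorem bijective_eval₂Hom (E : VectorBundleStructure π) (i : E.ι) {V : Y.Opens}
    (hV : IsAffineOpen V) (h : V ≤ E.U i) :
    Function.Bijective (MvPolynomial.eval₂Hom (π.app V).hom (E.coordOn i h)) := by
  have := E.isIso_coordOn i h
  set v := fun a => (π ⁻¹ᵁ V).topIso.inv (E.coordOn i h a) with hv
  set g := AffineSpace.homOfVector (π ∣_ V) v with hg
  have : IsAffine V.toScheme := hV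
  have h1 := bijective_appTop (AffineSpace.isoOfIsAffine (Fin (E.rank i)) V.toScheme).hom
  have h2 : Function.Bijective (MvPolynomial.eval₂Hom
      (𝔸(Fin (E.rank i); V.toScheme) ↘ V.toScheme).appTop.hom (AffineSpace.coord V.toScheme)) := by
    rw [AffineSpace.isoOfIsAffine_hom_appTop] at h1
    exact (Function.Bijective.of_comp_iff _ (ConcreteCategory.bijective_of_isIso
      (Scheme.ΓSpecIso (CommRingCat.of (MvPolynomial (Fin (E.rank i)) Γ(V.toScheme, ⊤)))).hom)).1 h1
  have h3 := bijective_appTop g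
  have h4 : Function.Bijective (π ⁻¹ᵁ V).topIso.hom := ConcreteCategory.bijective_of_isIso _
  have h5 := (MvPolynomial.mapEquiv (Fin (E.rank i))
    V.topIso.symm.commRingCatIsoToRingEquiv).bijective
  have h6 := h4.comp (h3.comp (h2.comp h5))
  have h7 : MvPolynomial.eval₂Hom (π.app V).hom (E.coordOn i h) =
      (π ⁻¹ᵁ V).topIso.hom.hom.comp (g.appTop.hom.comp ((MvPolynomial.eval₂Hom
        (𝔸(Fin (E.rank i); V.toScheme) ↘ V.toScheme).appTop.hom
        (AffineSpace.coord V.toScheme)).comp (MvPolynomial.mapEquiv (Fin (E.rank i))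
          V.topIso.symm.commRingCatIsoToRingEquiv).toRingHom)) := by
    apply MvPolynomial.ringHom_ext
    · intro b
      have h8 : g.appTop ((𝔸(Fin (E.rank i); V.toScheme) ↘ V.toScheme).appTop (V.topIso.inv b)) =
          (π ∣_ V).appTop (V.topIso.inv b) := by
        rw [← CommRingCat.comp_apply, ← Scheme.Hom.comp_appTop, hg, AffineSpace.homOfVector_over]
      have h9 : (π ⁻¹ᵁ V).topIso.hom ((π ∣_ V).appTop (V.topIso.inv b)) = π.app V b := by
        rw [morphismRestrict_appTop]
        refine (presheaf_map_map (eqToHom _).op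
          (eqToHom (show π ⁻¹ᵁ V = (π ⁻¹ᵁ V).ι ''ᵁ ⊤ by simp)).op
          ((TopologicalSpace.Opens.map π.base).map (eqToHom (by simp))).op _).trans ?_
        have h10 := congrArg (fun f => f.hom (V.topIso.inv b)) (π.naturality
          (eqToHom (show V = V.ι ''ᵁ ⊤ by simp)).op)
        refine h10.symm.trans (congrArg (π.app V) ?_)
        exact V.topIso.inv_hom_id_apply b
      rw [MvPolynomial.eval₂Hom_C, ← h9, ← h8]
      simp only [RingHom.comp_apply]
      refine congrArg (fun z => (π ⁻¹ᵁ V).topIso.hom (g.appTop z)) ?_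
      refine Eq.trans ?_ (congrArg (MvPolynomial.eval₂Hom _ _) (MvPolynomial.map_C _ b).symm)
      rw [MvPolynomial.eval₂Hom_C]
      rfl
    · intro a
      rw [MvPolynomial.eval₂Hom_X']
      have h8 : (π ⁻¹ᵁ V).topIso.hom (g.appTop (AffineSpace.coord V.toScheme a)) =
          E.coordOn i h a := by
        rw [hg, AffineSpace.homOfVector_appTop_coord, hv]
        exact (π ⁻¹ᵁ V).topIso.inv_hom_id_apply _
      rw [← h8]
      simp only [RingHom.comp_apply]
      refine congrArg (fun z => (π ⁻¹ᵁ V).topIso.hom (g.appTop z)) ?_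
      refine Eq.trans ?_ (congrArg (MvPolynomial.eval₂Hom _ _) (MvPolynomial.map_X _ a).symm)
      rw [MvPolynomial.eval₂Hom_X']
  rw [h7]
  exact h6

end VectorBundleStructure

/-! ## Euler derivations of polynomial algebras and of their étale extensions -/

section PolynomialEuler

variable {R A B : Type*} [CommRing R] [CommRing A] [CommRing B] [Algebra R B]
  [Algebra A B] {n : Type*} {x : n → B}

/-- The derivation is `∑ xᵢ ∂/∂xᵢ`, transported from the polynomial ring. -/
theorem exists_derivation_fixing_coordinates [Algebra R A] [IsScalarTower R A B]
    (hx : Function.Bijective (MvPolynomial.aeval x : MvPolynomial n A →ₐ[A] B)) :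
    ∃ D : Derivation R B B, (∀ a, D (algebraMap A B a) = 0) ∧ ∀ i, D (x i) = x i := by
  let φ := AlgEquiv.ofBijective _ hx
  have hφ (i) : φ (MvPolynomial.X i) = x i := MvPolynomial.aeval_X x i
  let D₀ : Derivation A (MvPolynomial n A) (MvPolynomial n A) :=
    MvPolynomial.mkDerivation A MvPolynomial.X
  let D : Derivation A B B := Derivation.mk'
    (φ.toLinearMap ∘ₗ D₀.toLinearMap ∘ₗ φ.symm.toLinearMap) fun a b => by simp
  refine ⟨D.restrictScalars R, fun a => D.map_algebraMap a, fun i => ?_⟩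
  change φ (D₀ (φ.symm (x i))) = x i
  rw [← hφ, φ.symm_apply_apply, MvPolynomial.mkDerivation_X]

theorem induction_of_surjective_aeval
    (hx : Function.Surjective (MvPolynomial.aeval x : MvPolynomial n A →ₐ[A] B)) {p : B → Prop}
    (halg : ∀ a, p (algebraMap A B a)) (hadd : ∀ b c, p b → p c → p (b + c))
    (hmul : ∀ b i, p b → p (b * x i)) (b : B) : p b := by
  obtain ⟨q, rfl⟩ := hx b
  induction q using MvPolynomial.induction_on with
  | C a => simpa using halg a
  | add q r hq hr => rw [map_add]; exact hadd _ _ hq hr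
  | mul_X q i hq => rw [map_mul, MvPolynomial.aeval_X]; exact hmul _ i hq

theorem ker_le_span_of_surjective_aeval
    (hx : Function.Surjective (MvPolynomial.aeval x : MvPolynomial n A →ₐ[A] B)) {z : B →+* A}
    (hz : ∀ a, z (algebraMap A B a) = a) (hzx : ∀ i, z (x i) = 0) :
    RingHom.ker z ≤ Ideal.span (Set.range x) := by
  have key (b : B) : b - algebraMap A B (z b) ∈ Ideal.span (Set.range x) := by
    induction b using induction_of_surjective_aeval hx with
    | halg a => simp [hz]
    | hadd b c hb hc =>
      rw [map_add, map_add, add_sub_add_comm]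
      exact Ideal.add_mem _ hb hc
    | hmul b i hb =>
      rw [map_mul, hzx, mul_zero, map_zero, sub_zero]
      exact Ideal.mul_mem_left _ _ (Ideal.subset_span ⟨i, rfl⟩)
  intro b hb
  simpa [RingHom.mem_ker.1 hb] using key b

end PolynomialEuler

section Euler

variable {R A B : Type*} [Field R] [CommRing A] [CommRing B] [Algebra R B]
  [Algebra A B]

/-- Generators suffice, since `e (c a) - c a = c (e a - a) + a e(c)` and `a e(c) ∈ I ^ 2`. -/
theorem isEuler_of_span [Algebra R A] {I : Ideal A} {e : Derivation R A A} {s : Set A} (hs : Ideal.span s = I)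
    (hmem : ∀ a, e a ∈ I) (h : ∀ a ∈ s, e a - a ∈ I ^ 2) : IsEuler I e where
  mem := hmem
  sub_self_mem a ha := by
    rw [← hs] at ha
    induction ha using Submodule.span_induction with
    | mem a ha => exact h a ha
    | zero => simp
    | add a b _ _ ha hb =>
      rw [map_add, add_sub_add_comm]
      exact Ideal.add_mem _ ha hb
    | smul c a ha' ha =>
      have h1 : e (c • a) - c • a = c * (e a - a) + a * e c := by
        simp only [smul_eq_mul, Derivation.leibniz]; ring
      rw [h1]
      refine Ideal.add_mem _ (Ideal.mul_mem_left _ _ ha) ?_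
      rw [sq]
      exact Ideal.mul_mem_mul (hs ▸ ha') (hmem c)

theorem isEuler_ker_of_polynomial {n : Type*} {x : n → B}
    (hx : Function.Surjective (MvPolynomial.aeval x : MvPolynomial n A →ₐ[A] B)) {z : B →+* A}
    (hz : ∀ a, z (algebraMap A B a) = a) (hzx : ∀ i, z (x i) = 0) {e : Derivation R B B}
    (he : ∀ a, e (algebraMap A B a) = 0) (hex : ∀ i, e (x i) = x i) :
    IsEuler (RingHom.ker z) e := by
  refine isEuler_of_span (s := Set.range x)
    (le_antisymm ?_ (ker_le_span_of_surjective_aeval hx hz hzx)) (fun b => ?_) ?_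
  · rw [Ideal.span_le]
    rintro _ ⟨i, rfl⟩
    exact hzx i
  · rw [RingHom.mem_ker]
    induction b using induction_of_surjective_aeval hx with
    | halg a => rw [he, map_zero]
    | hadd b c hb hc => rw [map_add, map_add, hb, hc, add_zero]
    | hmul b i hb => simp [hzx, hex]
  · rintro _ ⟨i, rfl⟩
    simp [hex]

/-- Modulo the extended ideal, `e'` is a derivation vanishing on `A`, hence zero. -/
theorem IsEuler.of_formallyUnramified [Algebra R A] [IsScalarTower R A B]
    [Algebra.FormallyUnramified A B] {I : Ideal A}
    {e : Derivation R A A} (he : IsEuler I e) {e' : Derivation R B B}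
    (h : ∀ a, e' (algebraMap A B a) = algebraMap A B (e a)) :
    IsEuler (I.map (algebraMap A B)) e' := by
  refine isEuler_of_span (s := algebraMap A B '' I) rfl (fun b => ?_) ?_
  · have h1 : (Submodule.mkQ (I.map (algebraMap A B))).compDer e' = 0 :=
      derivation_ext_of_formallyUnramified (A := A) fun a =>
        (Submodule.Quotient.mk_eq_zero _).2 (h a ▸ Ideal.mem_map_of_mem _ (he.mem a))
    exact (Submodule.Quotient.mk_eq_zero _).1 (DFunLike.congr_fun h1 b)
  · rintro _ ⟨a, ha, rfl⟩
    rw [h, ← map_sub, ← Ideal.map_pow]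
    exact Ideal.mem_map_of_mem _ (he.sub_self_mem a ha)

end Euler

/-! ### Membership in an ideal sheaf is local. -/

section Local

variable {X Y : Scheme.{0}}

theorem mem_ideal_of_locally {J : X.IdealSheafData} (U : X.affineOpens) {g : Γ(X, U.1)}
    (h : ∀ p ∈ U.1, ∃ (W : X.affineOpens) (hW : W ≤ U), p ∈ W.1 ∧
      X.presheaf.map (homOfLE hW).op g ∈ J.ideal W) : g ∈ J.ideal U := by
  have key (p : U.1) : ∃ s : Γ(X, U.1), p.1 ∈ X.basicOpen s ∧ ∃ n : ℕ, s ^ n • g ∈ J.ideal U := by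
    obtain ⟨W, hW, hp, hg⟩ := h p.1 p.2
    obtain ⟨s, hs, hps⟩ := U.2.exists_basicOpen_le ⟨p.1, hp⟩ p.2
    refine ⟨s, hps, ?_⟩
    have h1 : (X.presheaf.map (homOfLE (X.basicOpen_le s)).op g) ∈
        J.ideal (X.affineBasicOpen s) := by
      have h2 := J.ideal_le_comap_ideal (show X.affineBasicOpen s ≤ W from hs) hg
      exact (presheaf_map_map (homOfLE hW).op (homOfLE hs).op (homOfLE (X.basicOpen_le s)).op g) ▸ h2
    rw [← J.map_ideal_basicOpen] at h1
    have := U.2.isLocalization_basicOpen s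
    obtain ⟨_, ⟨n, rfl⟩, hn⟩ := (IsLocalization.algebraMap_mem_map_algebraMap_iff (.powers s)
      Γ(X, X.basicOpen s) _ _).1 h1
    exact ⟨n, hn⟩
  choose s hs n hn using key
  refine Submodule.mem_of_span_eq_top_of_smul_pow_mem (J.ideal U) (Set.range s) ?_ g ?_
  · rw [← IsAffineOpen.self_le_iSup_basicOpen_iff U.2]
    exact fun p hp => TopologicalSpace.Opens.mem_iSup.2 ⟨⟨_, ⟨p, hp⟩, rfl⟩, hs ⟨p, hp⟩⟩
  · rintro ⟨_, p, rfl⟩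
    exact ⟨n p, hn p⟩

end Local

/-! ## Radial vector fields on a vector bundle -/

section Radial

variable {X Y : Scheme.{0}} [X.Over SpecC] [Y.Over SpecC] (π : X ⟶ Y) [π.IsOver SpecC]

theorem scalars_appLE {V : Y.Opens} {W : X.Opens} (h : W ≤ π ⁻¹ᵁ V) :
    scalars Y V ≫ π.appLE V W h = scalars X W := by
  simp only [scalars, Category.assoc, Scheme.Hom.appLE_comp_appLE]
  congr 2
  exact comp_over π SpecC

/-- The pullback of functions along a morphism of complex schemes. -/
def pull {V : Y.Opens} {W : X.Opens} (h : W ≤ π ⁻¹ᵁ V) : Γ(Y, V) →ₐ[ℂ] Γ(X, W) where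
  __ := (π.appLE V W h).hom
  commutes' r := congrArg (fun f : CommRingCat.of ℂ ⟶ Γ(X, W) => f.hom r) (scalars_appLE π h)

theorem res_pull {V : Y.Opens} {W W' : X.Opens} (h : W ≤ π ⁻¹ᵁ V) (hW : W' ≤ W) (b : Γ(Y, V)) :
    res hW (pull π h b) = pull π (hW.trans h) b :=
  congrArg (fun f => f.hom b) (π.appLE_map h (homOfLE hW).op)

theorem pull_res {V V' : Y.Opens} {W : X.Opens} (h : W ≤ π ⁻¹ᵁ V') (hV : V' ≤ V) (b : Γ(Y, V)) :
    pull π h (res hV b) = pull π (h.trans (π.preimage_mono hV)) b :=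
  congrArg (fun f => f.hom b) (π.map_appLE h (homOfLE hV).op)

theorem pull_self {V : Y.Opens} (b : Γ(Y, V)) : pull π le_rfl b = π.app V b :=
  congrArg (fun f => f.hom b) π.appLE_eq_app

variable {π} (E : VectorBundleStructure π)

/-- A derivation over `W` that kills the functions pulled back from `V` and fixes the fibre
coordinates with index `i`. -/
structure IsRadialOver {V : Y.Opens} {i : E.ι} (hV : V ≤ E.U i) {W : X.Opens} (hW : W ≤ π ⁻¹ᵁ V)
    (D : Derivation ℂ Γ(X, W) Γ(X, W)) : Prop where
  pull : ∀ b : Γ(Y, V), D (pull π hW b) = 0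
  coord : ∀ a, D (res hW (E.coordOn i hV a)) = res hW (E.coordOn i hV a)

variable {E}

theorem exists_isRadialOver {V : Y.Opens} (hVa : IsAffineOpen V) {i : E.ι} (hV : V ≤ E.U i) :
    ∃ D, IsRadialOver E hV le_rfl D := by
  let : Algebra Γ(Y, V) Γ(X, π ⁻¹ᵁ V) := (π.app V).hom.toAlgebra
  have : IsScalarTower ℂ Γ(Y, V) Γ(X, π ⁻¹ᵁ V) :=
    IsScalarTower.of_algebraMap_eq fun r => by
      rw [← (pull π le_rfl : Γ(Y, V) →ₐ[ℂ] Γ(X, π ⁻¹ᵁ V)).commutes r, pull_self]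
      rfl
  obtain ⟨D, h1, h2⟩ := exists_derivation_fixing_coordinates (R := ℂ)
    (x := E.coordOn i hV) (A := Γ(Y, V)) (E.bijective_eval₂Hom i hVa hV)
  refine ⟨D, fun b => ?_, fun a => ?_⟩
  · rw [pull_self]; exact h1 b
  · rw [res_self]; exact h2 a

/-- By étaleness of restriction the two fields need only agree on `π⁻¹(V)`, whose functions are
generated by pullbacks and fibre coordinates. -/
theorem IsRadialOver.ext {V : Y.Opens} (hVa : IsAffineOpen V) {i : E.ι} {hV : V ≤ E.U i}
    {W : X.Opens} (hWa : IsAffineOpen W) {hW : W ≤ π ⁻¹ᵁ V} {v w : Derivation ℂ Γ(X, W) Γ(X, W)}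
    (hv : IsRadialOver E hV hW v) (hw : IsRadialOver E hV hW w) : v = w := by
  have := E.isAffineHom
  have hπV : IsAffineOpen (π ⁻¹ᵁ V) := hVa.preimage π
  refine res_derivation_ext hπV hWa hW fun f => ?_
  let : Algebra Γ(Y, V) Γ(X, π ⁻¹ᵁ V) := (π.app V).hom.toAlgebra
  induction f using induction_of_surjective_aeval (x := E.coordOn i hV) (A := Γ(Y, V))
    (E.bijective_eval₂Hom i hVa hV).2 with
  | halg b =>
    have h1 : res hW (algebraMap Γ(Y, V) Γ(X, π ⁻¹ᵁ V) b) = FormalMoser.pull π hW b := by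
      rw [← res_pull π le_rfl hW, pull_self]; rfl
    rw [h1, hv.pull, hw.pull]
  | hadd b c hb hc => rw [map_add, map_add, map_add, hb, hc]
  | hmul b a hb => rw [map_mul, v.leibniz, w.leibniz, hb, hv.coord, hw.coord]

theorem coordOn_transition (E : VectorBundleStructure π) {V : Y.Opens} {i j : E.ι}
    (hi : V ≤ E.U i) (hj : V ≤ E.U j) :
    ∃ M : Matrix (Fin (E.rank j)) (Fin (E.rank i)) Γ(Y, V), ∀ a,
      E.coordOn j hj a = ∑ b, FormalMoser.pull π le_rfl (M a b) * E.coordOn i hi b := by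
  obtain ⟨M, hM⟩ := E.transition i j
  have hle : V ≤ E.U i ⊓ E.U j := le_inf hi hj
  refine ⟨fun a b => res hle (M a b), fun a => ?_⟩
  have h := congrArg (res (π.preimage_mono hle)) (hM a)
  rw [map_sum] at h
  simp only [map_mul] at h
  refine Eq.trans ?_ (h.trans (Finset.sum_congr rfl fun b _ => ?_))
  · exact (res_res _ _ _).symm
  · congr 1
    · rw [pull_res, ← pull_self, res_pull]
    · exact res_res _ _ _

/-- Independence of the trivialisation: new coordinates are linear in the old ones, with
coefficients from the base. A radial field kills these coefficients, so it fixes the new coordinates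
too. -/
theorem IsRadialOver.of_res {V V' : Y.Opens} (hVa : IsAffineOpen V) (hVa' : IsAffineOpen V')
    {i j : E.ι} {hV : V ≤ E.U i} {hV' : V' ≤ E.U j} (hVV : V' ≤ V) {W W' : X.Opens}
    {hW : W ≤ π ⁻¹ᵁ V} {hW' : W' ≤ π ⁻¹ᵁ V'} (hWW : W' ≤ W)
    {D : Derivation ℂ Γ(X, W) Γ(X, W)} (hD : IsRadialOver E hV hW D)
    {D' : Derivation ℂ Γ(X, W') Γ(X, W')} (h : ∀ f, D' (res hWW f) = res hWW (D f)) :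
    IsRadialOver E hV' hW' D' := by
  have hpull (b : Γ(Y, V')) : D' (FormalMoser.pull π hW' b) = 0 := by
    let : Algebra Γ(Y, V) Γ(Y, V') := (res hVV).toRingHom.toAlgebra
    have : IsScalarTower ℂ Γ(Y, V) Γ(Y, V') :=
      IsScalarTower.of_algebraMap_eq fun r => ((res hVV).commutes r).symm
    have : Algebra.Etale Γ(Y, V) Γ(Y, V') := etale_res hVa hVa' hVV
    let : Algebra Γ(Y, V') Γ(X, W') := (FormalMoser.pull π hW').toRingHom.toAlgebra
    have : IsScalarTower ℂ Γ(Y, V') Γ(X, W') :=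
      IsScalarTower.of_algebraMap_eq fun r => ((FormalMoser.pull π hW').commutes r).symm
    let : Algebra Γ(Y, V) Γ(X, W') := Algebra.compHom _ (algebraMap Γ(Y, V) Γ(Y, V'))
    have : IsScalarTower Γ(Y, V) Γ(Y, V') Γ(X, W') := IsScalarTower.of_algebraMap_eq fun _ => rfl
    -- Functions on `V'` need not come from `V`, but a derivation killing those of `V` kills all of
    -- them, by étaleness.
    have h1 : D'.compAlgebraMap Γ(Y, V') = 0 :=
      derivation_ext_of_formallyUnramified (A := Γ(Y, V)) fun a => by
        change D' (FormalMoser.pull π hW' (res hVV a)) = 0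
        rw [pull_res, ← res_pull π hW hWW, h, hD.pull, map_zero]
    exact DFunLike.congr_fun h1 b
  refine ⟨hpull, fun a => ?_⟩
  have hi (b) : D' (res hW' (E.coordOn i (hVV.trans hV) b)) =
      res hW' (E.coordOn i (hVV.trans hV) b) := by
    have h1 : res hW' (E.coordOn i (hVV.trans hV) b) = res hWW (res hW (E.coordOn i hV b)) := by
      rw [res_res]
      exact (res_res _ _ _).trans (res_res _ _ _).symm
    rw [h1, h, hD.coord]
  obtain ⟨M, hM⟩ := coordOn_transition E (hVV.trans hV) hV'
  rw [hM a, map_sum, map_sum]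
  refine Finset.sum_congr rfl fun b _ => ?_
  rw [map_mul, D'.leibniz, hi, res_pull, hpull, smul_zero, add_zero, smul_eq_mul]

end Radial

/-! ### Gluing radial fields to the Euler vector field. -/

section EulerField

theorem eq_of_locally_eq {X : Scheme.{0}} [X.Over SpecC] {U : X.Opens} {s t : Γ(X, U)}
    (h : ∀ p ∈ U, ∃ (W : X.Opens) (hW : W ≤ U), p ∈ W ∧ res hW s = res hW t) : s = t := by
  choose W hW hp hst using fun p : U => h p.1 p.2
  exact X.sheaf.eq_of_locally_eq' W U (fun p => homOfLE (hW p))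
    (fun p hpU => TopologicalSpace.Opens.mem_iSup.2 ⟨⟨p, hpU⟩, hp ⟨p, hpU⟩⟩) s t hst

variable {X Y : Scheme.{0}} {π : X ⟶ Y}

theorem exists_affine_mem_le (π : X ⟶ Y) {O : Y.Opens} {W : X.Opens} {p : X} (hp : p ∈ W)
    (hO : π p ∈ O) :
    ∃ (V : Y.Opens) (W' : X.Opens), IsAffineOpen V ∧ V ≤ O ∧ IsAffineOpen W' ∧ W' ≤ W ∧
      W' ≤ π ⁻¹ᵁ V ∧ p ∈ W' := by
  obtain ⟨V, hV, hpV, hVO⟩ := exists_isAffineOpen_mem_and_subset hO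
  obtain ⟨W', hW', hpW, hle⟩ := exists_isAffineOpen_mem_and_subset (X := X) (x := p)
    (U := W ⊓ π ⁻¹ᵁ V) ⟨hp, hpV⟩
  exact ⟨V, W', hV, hVO, hW', hle.trans inf_le_left, hle.trans inf_le_right, hpW⟩

/-- Affine open sets over which radial vector fields are determined by local data. -/
def IsSmall (E : VectorBundleStructure π) (W : X.Opens) : Prop :=
  IsAffineOpen W ∧ ∃ (V : Y.Opens) (i : E.ι), IsAffineOpen V ∧ V ≤ E.U i ∧ W ≤ π ⁻¹ᵁ V

theorem exists_isSmall_mem_le (E : VectorBundleStructure π) {U : X.Opens} {p : X} (hp : p ∈ U) :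
    ∃ W, IsSmall E W ∧ W ≤ U ∧ p ∈ W := by
  obtain ⟨i, hi⟩ := TopologicalSpace.Opens.mem_iSup.1
    (show π p ∈ ⨆ i, E.U i from E.iSup_U ▸ trivial)
  obtain ⟨V, W, hV, hVO, hW, hWU, hWV, hpW⟩ := exists_affine_mem_le π hp hi
  exact ⟨W, ⟨hW, V, i, hV, hVO, hWV⟩, hWU, hpW⟩

variable [X.Over SpecC] [Y.Over SpecC] [π.IsOver SpecC]
  {E : VectorBundleStructure π}

/-- The inclusion `V' ≤ V` required by `IsRadialOver.of_res` is obtained locally, by shrinking to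
affine opens inside `V ⊓ V'`. -/
theorem IsRadialOver.change {V V' : Y.Opens} (hVa : IsAffineOpen V)
    {i j : E.ι} {hV : V ≤ E.U i} {hV' : V' ≤ E.U j} {W : X.Opens} (hWa : IsAffineOpen W)
    {hW : W ≤ π ⁻¹ᵁ V} (hW' : W ≤ π ⁻¹ᵁ V')
    {D : Derivation ℂ Γ(X, W) Γ(X, W)} (hD : IsRadialOver E hV hW D) :
    IsRadialOver E hV' hW' D := by
  have key (p : X) (hp : p ∈ W) : ∃ (V₁ : Y.Opens) (hVV : V₁ ≤ V') (W₁ : X.Opens)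
      (hWW : W₁ ≤ W) (hW₁ : W₁ ≤ π ⁻¹ᵁ V₁) (D₁ : Derivation ℂ Γ(X, W₁) Γ(X, W₁)), p ∈ W₁ ∧
      (∀ f, D₁ (res hWW f) = res hWW (D f)) ∧ IsRadialOver E (hVV.trans hV') hW₁ D₁ := by
    obtain ⟨V₁, W₁, hV₁, hVO, hW₁, hWW, hWV, hpW⟩ :=
      exists_affine_mem_le π hp (O := V ⊓ V') ⟨hW hp, hW' hp⟩
    obtain ⟨D₁, hD₁⟩ := exists_res_derivation_extension hWa hW₁ hWW D
    exact ⟨V₁, hVO.trans inf_le_right, W₁, hWW, hWV, D₁, hpW, hD₁,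
      hD.of_res hVa hV₁ (hVO.trans inf_le_left) hWW hD₁⟩
  refine ⟨fun b => eq_of_locally_eq fun p hp => ?_, fun a => eq_of_locally_eq fun p hp => ?_⟩
  · obtain ⟨V₁, hVV, W₁, hWW, hW₁, D₁, hpW, hD₁, hr⟩ := key p hp
    refine ⟨W₁, hWW, hpW, ?_⟩
    rw [← hD₁, res_pull, ← pull_res π hW₁ hVV, hr.pull, map_zero]
  · obtain ⟨V₁, hVV, W₁, hWW, hW₁, D₁, hpW, hD₁, hr⟩ := key p hp
    refine ⟨W₁, hWW, hpW, ?_⟩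
    have h1 : res hWW (res hW' (E.coordOn j hV' a)) =
        res hW₁ (E.coordOn j (hVV.trans hV') a) := by
      rw [res_res]
      exact (res_res _ _ _).trans (res_res _ _ _).symm
    rw [← hD₁, h1, hr.coord]

variable (E) in
/-- The derivation along the fibres that is the Euler vector field in all fibre coordinates. -/
def IsRadial {W : X.Opens} (D : Derivation ℂ Γ(X, W) Γ(X, W)) : Prop :=
  ∀ (V : Y.Opens) (i : E.ι) (hV : V ≤ E.U i) (hW : W ≤ π ⁻¹ᵁ V), IsRadialOver E hV hW D

theorem IsSmall.exists_isRadial {W : X.Opens} (h : IsSmall E W) :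
    ∃ D : Derivation ℂ Γ(X, W) Γ(X, W), IsRadial E D := by
  obtain ⟨hW, V, i, hVa, hV, hWV⟩ := h
  have := E.isAffineHom
  obtain ⟨D, hD⟩ := exists_isRadialOver hVa hV
  obtain ⟨D', hD'⟩ := exists_res_derivation_extension (hVa.preimage π) hW hWV D
  have h1 : IsRadialOver E hV hWV D' := hD.of_res hVa hVa le_rfl hWV hD'
  exact ⟨D', fun V' j hV' hW' => h1.change hVa hW hW'⟩

theorem IsRadial.apply_res {W W' : X.Opens} (hW : IsSmall E W) (hW' : IsAffineOpen W')
    (h : W' ≤ W) {D : Derivation ℂ Γ(X, W) Γ(X, W)} {D' : Derivation ℂ Γ(X, W') Γ(X, W')}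
    (hD : IsRadial E D) (hD' : IsRadial E D') (f : Γ(X, W)) : D' (res h f) = res h (D f) := by
  obtain ⟨hWa, V, i, hVa, hV, hWV⟩ := hW
  obtain ⟨D₁, hD₁⟩ := exists_res_derivation_extension hWa hW' h D
  have h1 : IsRadialOver E hV (h.trans hWV) D₁ := (hD V i hV hWV).of_res hVa hVa le_rfl h hD₁
  rw [(hD' V i hV (h.trans hWV)).ext hVa hW' h1, hD₁]

theorem existsUnique_eulerField (E : VectorBundleStructure π) (U : X.Opens) (f : Γ(X, U)) :
    ∃! s : Γ(X, U), ∀ (W : X.Opens) (h : W ≤ U) (D : Derivation ℂ Γ(X, W) Γ(X, W)),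
      IsSmall E W → IsRadial E D → res h s = D (res h f) := by
  let ι := {W : X.Opens // IsSmall E W ∧ W ≤ U}
  choose D hD using fun W : ι => W.2.1.exists_isRadial
  have hcover : U ≤ ⨆ W : ι, W.1 := fun p hp => by
    obtain ⟨W, hW, hWU, hpW⟩ := exists_isSmall_mem_le E hp
    exact TopologicalSpace.Opens.mem_iSup.2 ⟨⟨W, hW, hWU⟩, hpW⟩
  obtain ⟨s, hs, huniq⟩ := X.sheaf.existsUnique_gluing' (fun W : ι => W.1) U
    (fun W => homOfLE W.2.2) hcover (fun W => D W (res W.2.2 f)) (fun W W' => by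
      change res (inf_le_left : W.1 ⊓ W'.1 ≤ W.1) (D W (res W.2.2 f)) =
        res (inf_le_right : W.1 ⊓ W'.1 ≤ W'.1) (D W' (res W'.2.2 f))
      -- The overlap is not known to be affine, so agreement is tested on small affine opens inside
      -- it.
      refine eq_of_locally_eq fun p hp => ?_
      obtain ⟨W₁, hW₁, hle, hpW⟩ := exists_isSmall_mem_le E hp
      obtain ⟨D₁, hD₁⟩ := hW₁.exists_isRadial
      refine ⟨W₁, hle, hpW, ?_⟩
      rw [res_res, res_res,
        ← (hD W).apply_res W.2.1 hW₁.1 (hle.trans inf_le_left) hD₁,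
        ← (hD W').apply_res W'.2.1 hW₁.1 (hle.trans inf_le_right) hD₁, res_res, res_res])
  refine ⟨s, fun W h D' hW hD' => ?_, fun t ht => huniq t fun W => ?_⟩
  · rw [show res h s = _ from hs ⟨W, hW, h⟩, ← res_self (D ⟨W, hW, h⟩ (res h f)),
      ← (hD ⟨W, hW, h⟩).apply_res hW hW.1 le_rfl hD', res_self]
  · exact ht W.1 W.2.2 (D W) W.2.1 (hD W)

/-- The Euler vector field, on all functions on an open set. -/
def eulerFun (E : VectorBundleStructure π) (U : X.Opens) (f : Γ(X, U)) : Γ(X, U) :=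
  (existsUnique_eulerField E U f).choose

theorem res_eulerFun {U W : X.Opens} (h : W ≤ U) {D : Derivation ℂ Γ(X, W) Γ(X, W)}
    (hW : IsSmall E W) (hD : IsRadial E D) (f : Γ(X, U)) :
    res h (eulerFun E U f) = D (res h f) :=
  (existsUnique_eulerField E U f).choose_spec.1 W h D hW hD

theorem eq_eulerFun {U : X.Opens} {f s : Γ(X, U)}
    (h : ∀ (W : X.Opens) (h : W ≤ U) (D : Derivation ℂ Γ(X, W) Γ(X, W)),
      IsSmall E W → IsRadial E D → res h s = D (res h f)) : eulerFun E U f = s :=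
  ((existsUnique_eulerField E U f).choose_spec.2 s h).symm

/-- The Euler vector field of a vector bundle, on an open set. -/
def euler (E : VectorBundleStructure π) (U : X.Opens) : Derivation ℂ Γ(X, U) Γ(X, U) :=
  Derivation.mk'
    { toFun := eulerFun E U
      map_add' := fun f g => eq_eulerFun fun W h D hW hD => by
        rw [map_add, map_add, map_add, res_eulerFun h hW hD, res_eulerFun h hW hD]
      map_smul' := fun r f => eq_eulerFun fun W h D hW hD => by
        rw [RingHom.id_apply, map_smul, map_smul, D.map_smul, res_eulerFun h hW hD] }
    fun f g => eq_eulerFun fun W h D hW hD => by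
      simp only [smul_eq_mul, map_add, map_mul, Derivation.leibniz, LinearMap.coe_mk,
        AddHom.coe_mk, res_eulerFun h hW hD]

theorem euler_res {U U' : X.Opens} (h : U' ≤ U) (f : Γ(X, U)) :
    euler E U' (res h f) = res h (euler E U f) :=
  eq_eulerFun fun W hW D hWs hD => by
    rw [res_res, res_res]
    exact res_eulerFun (hW.trans h) hWs hD f

theorem euler_eq {W : X.Opens} {D : Derivation ℂ Γ(X, W) Γ(X, W)} (hW : IsSmall E W)
    (hD : IsRadial E D) : euler E W = D := by
  ext f
  have h := res_eulerFun le_rfl hW hD f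
  rwa [res_self, res_self] at h

theorem isRadial_euler {W : X.Opens} (hW : IsSmall E W) : IsRadial E (euler E W) := by
  obtain ⟨D, hD⟩ := hW.exists_isRadial
  rwa [euler_eq hW hD]

end EulerField

/-! ### The ideal of the zero section and the Euler condition. -/

section ZeroSection

variable {X Y : Scheme.{0}} {π : X ⟶ Y}

namespace VectorBundleStructure

theorem preimage_zeroSection (E : VectorBundleStructure π) (V : Y.Opens) :
    E.zeroSection ⁻¹ᵁ π ⁻¹ᵁ V = V := by
  rw [← Scheme.Hom.comp_preimage, E.zeroSection_comp, Scheme.Hom.id_preimage]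

theorem zeroSection_ideal (E : VectorBundleStructure π) (U : X.affineOpens) :
    E.zeroSection.ker.ideal U = RingHom.ker (E.zeroSection.app U.1).hom := by
  have := E.quasiCompact_zeroSection
  exact E.zeroSection.ker_apply U

/-- Restriction to the zero section. -/
def restrictZero (E : VectorBundleStructure π) (V : Y.Opens) : Γ(X, π ⁻¹ᵁ V) →+* Γ(Y, V) :=
  (E.zeroSection.appLE (π ⁻¹ᵁ V) V (E.preimage_zeroSection V).ge).hom

theorem restrictZero_app (E : VectorBundleStructure π) {V : Y.Opens} (b : Γ(Y, V)) :
    E.restrictZero V (π.app V b) = b := by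
  have h1 : π.app V ≫ E.zeroSection.appLE (π ⁻¹ᵁ V) V (E.preimage_zeroSection V).ge = 𝟙 _ := by
    rw [← Scheme.Hom.appLE_eq_app, Scheme.Hom.appLE_comp_appLE]
    simp only [E.zeroSection_comp]
    exact (𝟙 Y : Y ⟶ Y).appLE_eq_app
  exact congrArg (fun f => f.hom b) h1

theorem restrictZero_coordOn (E : VectorBundleStructure π) {i : E.ι} {V : Y.Opens}
    (h : V ≤ E.U i) (a : Fin (E.rank i)) : E.restrictZero V (E.coordOn i h a) = 0 := by
  have h1 : X.presheaf.map (homOfLE (π.preimage_mono h)).op ≫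
      E.zeroSection.appLE (π ⁻¹ᵁ V) V (E.preimage_zeroSection V).ge =
      E.zeroSection.app (π ⁻¹ᵁ E.U i) ≫
        Y.presheaf.map (homOfLE (h.trans (E.preimage_zeroSection (E.U i)).ge)).op := by
    rw [Scheme.Hom.map_appLE]
    rfl
  refine (congrArg (fun f => f.hom (E.coord i a)) h1).trans ?_
  change Y.presheaf.map _ (E.zeroSection.app (π ⁻¹ᵁ E.U i) (E.coord i a)) = 0
  rw [E.zeroSection_coord, map_zero]

theorem ker_restrictZero (E : VectorBundleStructure π) (V : Y.Opens) :
    RingHom.ker (E.restrictZero V) = RingHom.ker (E.zeroSection.app (π ⁻¹ᵁ V)).hom := by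
  ext f
  have h1 : IsIso (Y.presheaf.map (homOfLE (E.preimage_zeroSection V).ge).op) := by
    have : homOfLE (E.preimage_zeroSection V).ge = eqToHom (E.preimage_zeroSection V).symm := rfl
    rw [this]
    infer_instance
  have h2 := (ConcreteCategory.bijective_of_isIso
    (Y.presheaf.map (homOfLE (E.preimage_zeroSection V).ge).op)).1
  rw [RingHom.mem_ker, RingHom.mem_ker]
  exact map_eq_zero_iff (Y.presheaf.map (homOfLE (E.preimage_zeroSection V).ge).op).hom h2

end VectorBundleStructure

variable [X.Over SpecC] [Y.Over SpecC] [π.IsOver SpecC]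

/-- Over `π⁻¹(V)` the ideal is generated by the fibre coordinates, which the Euler field fixes. -/
theorem isEuler_euler_preimage (E : VectorBundleStructure π) {V : Y.Opens} {i : E.ι}
    (hVa : IsAffineOpen V) (hV : V ≤ E.U i) (hπV : IsAffineOpen (π ⁻¹ᵁ V)) :
    IsEuler (E.zeroSection.ker.ideal ⟨π ⁻¹ᵁ V, hπV⟩) (euler E (π ⁻¹ᵁ V)) := by
  have h := isRadial_euler (E := E) ⟨hπV, V, i, hVa, hV, le_rfl⟩ V i hV le_rfl
  rw [E.zeroSection_ideal]
  change IsEuler (RingHom.ker (E.zeroSection.app (π ⁻¹ᵁ V)).hom) _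
  rw [← E.ker_restrictZero]
  let : Algebra Γ(Y, V) Γ(X, π ⁻¹ᵁ V) := (π.app V).hom.toAlgebra
  refine isEuler_ker_of_polynomial (x := E.coordOn i hV) (E.bijective_eval₂Hom i hVa hV).2
    E.restrictZero_app (E.restrictZero_coordOn hV) (fun b => ?_) fun a => ?_
  · exact (congrArg (euler E (π ⁻¹ᵁ V)) (pull_self π b)).symm.trans (h.pull b)
  · have h1 := h.coord a
    rwa [res_self] at h1

theorem isEuler_euler_of_isSmall (E : VectorBundleStructure π) (W : X.affineOpens)
    (hW : IsSmall E W.1) : IsEuler (E.zeroSection.ker.ideal W) (euler E W.1) := by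
  obtain ⟨-, V, i, hVa, hV, hWV⟩ := hW
  have := E.isAffineHom
  have hπV := hVa.preimage π
  rw [← E.zeroSection.ker.map_ideal (show W ≤ ⟨π ⁻¹ᵁ V, hπV⟩ from hWV)]
  let : Algebra Γ(X, π ⁻¹ᵁ V) Γ(X, W.1) := (res hWV).toRingHom.toAlgebra
  have : IsScalarTower ℂ Γ(X, π ⁻¹ᵁ V) Γ(X, W.1) :=
    IsScalarTower.of_algebraMap_eq fun r => ((res hWV).commutes r).symm
  have : Algebra.Etale Γ(X, π ⁻¹ᵁ V) Γ(X, W.1) := etale_res hπV W.2 hWV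
  exact (isEuler_euler_preimage E hVa hV hπV).of_formallyUnramified fun f => euler_res hWV f

/-- The Euler vector field vanishes on the zero section and acts as the identity on its conormal
bundle. -/
theorem isEuler_euler (E : VectorBundleStructure π) (U : X.affineOpens) :
    IsEuler (E.zeroSection.ker.ideal U) (euler E U.1) where
  mem f := mem_ideal_of_locally U fun p hp => by
    obtain ⟨W, hW, hWU, hpW⟩ := exists_isSmall_mem_le E hp
    refine ⟨⟨W, hW.1⟩, hWU, hpW, ?_⟩
    have h := (isEuler_euler_of_isSmall E ⟨W, hW.1⟩ hW).mem (res hWU f)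
    rwa [euler_res hWU] at h
  -- The second condition is local for the squared ideal sheaf.
  sub_self_mem f hf := mem_ideal_of_locally (J := E.zeroSection.ker ^ 2) U fun p hp => by
    obtain ⟨W, hW, hWU, hpW⟩ := exists_isSmall_mem_le E hp
    refine ⟨⟨W, hW.1⟩, hWU, hpW, ?_⟩
    have h := (isEuler_euler_of_isSmall E ⟨W, hW.1⟩ hW).sub_self_mem (res hWU f)
      (E.zeroSection.ker.ideal_le_comap_ideal (show (⟨W, hW.1⟩ : X.affineOpens) ≤ U from hWU) hf)
    rwa [euler_res hWU, ← map_sub] at h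

end ZeroSection

/-! ### From pointwise agreement to divisibility by the ideal. -/

section Agree

variable {X Y : Scheme.{0}}

open TensorProduct in
theorem evaluation_linear_eq_zero {U : X.Opens} {x : X} (hx : x ∈ U) {M : Type*}
    [AddCommGroup M] [Module Γ(X, U) M] {m : M}
    (h : letI : Algebra Γ(X, U) (X.residueField x) := (X.evaluation U x hx).hom.toAlgebra
      (1 : X.residueField x) ⊗ₜ[Γ(X, U)] m = 0) (ℓ : M →ₗ[Γ(X, U)] Γ(X, U)) :
    X.evaluation U x hx (ℓ m) = 0 := by
  let : Algebra Γ(X, U) (X.residueField x) := (X.evaluation U x hx).hom.toAlgebra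
  have h1 := congrArg (fun t => TensorProduct.rid Γ(X, U) _ (ℓ.lTensor (X.residueField x) t)) h
  simp only [LinearMap.lTensor_tmul, TensorProduct.rid_tmul, map_zero, Algebra.smul_def,
    mul_one] at h1
  exact h1

/-- As `Ω^k` is projective, divisibility by an ideal can be tested with linear functionals. Each
turns the difference into a function vanishing at all points of `Y`, and on a reduced scheme such a
function is zero. -/
theorem GlobalForm.sub_mem_of_agreeAt [X.Over SpecC] [Smooth (X ↘ SpecC)] [AlgebraicGeometry.IsReduced Y]
    {z : Y ⟶ X} {k : ℕ} {ω ω' : GlobalForm X k} (h : ∀ y, ω.AgreeAt ω' (z y))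
    (U : X.affineOpens) :
    ω.val U - ω'.val U ∈
      (RingHom.ker (z.app U.1).hom • ⊤ : Submodule Γ(X, U.1) (Form ℂ Γ(X, U.1) k)) := by
  have := algebra_smooth U.2
  have : Module.Projective Γ(X, U.1) (Form ℂ Γ(X, U.1) k) := projective_exteriorPower k
  refine mem_smul_top_of_forall_dual fun ℓ => ?_
  rw [RingHom.mem_ker]
  refine (basicOpen_eq_bot_iff _).1 ?_
  rw [Scheme.basicOpen_eq_bot_iff_forall_evaluation_eq_zero]
  intro y
  have h1 := evaluation_linear_eq_zero (show z y.1 ∈ U.1 from y.2) (h y.1 U y.2) ℓ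
  have h2 := Scheme.evaluation_naturality_apply z y.1 y.2 (ℓ (ω.val U - ω'.val U))
  rw [h1, map_zero] at h2
  exact h2.symm

end Agree

/-! ### Compatibility of the completed automorphisms with restriction. -/

section Naturality

variable {R A B : Type*} [CommRing R] [CommRing A] [CommRing B] [Algebra R A] [Algebra R B]
  {I : Ideal A} {J : Ideal B}

theorem evalₐ_mapCompletion (f : A →+* B) (h : I ≤ J.comap f) {n : ℕ} {x : AdicCompletion I A}
    {a : A} (ha : AdicCompletion.evalₐ I n x = Ideal.Quotient.mk (I ^ n) a) :
    AdicCompletion.evalₐ J n (mapCompletion f h x) = Ideal.Quotient.mk (J ^ n) (f a) := by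
  have hn (n : ℕ) : I ^ n ≤ (J ^ n).comap f := by
    rw [← Ideal.map_le_iff_le_comap, Ideal.map_pow]
    exact Ideal.pow_right_mono (Ideal.map_le_iff_le_comap.2 h) n
  have h1 : AdicCompletion.evalₐ J n (mapCompletion f h x) =
      Ideal.quotientMap (J ^ n) f (hn n) (AdicCompletion.evalₐ I n x) := by
    refine AdicCompletion.evalₐ_liftRingHom J
      (fun k => (Ideal.quotientMap (J ^ k) f (hn k)).comp
        (AdicCompletion.evalₐ I k : AdicCompletion I A →+* A ⧸ I ^ k)) (fun {m k} hle => ?_) n x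
    ext x
    induction x using AdicCompletion.induction_on with
    | _ r =>
      simp only [RingHom.comp_apply, RingHom.coe_coe, AdicCompletion.evalₐ_mk,
        Ideal.quotientMap_mk]
      exact congrArg (Ideal.quotientMap (J ^ m) f (hn m)) (AdicCompletion.Ideal.mk_eq_mk I hle r)
  rw [h1, ha, Ideal.quotientMap_mk]

theorem IsAdicFlow.mapCompletion_equiv {F : ℕ → A →ₗ[R] A} (hF : IsAdicFlow I F)
    {G : ℕ → B →ₗ[R] B} (hG : IsAdicFlow J G) (f : A →+* B) (h : I ≤ J.comap f)
    (hFG : ∀ n a, f (F n a) = G n (f a)) (x : AdicCompletion I A) :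
    mapCompletion f h (hF.equiv x) = hG.equiv (mapCompletion f h x) := by
  refine AdicCompletion.ext_evalₐ fun n => ?_
  obtain ⟨a, ha⟩ := Ideal.Quotient.mk_surjective (AdicCompletion.evalₐ I n x)
  have h1 : AdicCompletion.evalₐ I n (hF.equiv x) = _ :=
    (hF.evalₐ_equiv n x).trans ((congrArg (hF.level n) ha.symm).trans (hF.level_mk n a))
  rw [evalₐ_mapCompletion f h h1, hG.evalₐ_equiv, evalₐ_mapCompletion f h ha.symm, hG.level_mk,
    map_sum]
  simp only [hFG]

/-- Inducing the identity on the quotient gives equality of ideals, not just an inclusion, because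
the inverse has the same property. -/
theorem map_ker_eq_of_comp_eq {S T : Type*} [CommRing S] [CommRing T] [Algebra R S] (g : S →+* T)
    (e : S ≃ₐ[R] S) (h : ∀ x, g (e x) = g x) : (RingHom.ker g).map e = RingHom.ker g := by
  refine le_antisymm (Ideal.map_le_iff_le_comap.2 fun x hx => ?_) fun x hx => ?_
  · exact (h x).trans hx
  · rw [← e.apply_symm_apply x]
    refine Ideal.mem_map_of_mem e ?_
    rw [RingHom.mem_ker, ← h, e.apply_symm_apply]
    exact hx

end Naturality

/-! ### The global automorphism. -/

section Automorphism

variable {X Y : Scheme.{0}} [X.Over SpecC] [Y.Over SpecC] {π : X ⟶ Y} [π.IsOver SpecC]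

/-- The flow of Moser's vector field, as an automorphism of the formal completion. -/
def moserAut (E : VectorBundleStructure π) {ω₀ ω₁ : GlobalForm X 2} (h₀ : ω₀.IsSymplectic)
    (h₁ : ω₁.IsSymplectic)
    (h : ∀ U : X.affineOpens, ω₁.val U - ω₀.val U ∈
      (E.zeroSection.ker.ideal U • ⊤ : Submodule Γ(X, U.1) (Form ℂ Γ(X, U.1) 2))) :
    FormalAut E.zeroSection.ker where
  app U := ((isEuler_euler E U).isAdicFlow_moserSeries (h₀ U) (h₁ U) (h U)).equiv
  naturality {U V} hVU f :=
    IsAdicFlow.mapCompletion_equiv _ _ _ _ (fun n a =>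
      moserSeries_map (f := res hVU) (h₀ U) (h₀ V) (ω₀.compat hVU) (fun a => euler_res hVU a)
        (fun v => exists_res_derivation_extension U.2 V.2 hVU v) (h₁ U) (ω₁.compat hVU) n a) f

end Automorphism

end FormalMoser

end

theorem mainTheorem8
    {X Y : Scheme.{0}} [X.Over FormalMoser.SpecC] [Y.Over FormalMoser.SpecC]
    [Smooth (Y ↘ FormalMoser.SpecC)] [IsSeparated (Y ↘ FormalMoser.SpecC)]
    [QuasiCompact (Y ↘ FormalMoser.SpecC)]
    (π : X ⟶ Y) [π.IsOver FormalMoser.SpecC] (E : FormalMoser.VectorBundleStructure π)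
    (ω₀ ω₁ : FormalMoser.GlobalForm X 2) (h₀ : ω₀.IsSymplectic) (h₁ : ω₁.IsSymplectic)
    (h : ∀ y : Y, ω₀.AgreeAt ω₁ (E.zeroSection y)) :
    ∃ Φ : FormalMoser.FormalAut E.zeroSection.ker,
      (∀ U : X.affineOpens,
        (FormalMoser.completedIdeal E.zeroSection.ker U).map (Φ.app U) =
          FormalMoser.completedIdeal E.zeroSection.ker U) ∧
      (∀ (U : X.affineOpens) (f : FormalMoser.CompletedSheaf E.zeroSection.ker U),
        AdicCompletion.evalOneₐ (E.zeroSection.ker.ideal U) (Φ.app U f) =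
          AdicCompletion.evalOneₐ (E.zeroSection.ker.ideal U) f) ∧
      Φ.PullsBack ω₁ ω₀ := by
  have hX : Smooth (X ↘ FormalMoser.SpecC) := by
    have := E.smooth
    rw [← comp_over π FormalMoser.SpecC]
    exact smooth_comp _ _
  have hY : AlgebraicGeometry.IsReduced Y := FormalMoser.isReduced_of_smooth
  have hI (U : X.affineOpens) : ω₁.val U - ω₀.val U ∈ (E.zeroSection.ker.ideal U • ⊤ :
      Submodule Γ(X, U.1) (FormalMoser.Form ℂ Γ(X, U.1) 2)) := by
    -- The hypothesis concerns `ω₀ - ω₁`, whereas the path from `ω₀` to `ω₁` uses the opposite sign.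
    rw [E.zeroSection_ideal, ← neg_sub, Submodule.neg_mem_iff]
    exact FormalMoser.GlobalForm.sub_mem_of_agreeAt h U
  have hone (U : X.affineOpens) (f : FormalMoser.CompletedSheaf E.zeroSection.ker U) :
      AdicCompletion.evalOneₐ (E.zeroSection.ker.ideal U)
        ((FormalMoser.moserAut E h₀ h₁ hI).app U f) =
          AdicCompletion.evalOneₐ (E.zeroSection.ker.ideal U) f :=
    FormalMoser.IsAdicFlow.evalOneₐ_equiv _ f
  exact ⟨FormalMoser.moserAut E h₀ h₁ hI,
    fun U => FormalMoser.map_ker_eq_of_comp_eq _ _ (hone U), hone,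
    fun U => (FormalMoser.isEuler_euler E U).formalPullback_eq (h₀ U) (h₁ U) (hI U)⟩
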